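/- Let $\mathbb F=\mathbb R$ or $\mathbb C$, let $\gamma=(\gamma_1,\dots,\gamma_n)\in\mathbb F^n$ be a tuple whose entries are not all equal, $\Gamma=\mathrm{diag}(\gamma_1,\dots,\gamma_n)$, and let $\mathfrak t_\gamma(n)$ be the Lie algebra of upper triangular $n\times n$ matrices over $\mathbb F$ whose diagonal part is a multiple of $\Gamma$. Its canonical basis consists of the matrix units $e_{ij}$, $i<j$, and $f=\Gamma$. Let $\mathrm T_\gamma(n)$ be the group of upper triangular matrices $B$ with $b_{ii}=e^{\gamma_i\varepsilon}$ for some $\varepsilon\in\mathbb F$; it acts on the dual space $\mathfrak t_\gamma(n)^*$ by $\langle \mathrm{Ad}^*_Bx,Y\rangle=\langle x,B^{-1}YB\rangle$. Let $x_0$, $x_{ji}$ $(i<j)$ be the coordinates of $x\in\mathfrak t_\gamma(n)^*$, i.e. the values of $x$ on $f$ and $e_{ij}$. A functional basis of the invariants of this action on an open set $U\subset\mathfrak t_\gamma(n)^*$ is a finite family of smooth (holomorphic if $\mathbb F=\mathbb C$) functions on $U$ that are invariant (constant along $\mathrm{Ad}^*_{B_t}x$ for every path $B_t$ in $\mathrm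 T_\gamma(n)$ starting at the identity along which $\mathrm{Ad}^*_{B_t}x$ stays in $U$), whose differentials are linearly independent at every point of $U$, and such that every smooth invariant function on an open subset of $U$ is locally a smooth function of them. A basis of $\mathrm{Inv}(\mathfrak t_\gamma(n))$ (generalized Casimir invariants) is the family of expressions in the elements $e_{ij}$, $f$ obtained from a functional basis by symmetrization (replacement of coordinates by the corresponding basis elements, monomials in noncommuting elements being replaced by the average of the products in all orders). For a matrix $A$ let $A^{i_1,i_2}_{j_1,j_2}=(a_{ij})^{i=i_1,\dots,i_2}_{j=j_1,\dots,j_2}$ and $|A|=\det A$. Put $\varkappa=n-k+1$, $\varkappa_0=n-k_0+1$, and let $\mathcal E$ be the matrix with the entries $e_{ij}$ for $i<j$ and $0$ otherwise. Let $\Omega\subset\mathfrak t_\gamma(n)^*$ be the set, open and dense, where the values of all the minors $|\mathcal E^{1,k}_{\varkappa,n}|$, $k=1,\dots,[n/2]$, computed with $x_{ji}$ in place of $e_{ij}$, are nonzero. 1) If $\gamma_k=\gamma_\varkappa$ for all $k\in\{1,\dots,[n/2]\}$, then a basis of $\mathrm{Inv}(\mathfrak t_\gamma(n))$, with functional basis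 on $\Omega$, consists of the $[n/2]+1$ expressions \[ |\mathcal E^{1,k}_{\varkappa,n}|,\quad k=1,\dots,\left[\tfrac n2\right],\qquad f+\sum_{k=1}^{[n/2]}\frac{(-1)^{k+1}}{|\mathcal E^{1,k}_{\varkappa,n}|}(\gamma_k-\gamma_{k+1})\sum_{i=k+1}^{n-k} \left|\begin{array}{cc}\mathcal E^{1,k}_{i,i}&\mathcal E^{1,k}_{\varkappa,n}\\ 0&\mathcal E^{i,i}_{\varkappa,n}\end{array}\right| , \] where in all monomials of the last determinants a uniform order of the factors from $\mathcal E^{1,k}_{i,i}$ and from $\mathcal E^{i,i}_{\varkappa,n}$ is used: either always the former before the latter, or always after, or the average of both orders. 2) Otherwise let $k_0$ be the minimal $k\in\{1,\dots,[n/2]\}$ with $\gamma_k\ne\gamma_\varkappa$, and \[ \alpha_k=-\sum_{i=k_0}^{k}\frac{\gamma_{n-i+1}-\gamma_i}{\gamma_{n-k_0+1}-\gamma_{k_0}} . \] Then a basis of $\mathrm{Inv}(\mathfrak t_\gamma(n))$ consists of the $[n/2]-1$ expressions \[ |\mathcal E^{1,k}_{\varkappa,n}|,\quad k=1,\dots,k_0-1,\qquad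 |\mathcal E^{1,k_0}_{\varkappa_0,n}|^{\alpha_k}\,|\mathcal E^{1,k}_{\varkappa,n}|,\quad k=k_0+1,\dots,\left[\tfrac n2\right]. \] Here, for any open set $V\subset\mathbb F\setminus\{0\}$, the powers $z^{\alpha_k}$ may be any branches on $V$, up to locally constant nonzero factors (for $\mathbb F=\mathbb R$ one may take $|z|^{\alpha_k}$ on $V=\mathbb R\setminus\{0\}$), and the functional basis is considered on the part of $\Omega$ where the value of the minor $|\mathcal E^{1,k_0}_{\varkappa_0,n}|$ lies in $V$. -/

import Mathlib

open scoped ContDiff Topology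

noncomputable section

namespace TriLie

attribute [local instance 100] LieRing.ofAssociativeRing

variable {𝔽 : Type*} [RCLike 𝔽] {n : ℕ}

/-! ### The Lie algebra, its canonical basis and the group -/

/-- Diagonal entries of a product of two upper triangular matrices. -/
theorem upper_mul_diag {A B : Matrix (Fin n) (Fin n) 𝔽} (hA : ∀ i j, j < i → A i j = 0)
    (hB : ∀ i j, j < i → B i j = 0) (i : Fin n) : (A * B) i i = A i i * B i i := by
  rw [Matrix.mul_apply]
  refine Finset.sum_eq_single i (fun j _ hj => ?_) (fun h => absurd (Finset.mem_univ i) h)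
  rcases lt_or_gt_of_ne hj with h | h
  · rw [hA i j h, zero_mul]
  · rw [hB j i h, mul_zero]

/-- A product of two upper triangular matrices is upper triangular. -/
theorem upper_mul {A B : Matrix (Fin n) (Fin n) 𝔽} (hA : ∀ i j, j < i → A i j = 0)
    (hB : ∀ i j, j < i → B i j = 0) (i j : Fin n) (hij : j < i) : (A * B) i j = 0 := by
  rw [Matrix.mul_apply]
  refine Finset.sum_eq_zero (fun k _ => ?_)
  rcases lt_or_ge k i with h | h
  · rw [hA i k h, zero_mul]
  · rw [hB k j (lt_of_lt_of_le hij h), mul_zero]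

/-- The Lie algebra `𝔱_γ(n)`: the upper triangular `n × n` matrices whose diagonal part is a
multiple of `Γ = diag(γ₁, …, γₙ)`, with the commutator as bracket. -/
def tgamma (γ : Fin n → 𝔽) : LieSubalgebra 𝔽 (Matrix (Fin n) (Fin n) 𝔽) where
  carrier := {Y | (∀ i j, j < i → Y i j = 0) ∧ ∃ c : 𝔽, ∀ i, Y i i = c * γ i}
  zero_mem' := ⟨fun _ _ _ => rfl, 0, fun i => by simp⟩
  add_mem' := by
    rintro A B ⟨hA, a, ha⟩ ⟨hB, b, hb⟩
    refine ⟨fun i j h => by simp [hA i j h, hB i j h], a + b, fun i => ?_⟩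
    simp [ha i, hb i, add_mul]
  smul_mem' := by
    rintro c A ⟨hA, a, ha⟩
    refine ⟨fun i j h => by simp [hA i j h], c * a, fun i => ?_⟩
    simp [ha i, mul_assoc]
  lie_mem' := by
    rintro A B ⟨hA, a, ha⟩ ⟨hB, b, hb⟩
    refine ⟨fun i j h => ?_, 0, fun i => ?_⟩
    · rw [Ring.lie_def, Matrix.sub_apply, upper_mul hA hB i j h, upper_mul hB hA i j h, sub_zero]
    · rw [Ring.lie_def, Matrix.sub_apply, upper_mul_diag hA hB, upper_mul_diag hB hA]
      ring

/-- Labels of the canonical basis: `none` for `f`, and `some ⟨(i, j), _⟩` with `i < j` for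
`e_ij`. -/
abbrev Idx (n : ℕ) : Type := Option {p : Fin n × Fin n // p.1 < p.2}

/-- The canonical generators: `f = Γ` and the matrix units `e_ij`, `i < j`. -/
def gen (γ : Fin n → 𝔽) : Idx n → tgamma γ
  | none => ⟨Matrix.diagonal γ,
      fun i j h => Matrix.diagonal_apply_ne γ (ne_of_gt h), 1, fun i => by simp⟩
  | some p => ⟨Matrix.single p.1.1 p.1.2 1, fun i j h => by
        rw [Matrix.single_apply, if_neg]
        rintro ⟨rfl, rfl⟩
        exact lt_asymm h p.2, 0, fun i => by
        rw [Matrix.single_apply, if_neg, zero_mul]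
        rintro ⟨h1, h2⟩
        exact absurd p.2 (by rw [h1, h2]; exact lt_irrefl _)⟩

theorem sum_gen_diag (γ : Fin n → 𝔽) (y : Idx n → 𝔽) (i : Fin n) :
    ((∑ a, y a • gen γ a : tgamma γ) : Matrix (Fin n) (Fin n) 𝔽) i i = y none * γ i := by
  rw [Fintype.sum_option]
  have h : ∀ (p : {p : Fin n × Fin n // p.1 < p.2}) (c : 𝔽),
      (Matrix.single p.1.1 p.1.2 c) i i = 0 := fun p c => by
    rw [Matrix.single_apply, if_neg]
    rintro ⟨h1, h2⟩
    exact absurd p.2 (by rw [h1, h2]; exact lt_irrefl _)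
  simp [gen, Matrix.sum_apply, h]

theorem sum_gen_upper (γ : Fin n → 𝔽) (y : Idx n → 𝔽) (i j : Fin n) (hij : i < j) :
    ((∑ a, y a • gen γ a : tgamma γ) : Matrix (Fin n) (Fin n) 𝔽) i j
      = y (some ⟨(i, j), hij⟩) := by
  rw [Fintype.sum_option]
  have h : ∀ (p : {p : Fin n × Fin n // p.1 < p.2}) (c : 𝔽),
      (Matrix.single p.1.1 p.1.2 c) i j = if p = ⟨(i, j), hij⟩ then c else 0 := fun p c => by
    rw [Matrix.single_apply]
    refine if_congr ?_ rfl rfl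
    rw [Subtype.ext_iff, Prod.ext_iff]
  simp [gen, Matrix.sum_apply, h, Matrix.diagonal_apply_ne γ (ne_of_lt hij)]

/-- The canonical basis of `𝔱_γ(n)`; `Γ` has to be non-proportional to the identity matrix. -/
def tbasis (γ : Fin n → 𝔽) (hγ : ∃ i j, γ i ≠ γ j) : Module.Basis (Idx n) 𝔽 (tgamma γ) :=
  Module.Basis.mk (v := gen γ)
    (by
      rw [Fintype.linearIndependent_iff]
      intro y hy
      obtain ⟨i, hi⟩ : ∃ i, γ i ≠ 0 := by
        by_contra! h
        obtain ⟨i, j, hij⟩ := hγ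
        exact hij ((h i).trans (h j).symm)
      rintro (_ | ⟨⟨k, l⟩, hkl⟩)
      · have := sum_gen_diag γ y i
        rw [hy] at this
        simpa [hi] using this.symm
      · have := sum_gen_upper γ y k l hkl
        rw [hy] at this
        simpa using this.symm)
    (by
      rintro ⟨Y, hY, c, hc⟩ -
      have : (⟨Y, hY, c, hc⟩ : tgamma γ)
          = ∑ a, (a.elim c fun p => Y p.1.1 p.1.2 : 𝔽) • gen γ a := by
        apply Subtype.ext
        ext i j
        rcases lt_trichotomy i j with h | rfl | h
        · rw [sum_gen_upper γ _ i j h]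
          rfl
        · rw [sum_gen_diag]
          exact hc i
        · rw [(∑ a, (a.elim c fun p => Y p.1.1 p.1.2 : 𝔽) • gen γ a : tgamma γ).2.1 i j h]
          exact hY i j h
      rw [this]
      exact Submodule.sum_mem _ fun a _ =>
        Submodule.smul_mem _ _ (Submodule.subset_span ⟨a, rfl⟩))

theorem tbasis_apply (γ : Fin n → 𝔽) (hγ : ∃ i j, γ i ≠ γ j) (a : Idx n) :
    tbasis γ hγ a = gen γ a := by
  simp [tbasis]

/-- The group `T_γ(n)` of the upper triangular matrices `B` with `b_ii = exp(γ_i ε)` for some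
`ε ∈ 𝔽`. The parameter `ε` is kept, so that `(B, ε)` are the coordinates of the Lie group. -/
structure TGroup (γ : Fin n → 𝔽) where
  /-- the matrix `B` -/
  mat : Matrix (Fin n) (Fin n) 𝔽
  /-- the parameter `ε` -/
  eps : 𝔽
  upper : ∀ i j, j < i → mat i j = 0
  diag : ∀ i, mat i i = NormedSpace.exp (γ i * eps)

/-- The topology given by the coordinates `(B, ε)`. -/
instance (γ : Fin n → 𝔽) : TopologicalSpace (TGroup γ) :=
  TopologicalSpace.induced (fun B => (B.mat, B.eps)) inferInstance

/-- The neutral element. -/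
instance (γ : Fin n → 𝔽) : One (TGroup γ) :=
  ⟨⟨1, 0, fun _ _ h => Matrix.one_apply_ne (ne_of_gt h), fun i => by simp⟩⟩

theorem TGroup.isUnit_det {γ : Fin n → 𝔽} (B : TGroup γ) : IsUnit B.mat.det := by
  have h : B.mat.det = ∏ i, B.mat i i :=
    Matrix.det_of_isUpperTriangular (fun i j hij => B.upper i j hij)
  rw [h, isUnit_iff_ne_zero, Finset.prod_ne_zero_iff]
  intro i _
  rw [B.diag i]
  exact (NormedSpace.isUnit_exp (γ i * B.eps)).ne_zero

theorem TGroup.inv_upper {γ : Fin n → 𝔽} (B : TGroup γ) (i j : Fin n) (hij : j < i) :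
    B.mat⁻¹ i j = 0 := by
  have : Invertible B.mat := Matrix.invertibleOfIsUnitDet _ B.isUnit_det
  exact Matrix.blockTriangular_inv_of_blockTriangular (b := id)
    (fun i j hij => B.upper i j hij) hij

/-- `Ad_{B⁻¹} : Y ↦ B⁻¹ Y B` on `𝔱_γ(n)`. -/
def TGroup.adInv {γ : Fin n → 𝔽} (B : TGroup γ) : tgamma γ →ₗ[𝔽] tgamma γ where
  toFun Y := ⟨B.mat⁻¹ * Y.1 * B.mat, by
    obtain ⟨Y, hY, c, hc⟩ := Y
    have h1 := upper_mul B.inv_upper hY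
    refine ⟨upper_mul h1 B.upper, c, fun i => ?_⟩
    have h2 : B.mat⁻¹ i i * B.mat i i = 1 := by
      rw [← upper_mul_diag B.inv_upper B.upper, Matrix.nonsing_inv_mul _ B.isUnit_det,
        Matrix.one_apply_eq]
    rw [upper_mul_diag h1 B.upper, upper_mul_diag B.inv_upper hY, ← hc i]
    calc B.mat⁻¹ i i * Y i i * B.mat i i = (B.mat⁻¹ i i * B.mat i i) * Y i i := by ring
      _ = Y i i := by rw [h2, one_mul]⟩
  map_add' Y Z := by
    apply Subtype.ext
    simp [mul_add, add_mul]
  map_smul' c Y := by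
    apply Subtype.ext
    simp

/-! ### The coadjoint action and its invariants

A point of the dual space `𝔱_γ(n)*` is given by its coordinates `x : Idx n → 𝔽`, the values of
the functional on the canonical basis: `x none` is `x₀` and `x (some ⟨(i, j), _⟩)` is `x_ji`. -/

/-- The coadjoint action in coordinates: `⟨Ad*_B x, Y⟩ = ⟨x, B⁻¹ Y B⟩`. -/
def coad {γ : Fin n → 𝔽} (hγ : ∃ i j, γ i ≠ γ j) (B : TGroup γ) (x : Idx n → 𝔽) : Idx n → 𝔽 :=
  fun a => (tbasis γ hγ).constr 𝔽 x (B.adInv (tbasis γ hγ a))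

/-- `F` is an invariant of the coadjoint action on the domain `U`: if `B ∈ T_γ(n)` is joined to
the neutral element by a path `B_t` such that `Ad*_{B_t} x` does not leave `U`, then
`F (Ad*_B x) = F x`. If `U` is stable under the (path connected) group, this says that
`F (Ad*_B x) = F x` for all `B ∈ T_γ(n)` and `x ∈ U`. -/
def IsInvariantOn {γ : Fin n → 𝔽} (hγ : ∃ i j, γ i ≠ γ j) (U : Set (Idx n → 𝔽))
    (F : (Idx n → 𝔽) → 𝔽) : Prop :=
  ∀ (x : Idx n → 𝔽) (B : unitInterval → TGroup γ), Continuous B → B 0 = 1 →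
    (∀ t, coad hγ (B t) x ∈ U) → F (coad hγ (B 1) x) = F x

/-- `F_l`, `l ∈ L`, is a functional basis of the invariants of the coadjoint action on `U`:
the `F_l` are smooth (holomorphic if `𝔽 = ℂ`) invariants, they are functionally independent, and
every invariant on an open subset of `U` is locally a smooth function of them. -/
structure IsFunctionalBasis {γ : Fin n → 𝔽} (hγ : ∃ i j, γ i ≠ γ j) (U : Set (Idx n → 𝔽))
    {L : Type} [Fintype L] (F : L → (Idx n → 𝔽) → 𝔽) : Prop where
  isOpen : IsOpen U
  smooth : ∀ l, ContDiffOn 𝔽 ∞ (F l) U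
  invariant : ∀ l, IsInvariantOn hγ U (F l)
  independent : ∀ x ∈ U, LinearIndependent 𝔽 (fun l => fderiv 𝔽 (F l) x)
  complete : ∀ (W : Set (Idx n → 𝔽)) (G : (Idx n → 𝔽) → 𝔽), IsOpen W → W ⊆ U →
    ContDiffOn 𝔽 ∞ G W → IsInvariantOn hγ W G → ∀ x ∈ W, ∃ H : (L → 𝔽) → 𝔽,
      ContDiffAt 𝔽 ∞ H (fun l => F l x) ∧ ∀ᶠ y in 𝓝 x, G y = H (fun l => F l y)

/-! ### Symmetrization and invariants of the Lie algebra -/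

/-- The universal enveloping algebra of `𝔱_γ(n)`. -/
abbrev UEA (γ : Fin n → 𝔽) := UniversalEnvelopingAlgebra 𝔽 (tgamma γ)

/-- The generators `f` and `e_ij` as elements of the universal enveloping algebra. -/
def ugen (γ : Fin n → 𝔽) (a : Idx n) : UEA γ := UniversalEnvelopingAlgebra.ι 𝔽 (gen γ a)

/-- The average `(1/r!) ∑_σ u(a_{σ 1}) ⋯ u(a_{σ r})` of the products of the generators with the
labels `a₁, …, a_r` over all orders. -/
def avgProd (γ : Fin n → 𝔽) (l : List (Idx n)) : UEA γ :=
  ((l.length.factorial : 𝔽)⁻¹) • ∑ σ : Equiv.Perm (Fin l.length),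
    (List.ofFn fun i => ugen γ (l.get (σ i))).prod

/-- The symmetrization map from the polynomials in the coordinates on the dual space to the
universal enveloping algebra. -/
def symmetrize (γ : Fin n → 𝔽) : MvPolynomial (Idx n) 𝔽 →ₗ[𝔽] UEA γ :=
  (MvPolynomial.basisMonomials (Idx n) 𝔽).constr 𝔽 fun s => avgProd γ (Finsupp.toMultiset s).toList

/-- A formal expression `∑_j φ_j(c_j) u_j` in the elements of the Lie algebra; `c_j` and `u_j` are
elements of the universal enveloping algebra and `φ_j` is a function of one variable
(for example, an inversion or a power). -/
structure AlgExpr (γ : Fin n → 𝔽) where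
  /-- labels of the summands -/
  κ : Type
  [fin : Fintype κ]
  /-- the functions `φ_j` -/
  φ : κ → 𝔽 → 𝔽
  /-- the arguments `c_j` -/
  c : κ → UEA γ
  /-- the cofactors `u_j` -/
  u : κ → UEA γ

attribute [instance] AlgExpr.fin

/-- `E` is the symmetrization of the function `F` on the dual space:
`F = ∑_j φ_j(p_j) q_j` with polynomials `p_j`, `q_j` such that `c_j = Sym p_j` and `u_j = Sym q_j`.
In each summand the basis elements associated with the coordinates in `p_j` commute with each
other and with those associated with the coordinates in `q_j`, so that the symmetrization acts
nontrivially on `q_j` only. -/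
def IsSymmetrization {γ : Fin n → 𝔽} (E : AlgExpr γ) (F : (Idx n → 𝔽) → 𝔽) : Prop :=
  ∃ p q : E.κ → MvPolynomial (Idx n) 𝔽,
    (∀ j, symmetrize γ (p j) = E.c j ∧ symmetrize γ (q j) = E.u j) ∧
    (∀ j, ∀ a ∈ (p j).vars, ∀ b ∈ (p j).vars ∪ (q j).vars, ⁅gen γ a, gen γ b⁆ = 0) ∧
    F = fun x => ∑ j, E.φ j (MvPolynomial.eval x (p j)) * MvPolynomial.eval x (q j)

/-- The expressions `E_l`, `l ∈ L`, form a basis of the set `Inv(𝔱_γ(n))` of invariants of the Lie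
algebra: they are the symmetrizations of the elements of a functional basis of the invariants of
the coadjoint action, considered on the domain `U` of the dual space. -/
def IsInvBasis {γ : Fin n → 𝔽} (hγ : ∃ i j, γ i ≠ γ j) (U : Set (Idx n → 𝔽))
    {L : Type} [Fintype L] (E : L → AlgExpr γ) : Prop :=
  ∃ F : L → (Idx n → 𝔽) → 𝔽,
    (∀ l, IsSymmetrization (E l) (F l)) ∧ IsFunctionalBasis hγ U F

/-! ### The matrices and determinants

An index `k : Fin (n / 2)` with value `k` stands for the number `k + 1 ∈ {1, …, [n/2]}`. -/

/-- The strictly upper triangular `n × n` matrix with the entries `v_ij`, `i < j`, completed with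
zeros. For `v = ugen γ` this is the matrix `𝓔 = (e_ij)`, for `v = x` it is the transpose of
the matrix `X = (x_ji)` of the coordinates. -/
def upperMat {A : Type*} [Zero A] (v : Idx n → A) : Matrix (Fin n) (Fin n) A :=
  Matrix.of fun i j => if h : i < j then v (some ⟨(i, j), h⟩) else 0

/-- `k : Fin (n / 2)` as an index of rows. -/
def row (k : Fin (n / 2)) : Fin n := ⟨k, by omega⟩

/-- The `n`-tuple index following `row k`. -/
def rowSucc (k : Fin (n / 2)) : Fin n := ⟨k + 1, by omega⟩

/-- The row indices `1, …, k`. -/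
def firstRows (k : Fin (n / 2)) (a : Fin (k + 1)) : Fin n := ⟨a, by omega⟩

/-- The column indices `n - k + 1, …, n`. -/
def lastCols (k : Fin (n / 2)) (b : Fin (k + 1)) : Fin n := ⟨n - (k + 1) + b, by omega⟩

/-- The submatrix `M^{1,k}_{n-k+1,n}`. -/
def corner {A : Type*} (M : Matrix (Fin n) (Fin n) A) (k : Fin (n / 2)) :
    Matrix (Fin (k + 1)) (Fin (k + 1)) A :=
  Matrix.of fun a b => M (firstRows k a) (lastCols k b)

/-- The `(k+1) × (k+1)` block matrix with the rows `(M^{1,k}_{i,i}, M^{1,k}_{n-k+1,n})` and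
`(0, M^{i,i}_{n-k+1,n})`. -/
def bordered {A : Type*} [Zero A] (M : Matrix (Fin n) (Fin n) A) (k : Fin (n / 2)) (i : Fin n) :
    Matrix (Fin (k + 1 + 1)) (Fin (k + 1 + 1)) A :=
  Matrix.of fun a b => Fin.lastCases (motive := fun _ => A)
    (Fin.cases (motive := fun _ => A) 0 (fun b' => M i (lastCols k b')) b)
    (fun a' => Fin.cases (motive := fun _ => A) (M (firstRows k a') i)
      (fun b' => M (firstRows k a') (lastCols k b')) b) a

/-- The uniform order of the factors in the monomials of a determinant with noncommuting entries:
by increasing column, by decreasing column, or the average of both. In the determinant of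
`bordered` these put the elements of the first column before the elements of the last row, after
them, or symmetrize each pair of them; all the other factors commute. -/
inductive FactorOrder
  | before
  | after
  | averaged

/-- `∑_σ sgn(σ) ∏_b M_{σ(b) b}`, the factors being ordered by increasing `b`. -/
def detBefore {A : Type*} [Ring A] {m : ℕ} (M : Matrix (Fin m) (Fin m) A) : A :=
  ∑ σ : Equiv.Perm (Fin m), ((Equiv.Perm.sign σ : ℤˣ) : ℤ) •
    (List.ofFn fun b => M (σ b) b).prod

/-- `∑_σ sgn(σ) ∏_b M_{σ(b) b}`, the factors being ordered by decreasing `b`. -/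
def detAfter {A : Type*} [Ring A] {m : ℕ} (M : Matrix (Fin m) (Fin m) A) : A :=
  ∑ σ : Equiv.Perm (Fin m), ((Equiv.Perm.sign σ : ℤˣ) : ℤ) •
    (List.ofFn fun b => M (σ b) b).reverse.prod

/-- The determinant in the universal enveloping algebra for a given order of the factors. -/
def udet {γ : Fin n → 𝔽} (o : FactorOrder) {m : ℕ} (M : Matrix (Fin m) (Fin m) (UEA γ)) : UEA γ :=
  match o with
  | .before => detBefore M
  | .after => detAfter M
  | .averaged => (2⁻¹ : 𝔽) • (detBefore M + detAfter M)

/-- The domain of the dual space where all the minors `|X^{n-k+1,n}_{1,k}|`, `k = 1, …, [n/2]`,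
are nonzero. -/
def regularDomain (𝔽 : Type*) [RCLike 𝔽] (n : ℕ) : Set (Idx n → 𝔽) :=
  {x | ∀ k : Fin (n / 2), (corner (upperMat x) k).det ≠ 0}

/-! ### The expressions forming the bases -/

/-- The expression `|𝓔^{1,k}_{n-k+1,n}|`. -/
def minorExpr (γ : Fin n → 𝔽) (o : FactorOrder) (k : Fin (n / 2)) : AlgExpr γ where
  κ := Unit
  φ _ _ := 1
  c _ := 1
  u _ := udet o (corner (upperMat (ugen γ)) k)

/-- The expression
`f + ∑_k (-1)^{k+1} |𝓔^{1,k}_{n-k+1,n}|⁻¹ (γ_k - γ_{k+1}) ∑_{i=k+1}^{n-k} |bordered 𝓔 k i|`. -/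
def nilindepExpr (γ : Fin n → 𝔽) (o : FactorOrder) : AlgExpr γ where
  κ := Option (Fin (n / 2))
  φ
    | none => fun _ => 1
    | some k => fun z => (-1) ^ ((k : ℕ) + 1 + 1) / z * (γ (row k) - γ (rowSucc k))
  c
    | none => 1
    | some k => udet o (corner (upperMat (ugen γ)) k)
  u
    | none => ugen γ none
    | some k => ∑ i ∈ Finset.univ.filter (fun i : Fin n => (k : ℕ) < i ∧ (i : ℕ) + k + 1 < n),
        udet o (bordered (upperMat (ugen γ)) k i)

/-- The basis in the singular case: the minors (`some k`) and one more expression (`none`). -/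
def singularBasis (γ : Fin n → 𝔽) (o : FactorOrder) : Option (Fin (n / 2)) → AlgExpr γ
  | none => nilindepExpr γ o
  | some k => minorExpr γ o k

/-- The exponents
`α_k = - ∑_{i=k₀}^{k} (γ_{n-i+1} - γ_i) / (γ_{n-k₀+1} - γ_{k₀})`. -/
def alpha (γ : Fin n → 𝔽) (k₀ k : Fin (n / 2)) : 𝔽 :=
  -∑ i ∈ Finset.Icc k₀ k,
    (γ (Fin.rev (row i)) - γ (row i)) / (γ (Fin.rev (row k₀)) - γ (row k₀))

/-- `P` is a branch of the power function `z ↦ z^α` on `V`: a nowhere vanishing function with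
`P' = α P / z`, i.e. a branch of `z^α` up to a locally constant nonzero factor. This covers
`z^α = exp(α ln z)` with any branch of the logarithm over `ℂ`, `|z|^α` over `ℝ`, integer powers,
and powers of negative real numbers with rational exponents of odd denominators. -/
def IsPowerBranch (α : 𝔽) (V : Set 𝔽) (P : 𝔽 → 𝔽) : Prop :=
  ∀ z ∈ V, z ≠ 0 ∧ P z ≠ 0 ∧ HasDerivAt P (α * P z / z) z

theorem isPowerBranch_abs (α : ℝ) : IsPowerBranch α {z : ℝ | z ≠ 0} (fun z => |z| ^ α) := by
  intro z hz
  have hz' : 0 < |z| := abs_pos.mpr hz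
  have h0 : (|z| : ℝ) ^ α ≠ 0 := (Real.rpow_pos_of_pos hz' α).ne'
  refine ⟨hz, h0, ?_⟩
  refine HasDerivAt.congr_deriv
    ((hasDerivAt_abs hz).rpow_const (p := α) (Or.inl hz'.ne')) ?_
  rw [Real.rpow_sub_one hz'.ne']
  rcases lt_or_gt_of_ne (show z ≠ 0 from hz) with h | h
  · simp only [abs_of_neg h, sign_neg h, SignType.coe_neg_one]
    field_simp
  · simp only [abs_of_pos h, sign_pos h, SignType.coe_one]
    field_simp

theorem isPowerBranch_cpow (α : ℂ) : IsPowerBranch α Complex.slitPlane (fun z => z ^ α) := by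
  intro z hz
  have h0 : z ≠ 0 := Complex.slitPlane_ne_zero hz
  refine ⟨h0, by simp [Complex.cpow_eq_zero_iff, h0], ?_⟩
  refine HasDerivAt.congr_deriv ((hasDerivAt_id z).cpow_const (c := α) hz) ?_
  simp only [id]
  rw [Complex.cpow_sub _ _ h0, Complex.cpow_one]
  field_simp

/-- The expression `|𝓔^{1,k₀}_{n-k₀+1,n}|^{α_k} |𝓔^{1,k}_{n-k+1,n}|`, the power being given by
the function `P`. -/
def powerExpr (γ : Fin n → 𝔽) (o : FactorOrder) (k₀ k : Fin (n / 2)) (P : 𝔽 → 𝔽) : AlgExpr γ where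
  κ := Unit
  φ _ := P
  c _ := udet o (corner (upperMat (ugen γ)) k₀)
  u _ := udet o (corner (upperMat (ugen γ)) k)

/-- The basis in the regular case: the minors for `k < k₀` and the products for `k > k₀`. -/
def regularBasis (γ : Fin n → 𝔽) (o : FactorOrder) (k₀ : Fin (n / 2))
    (P : Fin (n / 2) → 𝔽 → 𝔽) (k : {k : Fin (n / 2) // k ≠ k₀}) : AlgExpr γ :=
  if k.1 < k₀ then minorExpr γ o k.1 else powerExpr γ o k₀ k.1 (P k.1)

end TriLie

end

open TriLie

/-!
In matrix form the coadjoint action sends the strictly upper triangular matrix `M = upperMat x` to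
the part above the diagonal of `(B⁻¹)ᵀ M Bᵀ`, and adds to `x₀` a combination of the diagonal
entries of that matrix (`upperMat_coad`, `coad_none`). Since `(B⁻¹)ᵀ` and `Bᵀ` are lower triangular,
the corner of size `k` is multiplied by triangular blocks, so its determinant is multiplied by
`exp (ε w_k)` with `w_k = ∑_{i ≤ k} (γ_{n-i+1} - γ_i)` (`minor_coad`).

*Invariants.* If `γ_k = γ_{n-k+1}` for all `k`, then all `w_k` vanish and the minors are invariant.
The bordered determinants divided by the minors are, up to sign, the diagonal entries of
`M P_k M`, where `P_k` is the inverse of the corner placed in the opposite block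
(`det_bordered`, `midMat`). The trace of `M P_k M` is unchanged by conjugation, and Abel summation
over `k` converts the change of `x₀` into changes of these traces, so that the expression linear
in `x₀` is invariant (`midInv_coad`). In the other case the exponents `α_k` satisfy
`α_k w_{k₀} + w_k = 0`; a branch `P` of the power obeys `P (e^s z) = e^{α s} P z` along a path
(`IsPowerBranch.apply_exp_mul`), so the products are invariant.

*Completeness.* By the submersion theorem, invariants `F_l` with independent differentials form a
functional basis as soon as at every point every functional that kills the tangent space of the
orbit is a combination of the differentials of the `F_l` (`isFunctionalBasis_of_span`): the orbit
directions together with a transversal slice parametrized by the `F_l` fill a neighbourhood. The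
functionals killing the orbit of the nilradical and vanishing on `∂/∂x₀` and on the antidiagonal
directions are zero where the corner minors do not vanish (`eq_zero_of_stabilizer`), and the
differentials of the minors are triangular with respect to the antidiagonal directions;
hence these differentials span (`exists_eq_sum_fderiv_minor`).

*Symmetrization.* The elements in a corner commute, so there symmetrization changes nothing. In a
monomial of a bordered determinant at most one pair of factors, `e_{ai}` from the first column and
`e_{ib}` from the last row, does not commute; the commutator `e_{ab}` lies in the corner and
commutes with the rest. Hence the average over all orders is the average of the two orders of this
pair, and a uniform order differs from it, up to sign, by half of the sum of the determinants in
which the pair is replaced by its commutator. These add up to a constant multiple of the corner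
minor (`det_bracketMat`, `symmetrize_borderedPoly`), which after division by the minor changes the
invariant by an additive constant only.
-/

open scoped ContDiff Topology

namespace TriLie

attribute [local instance 100] LieRing.ofAssociativeRing

variable {𝔽 : Type*} [RCLike 𝔽] {n : ℕ}

/-! ### The coadjoint action in matrix form -/

theorem upperMat_apply_of_lt {A : Type*} [Zero A] (v : Idx n → A) {i j : Fin n} (h : i < j) :
    upperMat v i j = v (some ⟨(i, j), h⟩) := by
  simp [upperMat, h]

theorem upperMat_apply_of_le {A : Type*} [Zero A] (v : Idx n → A) {i j : Fin n} (h : j ≤ i) :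
    upperMat v i j = 0 := by
  simp [upperMat, not_lt.mpr h]

/-- The matrix `(B⁻¹)ᵀ M Bᵀ`. For `M = upperMat x` its entries above the diagonal are coordinates of
`Ad*_B x`, and its diagonal determines how the coordinate `x₀` changes. -/
noncomputable def conjTr {γ : Fin n → 𝔽} (B : TGroup γ) (M : Matrix (Fin n) (Fin n) 𝔽) :
    Matrix (Fin n) (Fin n) 𝔽 :=
  (B.mat⁻¹).transpose * M * B.mat.transpose

theorem sum_mul_eq_trace (M Y : Matrix (Fin n) (Fin n) 𝔽) :
    ∑ i, ∑ j, M i j * Y i j = (M.transpose * Y).trace := by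
  rw [Finset.sum_comm]
  simp [Matrix.trace, Matrix.mul_apply]

theorem sum_mul_conj {γ : Fin n → 𝔽} (B : TGroup γ) (M Y : Matrix (Fin n) (Fin n) 𝔽) :
    ∑ i, ∑ j, M i j * (B.mat⁻¹ * Y * B.mat) i j = ∑ i, ∑ j, conjTr B M i j * Y i j := by
  rw [sum_mul_eq_trace, sum_mul_eq_trace, conjTr]
  simp only [Matrix.transpose_mul, Matrix.transpose_transpose]
  rw [← Matrix.mul_assoc, Matrix.trace_mul_comm]
  simp only [Matrix.mul_assoc]

theorem repr_none_mul {γ : Fin n → 𝔽} (hγ : ∃ i j, γ i ≠ γ j) (Y : tgamma γ) (i : Fin n) :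
    (tbasis γ hγ).repr Y none * γ i = (Y : Matrix (Fin n) (Fin n) 𝔽) i i := by
  conv_rhs => rw [← (tbasis γ hγ).sum_repr Y]
  simp only [tbasis_apply]
  rw [sum_gen_diag]

theorem repr_none_congr {γ : Fin n → 𝔽} (hγ : ∃ i j, γ i ≠ γ j) {Y Z : tgamma γ}
    (h : ∀ i, (Y : Matrix (Fin n) (Fin n) 𝔽) i i = (Z : Matrix (Fin n) (Fin n) 𝔽) i i) :
    (tbasis γ hγ).repr Y none = (tbasis γ hγ).repr Z none := by
  obtain ⟨i, hi⟩ : ∃ i, γ i ≠ 0 := by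
    by_contra! h
    obtain ⟨i, j, hij⟩ := hγ
    exact hij ((h i).trans (h j).symm)
  refine mul_right_cancel₀ hi ?_
  rw [repr_none_mul, repr_none_mul, h i]

/-- The values of the functional with the coordinates `x`, as a pairing of matrices. -/
theorem constr_eq {γ : Fin n → 𝔽} (hγ : ∃ i j, γ i ≠ γ j) (x : Idx n → 𝔽) (Y : tgamma γ) :
    (tbasis γ hγ).constr 𝔽 x Y = (tbasis γ hγ).repr Y none * x none
      + ∑ i, ∑ j, upperMat x i j * (Y : Matrix (Fin n) (Fin n) 𝔽) i j := by
  rw [Module.Basis.constr_apply_fintype, Fintype.sum_option]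
  simp only [Module.Basis.equivFun_apply, smul_eq_mul]
  congr 1
  have h : ∀ i j, upperMat x i j * (Y : Matrix (Fin n) (Fin n) 𝔽) i j
      = ∑ p : {p : Fin n × Fin n // p.1 < p.2},
        if p.1 = (i, j) then (tbasis γ hγ).repr Y (some p) * x (some p) else 0 := by
    intro i j
    by_cases hij : i < j
    · rw [Finset.sum_eq_single ⟨(i, j), hij⟩]
      · rw [if_pos rfl, upperMat_apply_of_lt _ hij, mul_comm]
        congr 1
        conv_lhs => rw [← (tbasis γ hγ).sum_repr Y]
        simp only [tbasis_apply]
        rw [sum_gen_upper]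
      · intro p _ hp
        rw [if_neg]
        exact fun h => hp (Subtype.ext h)
      · simp
    · rw [upperMat_apply_of_le _ (not_lt.mp hij), zero_mul]
      symm
      refine Finset.sum_eq_zero fun p _ => if_neg ?_
      rintro h
      have := p.2
      rw [h] at this
      exact hij this
  simp only [h]
  rw [← Finset.sum_product', Finset.univ_product_univ, Finset.sum_comm]
  simp

theorem coad_apply {γ : Fin n → 𝔽} (hγ : ∃ i j, γ i ≠ γ j) (B : TGroup γ) (x : Idx n → 𝔽)
    (a : Idx n) : coad hγ B x a = (tbasis γ hγ).repr (gen γ a) none * x none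
      + ∑ i, ∑ j, conjTr B (upperMat x) i j * (gen γ a : Matrix (Fin n) (Fin n) 𝔽) i j := by
  rw [coad, tbasis_apply, constr_eq, ← sum_mul_conj]
  congr 2
  refine repr_none_congr hγ fun i => ?_
  change (B.mat⁻¹ * (gen γ a).1 * B.mat) i i = _
  have h1 := upper_mul B.inv_upper (gen γ a).2.1
  have h2 : B.mat⁻¹ i i * B.mat i i = 1 := by
    rw [← upper_mul_diag B.inv_upper B.upper, Matrix.nonsing_inv_mul _ B.isUnit_det,
      Matrix.one_apply_eq]
  rw [upper_mul_diag h1 B.upper, upper_mul_diag B.inv_upper (gen γ a).2.1]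
  linear_combination ((gen γ a).1 i i) * h2

theorem coad_some {γ : Fin n → 𝔽} (hγ : ∃ i j, γ i ≠ γ j) (B : TGroup γ) (x : Idx n → 𝔽)
    (p : {p : Fin n × Fin n // p.1 < p.2}) :
    coad hγ B x (some p) = conjTr B (upperMat x) p.1.1 p.1.2 := by
  rw [coad_apply, ← tbasis_apply γ hγ, Module.Basis.repr_self, tbasis_apply]
  simp [gen, Matrix.single_apply, ite_and]

theorem coad_none {γ : Fin n → 𝔽} (hγ : ∃ i j, γ i ≠ γ j) (B : TGroup γ) (x : Idx n → 𝔽) :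
    coad hγ B x none = x none + ∑ i, γ i * conjTr B (upperMat x) i i := by
  rw [coad_apply, ← tbasis_apply γ hγ, Module.Basis.repr_self, tbasis_apply]
  simp [gen, Matrix.diagonal_apply, mul_comm]

theorem upperMat_coad {γ : Fin n → 𝔽} (hγ : ∃ i j, γ i ≠ γ j) (B : TGroup γ) (x : Idx n → 𝔽)
    {i j : Fin n} (h : i < j) :
    upperMat (coad hγ B x) i j = conjTr B (upperMat x) i j := by
  rw [upperMat_apply_of_lt _ h, coad_some]

theorem coad_one {γ : Fin n → 𝔽} (hγ : ∃ i j, γ i ≠ γ j) (x : Idx n → 𝔽) :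
    coad hγ (1 : TGroup γ) x = x := by
  have h : conjTr (1 : TGroup γ) (upperMat x) = upperMat x := by
    have : (1 : TGroup γ).mat = 1 := rfl
    simp [conjTr, this]
  funext a
  rcases a with _ | p
  · rw [coad_none, h]
    simp [upperMat_apply_of_le]
  · rw [coad_some, h, upperMat_apply_of_lt _ p.2]

/-! ### Semi-invariance of the corner minors -/

/-- Multiplication by a matrix whose rows with the labels `f a` vanish outside the columns with the
labels `f b` acts on these rows through a square block. -/
theorem submatrix_mul_left {m l p : Type*} [Fintype m] [DecidableEq m] [Fintype p]
    {f : p → m} (hf : Function.Injective f) {L : Matrix m m 𝔽}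
    (hL : ∀ a j, j ∉ Set.range f → L (f a) j = 0) (A : Matrix m l 𝔽) {q : Type*} (g : q → l) :
    (L * A).submatrix f g = L.submatrix f f * A.submatrix f g := by
  ext a b
  simp only [Matrix.submatrix_apply, Matrix.mul_apply]
  refine (Finset.sum_of_injOn f hf.injOn (by simp) (fun j _ hj => ?_) (fun _ _ => rfl)).symm
  rw [hL a j (by simpa using hj), zero_mul]

theorem submatrix_mul_right {m l p : Type*} [Fintype m] [DecidableEq m] [Fintype p]
    {f : p → m} (hf : Function.Injective f) {R : Matrix m m 𝔽}
    (hR : ∀ a j, j ∉ Set.range f → R j (f a) = 0) (A : Matrix l m 𝔽) {q : Type*} (g : q → l) :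
    (A * R).submatrix g f = A.submatrix g f * R.submatrix f f := by
  ext a b
  simp only [Matrix.submatrix_apply, Matrix.mul_apply]
  refine (Finset.sum_of_injOn f hf.injOn (by simp) (fun j _ hj => ?_) (fun _ _ => rfl)).symm
  rw [hR b j (by simpa using hj), mul_zero]

theorem firstRows_injective (k : Fin (n / 2)) : Function.Injective (firstRows k) := by
  intro a b h
  simpa [firstRows, Fin.ext_iff] using h

theorem lastCols_injective (k : Fin (n / 2)) : Function.Injective (lastCols k) := by
  intro a b h
  simpa [lastCols, Fin.ext_iff] using h

theorem mem_range_firstRows (k : Fin (n / 2)) (i : Fin n) :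
    i ∈ Set.range (firstRows k) ↔ (i : ℕ) ≤ k := by
  constructor
  · rintro ⟨a, rfl⟩
    simp [firstRows]
    omega
  · intro h
    exact ⟨⟨i, by omega⟩, by simp [firstRows]⟩

theorem mem_range_lastCols (k : Fin (n / 2)) (i : Fin n) :
    i ∈ Set.range (lastCols k) ↔ n - (k + 1) ≤ (i : ℕ) := by
  constructor
  · rintro ⟨a, rfl⟩
    simp [lastCols]
  · intro h
    refine ⟨⟨i - (n - (k + 1)), by omega⟩, ?_⟩
    ext
    simp [lastCols]
    omega

theorem corner_eq_submatrix {A : Type*} (M : Matrix (Fin n) (Fin n) A) (k : Fin (n / 2)) :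
    corner M k = M.submatrix (firstRows k) (lastCols k) := rfl

theorem firstRows_lt_lastCols (k : Fin (n / 2)) (a b : Fin (k + 1)) :
    firstRows k a < lastCols k b := by
  simp only [firstRows, lastCols, Fin.lt_def]
  omega

theorem firstRows_strictMono (k : Fin (n / 2)) : StrictMono (firstRows k) := fun a b h => by
  simp only [firstRows, Fin.lt_def]
  exact h

theorem lastCols_strictMono (k : Fin (n / 2)) : StrictMono (lastCols k) := fun a b h => by
  simp only [lastCols, Fin.lt_def]
  have : (a : ℕ) < b := h
  omega

theorem corner_conjTr {γ : Fin n → 𝔽} (B : TGroup γ) (M : Matrix (Fin n) (Fin n) 𝔽)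
    (k : Fin (n / 2)) : corner (conjTr B M) k
      = (B.mat⁻¹).transpose.submatrix (firstRows k) (firstRows k) * corner M k
        * B.mat.transpose.submatrix (lastCols k) (lastCols k) := by
  rw [corner_eq_submatrix, conjTr, submatrix_mul_right (lastCols_injective k),
    submatrix_mul_left (firstRows_injective k)]
  · rfl
  · intro a j hj
    rw [mem_range_firstRows] at hj
    refine B.inv_upper _ _ ?_
    simp only [firstRows, Fin.lt_def]
    omega
  · intro a j hj
    rw [mem_range_lastCols] at hj
    refine B.upper _ _ ?_
    simp only [lastCols, Fin.lt_def]
    omega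

/-- The exponent of the semi-invariant minor of order `k + 1`. -/
def weight (γ : Fin n → 𝔽) (k : Fin (n / 2)) : 𝔽 :=
  ∑ a : Fin (k + 1), (γ (lastCols k a) - γ (firstRows k a))

/-- The corner minor of order `k + 1`, formed from the first rows and the last columns of
`upperMat x`, as a function on the dual space. -/
noncomputable def minor (k : Fin (n / 2)) (x : Idx n → 𝔽) : 𝔽 := (corner (upperMat x) k).det

theorem TGroup.inv_diag {γ : Fin n → 𝔽} (B : TGroup γ) (i : Fin n) :
    B.mat⁻¹ i i = NormedSpace.exp (-(γ i * B.eps)) := by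
  have h2 : B.mat⁻¹ i i * B.mat i i = 1 := by
    rw [← upper_mul_diag B.inv_upper B.upper, Matrix.nonsing_inv_mul _ B.isUnit_det,
      Matrix.one_apply_eq]
  have h3 : NormedSpace.exp (-(γ i * B.eps)) * NormedSpace.exp (γ i * B.eps) = 1 := by
    let _ : NormedAlgebra ℚ 𝔽 := NormedAlgebra.restrictScalars ℚ ℝ 𝔽
    rw [← NormedSpace.exp_add, neg_add_cancel, NormedSpace.exp_zero]
  rw [B.diag] at h2
  exact mul_right_cancel₀ (NormedSpace.isUnit_exp (γ i * B.eps)).ne_zero (h2.trans h3.symm)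

theorem corner_coad {γ : Fin n → 𝔽} (hγ : ∃ i j, γ i ≠ γ j) (B : TGroup γ) (x : Idx n → 𝔽)
    (k : Fin (n / 2)) :
    corner (upperMat (coad hγ B x)) k = corner (conjTr B (upperMat x)) k := by
  ext a b
  exact upperMat_coad hγ B x (firstRows_lt_lastCols k a b)

theorem det_firstRows_block {γ : Fin n → 𝔽} (B : TGroup γ) (k : Fin (n / 2)) :
    ((B.mat⁻¹).transpose.submatrix (firstRows k) (firstRows k)).det
      = ∏ a, NormedSpace.exp (-(γ (firstRows k a) * B.eps)) := by
  rw [Matrix.det_of_isLowerTriangular]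
  · simp [B.inv_diag]
  · intro a b hab
    exact B.inv_upper _ _ (firstRows_strictMono k hab)

theorem det_lastCols_block {γ : Fin n → 𝔽} (B : TGroup γ) (k : Fin (n / 2)) :
    (B.mat.transpose.submatrix (lastCols k) (lastCols k)).det
      = ∏ a, NormedSpace.exp (γ (lastCols k a) * B.eps) := by
  rw [Matrix.det_of_isLowerTriangular]
  · simp [B.diag]
  · intro a b hab
    exact B.upper _ _ (lastCols_strictMono k hab)

theorem minor_coad {γ : Fin n → 𝔽} (hγ : ∃ i j, γ i ≠ γ j) (B : TGroup γ) (x : Idx n → 𝔽)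
    (k : Fin (n / 2)) :
    minor k (coad hγ B x) = NormedSpace.exp (B.eps * weight γ k) * minor k x := by
  let _ : NormedAlgebra ℚ 𝔽 := NormedAlgebra.restrictScalars ℚ ℝ 𝔽
  rw [minor, corner_coad, corner_conjTr, Matrix.det_mul, Matrix.det_mul, det_firstRows_block,
    det_lastCols_block, weight, Finset.mul_sum, NormedSpace.exp_sum, mul_right_comm,
    ← Finset.prod_mul_distrib, minor]
  congr 1
  refine Finset.prod_congr rfl fun a _ => ?_
  rw [← NormedSpace.exp_add]
  congr 1
  ring

/-! ### Smooth curves in the group and the tangent space of an orbit -/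

theorem contDiff_exp (m : WithTop ℕ∞) : ContDiff 𝔽 m (NormedSpace.exp : 𝔽 → 𝔽) :=
  contDiff_iff_contDiffAt.mpr fun x => (NormedSpace.exp_analytic x).contDiffAt

theorem contDiff_det {E : Type*} [NormedAddCommGroup E] [NormedSpace 𝔽 E] {ι : Type*} [Fintype ι]
    [DecidableEq ι] {m : WithTop ℕ∞} {A : E → Matrix ι ι 𝔽}
    (hA : ∀ i j, ContDiff 𝔽 m fun p => A p i j) : ContDiff 𝔽 m fun p => (A p).det := by
  simp only [Matrix.det_apply']
  exact ContDiff.sum fun σ _ => contDiff_const.mul (contDiff_prod fun i _ => hA _ _)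

theorem contDiff_inv_entry {E : Type*} [NormedAddCommGroup E] [NormedSpace 𝔽 E] {ι : Type*}
    [Fintype ι] [DecidableEq ι] {m : WithTop ℕ∞} {A : E → Matrix ι ι 𝔽}
    (hA : ∀ i j, ContDiff 𝔽 m fun p => A p i j) (h : ∀ p, (A p).det ≠ 0) (i j : ι) :
    ContDiff 𝔽 m fun p => (A p)⁻¹ i j := by
  simp only [Matrix.inv_def, Ring.inverse_eq_inv', Matrix.smul_apply, smul_eq_mul]
  refine ((contDiff_det hA).inv h).mul ?_
  simp only [Matrix.adjugate_apply]
  refine contDiff_det fun k l => ?_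
  simp only [Matrix.updateRow_apply]
  split_ifs
  · exact contDiff_const
  · exact hA k l

/-- Global coordinates on the group `T_γ(n)`, with `0` corresponding to the neutral element. -/
noncomputable def chart (γ : Fin n → 𝔽) (p : Idx n → 𝔽) : TGroup γ where
  mat := upperMat p + Matrix.diagonal fun i => NormedSpace.exp (γ i * p none)
  eps := p none
  upper i j h := by
    rw [Matrix.add_apply, upperMat_apply_of_le _ h.le, Matrix.diagonal_apply_ne _ h.ne', add_zero]
  diag i := by
    rw [Matrix.add_apply, upperMat_apply_of_le _ le_rfl, Matrix.diagonal_apply_eq, zero_add]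

theorem TGroup.ext' {γ : Fin n → 𝔽} {B C : TGroup γ} (h : B.mat = C.mat) (h' : B.eps = C.eps) :
    B = C := by
  cases B
  cases C
  cases h
  cases h'
  rfl

theorem chart_zero (γ : Fin n → 𝔽) : chart γ 0 = 1 := by
  refine TGroup.ext' ?_ rfl
  change upperMat (0 : Idx n → 𝔽) + Matrix.diagonal (fun i => NormedSpace.exp (γ i * 0)) = 1
  ext i j
  simp [upperMat, Matrix.one_apply]

theorem contDiff_chart_entry (γ : Fin n → 𝔽) (m : WithTop ℕ∞) (i j : Fin n) :
    ContDiff 𝔽 m fun p => (chart γ p).mat i j := by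
  rcases lt_trichotomy i j with h | rfl | h
  · have : (fun p => (chart γ p).mat i j) = fun p : Idx n → 𝔽 => p (some ⟨(i, j), h⟩) := by
      funext p
      change (upperMat p + Matrix.diagonal _ : Matrix (Fin n) (Fin n) 𝔽) i j = _
      rw [Matrix.add_apply, upperMat_apply_of_lt _ h, Matrix.diagonal_apply_ne _ h.ne, add_zero]
    rw [this]
    exact contDiff_apply 𝔽 𝔽 _
  · simp only [(chart γ _).diag]
    exact (contDiff_exp m).comp (contDiff_const.mul (contDiff_apply 𝔽 𝔽 (none : Idx n)))
  · simp only [(chart γ _).upper i j h]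
    exact contDiff_const

theorem contDiff_upperMat_entry (m : WithTop ℕ∞) (i j : Fin n) :
    ContDiff 𝔽 m fun y : Idx n → 𝔽 => upperMat y i j := by
  by_cases h : i < j
  · simp only [upperMat_apply_of_lt _ h]
    exact contDiff_apply 𝔽 𝔽 _
  · simp only [upperMat_apply_of_le _ (not_lt.mp h)]
    exact contDiff_const

theorem contDiff_minor (m : WithTop ℕ∞) (k : Fin (n / 2)) :
    ContDiff 𝔽 m (minor k : (Idx n → 𝔽) → 𝔽) :=
  contDiff_det fun a b => contDiff_upperMat_entry m (firstRows k a) (lastCols k b)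

theorem contDiff_conjTr (γ : Fin n → 𝔽) (m : WithTop ℕ∞) (i j : Fin n) :
    ContDiff 𝔽 m fun p : (Idx n → 𝔽) × (Idx n → 𝔽) =>
      conjTr (chart γ p.1) (upperMat p.2) i j := by
  simp only [conjTr, Matrix.mul_apply, Matrix.transpose_apply]
  refine ContDiff.sum fun l _ => (ContDiff.sum fun k _ => ?_).mul ?_
  · refine ContDiff.mul ?_ ((contDiff_upperMat_entry m k l).comp contDiff_snd)
    exact (contDiff_inv_entry (contDiff_chart_entry γ m)
      (fun p => (chart γ p).isUnit_det.ne_zero) k i).comp contDiff_fst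
  · exact (contDiff_chart_entry γ m j l).comp contDiff_fst

theorem contDiff_coad {γ : Fin n → 𝔽} (hγ : ∃ i j, γ i ≠ γ j) (m : WithTop ℕ∞) :
    ContDiff 𝔽 m fun p : (Idx n → 𝔽) × (Idx n → 𝔽) => coad hγ (chart γ p.1) p.2 := by
  rw [contDiff_pi]
  rintro (_ | a)
  · simp only [coad_none]
    exact ((contDiff_apply 𝔽 𝔽 (none : Idx n)).comp contDiff_snd).add
      (ContDiff.sum fun i _ => contDiff_const.mul (contDiff_conjTr γ m i i))
  · simp only [coad_some]
    exact contDiff_conjTr γ m _ _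

theorem continuous_chart (γ : Fin n → 𝔽) : Continuous (chart γ) := by
  refine continuous_induced_rng.mpr (Continuous.prodMk ?_ ?_)
  · exact continuous_matrix fun i j => (contDiff_chart_entry γ 0 i j).continuous
  · exact continuous_apply (none : Idx n)

/-- The matrix of the element of `𝔱_γ(n)` with the coordinates `q`. -/
def lieMat (γ : Fin n → 𝔽) (q : Idx n → 𝔽) : Matrix (Fin n) (Fin n) 𝔽 :=
  upperMat q + q none • Matrix.diagonal γ

/-- The derivative of `conjTr` at the neutral element. -/
def lieTr (γ : Fin n → 𝔽) (q x : Idx n → 𝔽) : Matrix (Fin n) (Fin n) 𝔽 :=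
  upperMat x * (lieMat γ q).transpose - (lieMat γ q).transpose * upperMat x

/-- The tangent vector at `x` of the orbit of `x` given by the element of `𝔱_γ(n)` with the
coordinates `q`. -/
def tangent (γ : Fin n → 𝔽) (q x : Idx n → 𝔽) : Idx n → 𝔽
  | none => ∑ i, γ i * lieTr γ q x i i
  | some p => lieTr γ q x p.1.1 p.1.2

theorem hasDerivAt_chart_entry (γ : Fin n → 𝔽) (q : Idx n → 𝔽) (i j : Fin n) :
    HasDerivAt (fun t : 𝔽 => (chart γ (t • q)).mat i j) (lieMat γ q i j) 0 := by
  rw [lieMat, Matrix.add_apply, Matrix.smul_apply]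
  rcases lt_trichotomy i j with h | rfl | h
  · rw [upperMat_apply_of_lt _ h, Matrix.diagonal_apply_ne _ h.ne, smul_zero, add_zero]
    have : (fun t : 𝔽 => (chart γ (t • q)).mat i j)
        = fun t : 𝔽 => t * q (some ⟨(i, j), h⟩) := by
      funext t
      change (upperMat (t • q) + Matrix.diagonal _ : Matrix (Fin n) (Fin n) 𝔽) i j = _
      rw [Matrix.add_apply, upperMat_apply_of_lt _ h, Matrix.diagonal_apply_ne _ h.ne, add_zero]
      rfl
    rw [this]
    simpa using (hasDerivAt_id (0 : 𝔽)).mul_const (q (some ⟨(i, j), h⟩))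
  · simp only [(chart γ _).diag]
    rw [upperMat_apply_of_le _ le_rfl, Matrix.diagonal_apply_eq, zero_add]
    have h1 : HasDerivAt (fun t : 𝔽 => γ i * (chart γ (t • q)).eps) (γ i * q none) 0 := by
      change HasDerivAt (fun t : 𝔽 => γ i * (t * q none)) (γ i * q none) 0
      simpa using ((hasDerivAt_id (0 : 𝔽)).mul_const (q none)).const_mul (γ i)
    have h0 : γ i * (chart γ ((0 : 𝔽) • q)).eps = 0 := by
      change γ i * (0 * q none) = 0
      ring
    have h2 : HasDerivAt (NormedSpace.exp : 𝔽 → 𝔽) 1 (γ i * (chart γ ((0 : 𝔽) • q)).eps) := by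
      rw [h0]
      exact hasDerivAt_exp_zero
    have h3 := h2.comp (0 : 𝔽) h1
    rw [smul_eq_mul, mul_comm (q none), ← one_mul (γ i * q none)]
    exact h3
  · simp only [(chart γ _).upper i j h]
    rw [upperMat_apply_of_le _ h.le, Matrix.diagonal_apply_ne _ h.ne', smul_zero, add_zero]
    exact hasDerivAt_const _ _

theorem conjTr_one (γ : Fin n → 𝔽) (M : Matrix (Fin n) (Fin n) 𝔽) :
    conjTr (1 : TGroup γ) M = M := by
  have : (1 : TGroup γ).mat = 1 := rfl
  simp [conjTr, this]

theorem hasDerivAt_conjTr (γ : Fin n → 𝔽) (q x : Idx n → 𝔽) (i j : Fin n) :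
    HasDerivAt (fun t : 𝔽 => conjTr (chart γ (t • q)) (upperMat x) i j) (lieTr γ q x i j) 0 := by
  -- the derivative exists, and is found by differentiating `Bᵀ * conjTr B M = M * Bᵀ`
  have hd : ∀ i j, HasDerivAt (fun t : 𝔽 => conjTr (chart γ (t • q)) (upperMat x) i j)
      (deriv (fun t : 𝔽 => conjTr (chart γ (t • q)) (upperMat x) i j) 0) 0 := by
    intro i j
    refine DifferentiableAt.hasDerivAt ?_
    have h : ContDiff 𝔽 1 fun t : 𝔽 => (t • q, x) :=
      (contDiff_id.smul contDiff_const).prodMk contDiff_const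
    exact ((contDiff_conjTr γ 1 i j).comp h).differentiable (by simp) |>.differentiableAt
  set D : Fin n → Fin n → 𝔽 := fun i j =>
    deriv (fun t : 𝔽 => conjTr (chart γ (t • q)) (upperMat x) i j) 0 with hD
  have hmul : ∀ t : 𝔽, (chart γ (t • q)).mat.transpose * conjTr (chart γ (t • q)) (upperMat x)
      = upperMat x * (chart γ (t • q)).mat.transpose := by
    intro t
    rw [conjTr, ← Matrix.mul_assoc, ← Matrix.mul_assoc, ← Matrix.transpose_mul,
      Matrix.nonsing_inv_mul _ (chart γ (t • q)).isUnit_det, Matrix.transpose_one, Matrix.one_mul]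
  have h1 : HasDerivAt (fun t : 𝔽 => ((chart γ (t • q)).mat.transpose
      * conjTr (chart γ (t • q)) (upperMat x)) i j)
      (((lieMat γ q).transpose * upperMat x) i j + D i j) 0 := by
    simp only [Matrix.mul_apply, Matrix.transpose_apply]
    have h : ∀ k, HasDerivAt (fun t : 𝔽 => (chart γ (t • q)).mat k i
        * conjTr (chart γ (t • q)) (upperMat x) k j)
        (lieMat γ q k i * upperMat x k j + (1 : Matrix (Fin n) (Fin n) 𝔽) k i * D k j) 0 := by
      intro k
      have := (hasDerivAt_chart_entry γ q k i).mul (hd k j)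
      rw [zero_smul, chart_zero, conjTr_one] at this
      exact this
    have := HasDerivAt.fun_sum (u := Finset.univ) fun k _ => h k
    rw [Finset.sum_add_distrib] at this
    simpa [Matrix.one_apply] using this
  have h2 : HasDerivAt (fun t : 𝔽 => (upperMat x * (chart γ (t • q)).mat.transpose) i j)
      ((upperMat x * (lieMat γ q).transpose) i j) 0 := by
    simp only [Matrix.mul_apply, Matrix.transpose_apply]
    exact HasDerivAt.fun_sum fun k _ => (hasDerivAt_chart_entry γ q j k).const_mul _
  simp only [hmul] at h1
  have h3 := h1.unique h2
  have h4 : lieTr γ q x i j = D i j := by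
    rw [lieTr, Matrix.sub_apply, ← h3]
    ring
  rw [h4]
  exact hd i j

theorem hasDerivAt_coad {γ : Fin n → 𝔽} (hγ : ∃ i j, γ i ≠ γ j) (q x : Idx n → 𝔽) :
    HasDerivAt (fun t : 𝔽 => coad hγ (chart γ (t • q)) x) (tangent γ q x) 0 := by
  rw [hasDerivAt_pi]
  rintro (_ | a)
  · simp only [coad_none]
    exact (HasDerivAt.fun_sum fun i _ => (hasDerivAt_conjTr γ q x i i).const_mul _).const_add _
  · simp only [coad_some]
    exact hasDerivAt_conjTr γ q x _ _

theorem hasDerivAt_comp_coad {γ : Fin n → 𝔽} (hγ : ∃ i j, γ i ≠ γ j) (q x : Idx n → 𝔽)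
    {F : (Idx n → 𝔽) → 𝔽} (hF : DifferentiableAt 𝔽 F x) :
    HasDerivAt (fun t : 𝔽 => F (coad hγ (chart γ (t • q)) x))
      (fderiv 𝔽 F x (tangent γ q x)) 0 := by
  have h0 : coad hγ (chart γ ((0 : 𝔽) • q)) x = x := by rw [zero_smul, chart_zero, coad_one]
  have hF' : HasFDerivAt F (fderiv 𝔽 F x) (coad hγ (chart γ ((0 : 𝔽) • q)) x) := by
    rw [h0]
    exact hF.hasFDerivAt
  exact hF'.comp_hasDerivAt (0 : 𝔽) (hasDerivAt_coad hγ q x)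

/-- The linear path in the chart from the neutral element to the point with the coordinates `p`. -/
noncomputable def chartPath (γ : Fin n → 𝔽) (p : Idx n → 𝔽) (t : unitInterval) : TGroup γ :=
  chart γ (((t : ℝ) : 𝔽) • p)

theorem continuous_chartPath (γ : Fin n → 𝔽) (p : Idx n → 𝔽) : Continuous (chartPath γ p) := by
  have h' : Continuous fun t : unitInterval => ((t : ℝ) : 𝔽) :=
    RCLike.continuous_ofReal.comp continuous_subtype_val
  have h : Continuous fun t : unitInterval => ((t : ℝ) : 𝔽) • p := h'.smul continuous_const
  exact (continuous_chart γ).comp h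

theorem chartPath_zero (γ : Fin n → 𝔽) (p : Idx n → 𝔽) : chartPath γ p 0 = 1 := by
  simp [chartPath, chart_zero]

theorem chartPath_one (γ : Fin n → 𝔽) (p : Idx n → 𝔽) : chartPath γ p 1 = chart γ p := by
  simp [chartPath]

theorem norm_unitInterval_smul_le {E : Type*} [NormedAddCommGroup E] [NormedSpace 𝔽 E]
    (t : unitInterval) (p : E) : ‖((t : ℝ) : 𝔽) • p‖ ≤ ‖p‖ := by
  rw [norm_smul, RCLike.norm_ofReal, abs_of_nonneg t.2.1]
  exact mul_le_of_le_one_left (norm_nonneg _) t.2.2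

theorem continuous_coad_chart_smul {γ : Fin n → 𝔽} (hγ : ∃ i j, γ i ≠ γ j) (q x : Idx n → 𝔽) :
    Continuous fun t : 𝔽 => coad hγ (chart γ (t • q)) x := by
  have h1 : Continuous fun t : 𝔽 => t • q := continuous_id.smul continuous_const
  have h2 : Continuous fun p : (Idx n → 𝔽) × (Idx n → 𝔽) => coad hγ (chart γ p.1) p.2 :=
    (contDiff_coad hγ 0).continuous
  have h3 : Continuous fun t : 𝔽 => (t • q, x) := h1.prodMk continuous_const
  have h4 := h2.comp h3
  simp only [Function.comp_def] at h4
  exact h4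

/-- An invariant is constant along the curves `t ↦ Ad*_{B_t} x`, since the linear path in the chart
keeps a point near `x` inside the domain. -/
theorem fderiv_tangent_of_invariant {γ : Fin n → 𝔽} (hγ : ∃ i j, γ i ≠ γ j) {U : Set (Idx n → 𝔽)}
    (hU : IsOpen U) {F : (Idx n → 𝔽) → 𝔽} (hF : IsInvariantOn hγ U F) {x : Idx n → 𝔽} (hx : x ∈ U)
    (hd : DifferentiableAt 𝔽 F x) (q : Idx n → 𝔽) : fderiv 𝔽 F x (tangent γ q x) = 0 := by
  have h1 := hasDerivAt_comp_coad hγ q x hd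
  have h0 : coad hγ (chart γ ((0 : 𝔽) • q)) x = x := by rw [zero_smul, chart_zero, coad_one]
  have hn : (fun t : 𝔽 => coad hγ (chart γ (t • q)) x) ⁻¹' U ∈ 𝓝 (0 : 𝔽) :=
    (continuous_coad_chart_smul hγ q x).continuousAt.preimage_mem_nhds
      (by rw [h0]; exact hU.mem_nhds hx)
  obtain ⟨r, hr, hball⟩ := Metric.mem_nhds_iff.mp hn
  have hinv : ∀ t ∈ Metric.ball (0 : 𝔽) r, F (coad hγ (chart γ (t • q)) x) = F x := by
    intro t ht
    have h2 := hF x (chartPath γ (t • q)) (continuous_chartPath γ _) (chartPath_zero γ _) ?_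
    · rwa [chartPath_one] at h2
    · intro s
      have hs : ((s : ℝ) : 𝔽) • t ∈ Metric.ball (0 : 𝔽) r := by
        rw [mem_ball_zero_iff] at ht ⊢
        exact (norm_unitInterval_smul_le s t).trans_lt ht
      have h3 : coad hγ (chart γ ((((s : ℝ) : 𝔽) • t) • q)) x ∈ U := hball hs
      rwa [smul_assoc] at h3
  refine h1.unique ((hasDerivAt_const (0 : 𝔽) (F x)).congr_of_eventuallyEq ?_)
  filter_upwards [Metric.ball_mem_nhds (0 : 𝔽) hr] with t ht using hinv t ht

/-! ### Completeness of a family of invariants -/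

theorem exists_functional_of_ne_top {E : Type*} [AddCommGroup E] [Module 𝔽 E] {p : Submodule 𝔽 E}
    (hp : p ≠ ⊤) : ∃ f : E →ₗ[𝔽] 𝔽, f ≠ 0 ∧ ∀ y ∈ p, f y = 0 := by
  obtain ⟨f, hf, hf'⟩ := Submodule.exists_dual_map_eq_bot_of_lt_top (lt_top_iff_ne_top.mpr hp)
    inferInstance
  refine ⟨f, hf, fun y hy => ?_⟩
  have : f y ∈ p.map f := ⟨y, hy, rfl⟩
  rw [hf'] at this
  exact (Submodule.mem_bot 𝔽).mp this

/-- Linearly independent functionals on a vector space admit a dual system of vectors. -/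
theorem exists_dual_system {E : Type*} [AddCommGroup E] [Module 𝔽 E] {L : Type*} [Fintype L]
    [DecidableEq L] {φ : L → E →ₗ[𝔽] 𝔽} (h : LinearIndependent 𝔽 φ) :
    ∃ v : L → E, ∀ l m, φ l (v m) = if l = m then 1 else 0 := by
  have hsurj : Function.Surjective (LinearMap.pi φ : E →ₗ[𝔽] L → 𝔽) := by
    rw [← LinearMap.range_eq_top]
    by_contra hne
    obtain ⟨f, hf, hf'⟩ := exists_functional_of_ne_top hne
    refine hf ?_
    have hz : ∀ y, f (LinearMap.pi φ y) = 0 := fun y => hf' _ ⟨y, rfl⟩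
    have hs : ∀ g : L → 𝔽, f g = ∑ l, g l * f (Pi.single l 1) := fun g => by
      conv_lhs => rw [pi_eq_sum_univ' g]
      simp
    have hc := Fintype.linearIndependent_iff.mp h (fun l => f (Pi.single l 1)) (by
      ext y
      have := hz y
      rw [hs] at this
      simpa [mul_comm] using this)
    ext l
    simpa using hc l
  choose v hv using fun m : L => hsurj (Pi.single m 1)
  refine ⟨v, fun l m => ?_⟩
  have := congrFun (hv m) l
  simpa [Pi.single_apply] using this

/-- If every functional vanishing on the tangent space at `x` of the orbit of `x` is a combination
of the differentials of the invariants `F l`, then near `x` every invariant is a smooth function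
of the `F l`. Every point near `x` can be moved by an element of the group close to `1` into the
affine subspace through `x` spanned by a system of vectors dual to the differentials, on which
the `F l` form coordinates. -/
theorem exists_eq_comp_of_span {γ : Fin n → 𝔽} (hγ : ∃ i j, γ i ≠ γ j) {U : Set (Idx n → 𝔽)}
    (hU : IsOpen U) {L : Type} [Fintype L] {F : L → (Idx n → 𝔽) → 𝔽}
    (hF : ∀ l, ContDiffOn 𝔽 ∞ (F l) U) (hinv : ∀ l, IsInvariantOn hγ U (F l))
    {x : Idx n → 𝔽} (hind : LinearIndependent 𝔽 fun l => fderiv 𝔽 (F l) x)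
    (hspan : ∀ φ : (Idx n → 𝔽) →L[𝔽] 𝔽, (∀ q, φ (tangent γ q x) = 0) →
      ∃ c : L → 𝔽, φ = ∑ l, c l • fderiv 𝔽 (F l) x)
    {W : Set (Idx n → 𝔽)} {G : (Idx n → 𝔽) → 𝔽} (hW : IsOpen W) (hWU : W ⊆ U)
    (hG : ContDiffOn 𝔽 ∞ G W) (hGinv : IsInvariantOn hγ W G) (hx : x ∈ W) :
    ∃ H : (L → 𝔽) → 𝔽, ContDiffAt 𝔽 ∞ H (fun l => F l x) ∧
      ∀ᶠ y in 𝓝 x, G y = H fun l => F l y := by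
  classical
  obtain ⟨v, hv⟩ : ∃ v : L → Idx n → 𝔽, ∀ l m, fderiv 𝔽 (F l) x (v m) = if l = m then 1 else 0 :=
    exists_dual_system (φ := fun l => (fderiv 𝔽 (F l) x : (Idx n → 𝔽) →ₗ[𝔽] 𝔽))
      (hind.map' (ContinuousLinearMap.coeLM 𝔽) (LinearMap.ker_eq_bot.mpr
        ContinuousLinearMap.coe_injective))
  -- the affine section through `x`
  let σ : (L → 𝔽) → Idx n → 𝔽 := fun s => x + ∑ l, s l • v l
  have hσ0 : σ 0 = x := by simp [σ]
  have hσc : ContDiff 𝔽 ∞ σ :=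
    contDiff_const.add (ContDiff.sum fun l _ => (contDiff_apply 𝔽 𝔽 l).smul contDiff_const)
  have hσd : ∀ s : L → 𝔽, HasDerivAt (fun t : 𝔽 => σ (t • s)) (∑ l, s l • v l) 0 := by
    intro s
    have h : (fun t : 𝔽 => σ (t • s)) = fun t : 𝔽 => x + t • ∑ l, s l • v l := by
      funext t
      simp [σ, Finset.smul_sum, smul_smul]
    rw [h]
    simpa using ((hasDerivAt_id (0 : 𝔽)).smul_const (∑ l, s l • v l)).const_add x
  -- the action on the section
  let Φ : (Idx n → 𝔽) × (L → 𝔽) → Idx n → 𝔽 := fun p => coad hγ (chart γ p.1) (σ p.2)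
  have hΦc : ContDiff 𝔽 ∞ Φ := by
    have h1 : ContDiff 𝔽 ∞ fun p : (Idx n → 𝔽) × (L → 𝔽) => (p.1, σ p.2) :=
      contDiff_fst.prodMk (hσc.comp contDiff_snd)
    have h2 := (contDiff_coad hγ ∞).comp h1
    simp only [Function.comp_def] at h2
    exact h2
  have hΦ0 : Φ 0 = x := by
    simp only [Φ, Prod.fst_zero, Prod.snd_zero, chart_zero, coad_one, hσ0]
  have hΦs : HasStrictFDerivAt Φ (fderiv 𝔽 Φ 0) 0 :=
    hΦc.contDiffAt.hasStrictFDerivAt (by simp)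
  have hcurve : ∀ p : (Idx n → 𝔽) × (L → 𝔽),
      HasDerivAt (fun t : 𝔽 => Φ (t • p)) (fderiv 𝔽 Φ 0 p) 0 := by
    intro p
    have h1 : HasDerivAt (fun t : 𝔽 => t • p) p 0 := by
      simpa using (hasDerivAt_id (0 : 𝔽)).smul_const p
    have h2 : HasFDerivAt Φ (fderiv 𝔽 Φ 0) ((0 : 𝔽) • p) := by
      rw [zero_smul]
      exact hΦs.hasFDerivAt
    exact h2.comp_hasDerivAt (0 : 𝔽) h1
  have hΦq : ∀ q, fderiv 𝔽 Φ 0 (q, 0) = tangent γ q x := by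
    intro q
    refine (hcurve (q, 0)).unique ?_
    have h : (fun t : 𝔽 => Φ (t • (q, 0))) = fun t : 𝔽 => coad hγ (chart γ (t • q)) x := by
      funext t
      simp only [Φ, Prod.smul_mk, smul_zero, hσ0]
    rw [h]
    exact hasDerivAt_coad hγ q x
  have hΦv : ∀ s, fderiv 𝔽 Φ 0 (0, s) = ∑ l, s l • v l := by
    intro s
    refine (hcurve (0, s)).unique ?_
    have h : (fun t : 𝔽 => Φ (t • (0, s))) = fun t : 𝔽 => σ (t • s) := by
      funext t
      simp only [Φ, Prod.smul_mk, smul_zero, chart_zero, coad_one]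
    rw [h]
    exact hσd s
  have hrange : (fderiv 𝔽 Φ 0).range = ⊤ := by
    by_contra hne
    obtain ⟨f, hf, hf'⟩ := exists_functional_of_ne_top hne
    have hz : ∀ p, f (fderiv 𝔽 Φ 0 p) = 0 := fun p => hf' _ ⟨p, rfl⟩
    obtain ⟨c, hc⟩ := hspan (LinearMap.toContinuousLinearMap f) fun q => by
      rw [← hΦq]
      exact hz _
    have hc0 : ∀ m, c m = 0 := by
      intro m
      have h1 : fderiv 𝔽 Φ 0 (0, Pi.single m 1) = v m := by
        rw [hΦv]
        simp [Pi.single_apply]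
      have h2 : LinearMap.toContinuousLinearMap f (v m) = 0 := by
        rw [← h1]
        exact hz _
      rw [hc] at h2
      simpa [hv] using h2
    refine hf ?_
    refine LinearMap.ext fun y => ?_
    change LinearMap.toContinuousLinearMap f y = 0
    rw [hc]
    simp [hc0]
  have hnhds : Filter.map Φ (𝓝 0) = 𝓝 x := by
    rw [hΦs.map_nhds_eq_of_surj hrange, hΦ0]
  -- the invariants as coordinates on the section
  let ψ : (L → 𝔽) → L → 𝔽 := fun s l => F l (σ s)
  have hFx : ∀ l, ContDiffAt 𝔽 ∞ (F l) (σ 0) := fun l => by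
    rw [hσ0]
    exact (hF l).contDiffAt (hU.mem_nhds (hWU hx))
  have hψc : ContDiffAt 𝔽 ∞ ψ 0 := by
    rw [contDiffAt_pi]
    exact fun l => ContDiffAt.comp (0 : L → 𝔽) (hFx l) hσc.contDiffAt
  have hψd : HasFDerivAt ψ ((ContinuousLinearEquiv.refl 𝔽 (L → 𝔽) :
      (L → 𝔽) ≃L[𝔽] (L → 𝔽)) : (L → 𝔽) →L[𝔽] (L → 𝔽)) 0 := by
    have h1 := (hψc.differentiableAt (by simp)).hasFDerivAt
    have h2 : fderiv 𝔽 ψ 0 = ((ContinuousLinearEquiv.refl 𝔽 (L → 𝔽) :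
        (L → 𝔽) ≃L[𝔽] (L → 𝔽)) : (L → 𝔽) →L[𝔽] (L → 𝔽)) := by
      ext1 s
      have h3 : HasDerivAt (fun t : 𝔽 => t • s) s 0 := by
        simpa using (hasDerivAt_id (0 : 𝔽)).smul_const s
      have h4 : HasFDerivAt ψ (fderiv 𝔽 ψ 0) ((0 : 𝔽) • s) := by rwa [zero_smul]
      have h5 := h4.comp_hasDerivAt (0 : 𝔽) h3
      refine h5.unique ?_
      rw [hasDerivAt_pi]
      intro l
      have h6 : HasFDerivAt (F l) (fderiv 𝔽 (F l) x) (σ ((0 : 𝔽) • s)) := by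
        rw [zero_smul]
        have := ((hFx l).differentiableAt (by simp)).hasFDerivAt
        rwa [hσ0] at this ⊢
      have h7 := h6.comp_hasDerivAt (0 : 𝔽) (hσd s)
      simp only [map_sum, map_smul, hv, smul_eq_mul, mul_ite, mul_one, mul_zero,
        Finset.sum_ite_eq, Finset.mem_univ, if_true] at h7
      exact h7
    rwa [h2] at h1
  let ρ : (L → 𝔽) → L → 𝔽 := hψc.localInverse hψd (by simp)
  have hρc : ContDiffAt 𝔽 ∞ ρ (ψ 0) := hψc.to_localInverse hψd (by simp)
  have hρ0 : ρ (ψ 0) = 0 := hψc.localInverse_apply_image hψd (by simp)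
  have hρψ : ∀ᶠ s in 𝓝 (0 : L → 𝔽), ρ (ψ s) = s :=
    (hψc.hasStrictFDerivAt' hψd (by simp)).eventually_left_inverse
  have hψ0 : ψ 0 = fun l => F l x := by
    funext l
    simp only [ψ, hσ0]
  refine ⟨fun z => G (σ (ρ z)), ?_, ?_⟩
  · rw [← hψ0]
    refine ContDiffAt.comp (ψ 0) (g := G) ?_ (hσc.contDiffAt.comp (ψ 0) hρc)
    rw [hρ0, hσ0]
    exact hG.contDiffAt (hW.mem_nhds hx)
  · rw [← hnhds, Filter.eventually_map]
    have hpre : Φ ⁻¹' W ∈ 𝓝 (0 : (Idx n → 𝔽) × (L → 𝔽)) :=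
      hΦc.continuous.continuousAt.preimage_mem_nhds (by rw [hΦ0]; exact hW.mem_nhds hx)
    obtain ⟨r, hr, hball⟩ := Metric.mem_nhds_iff.mp hpre
    have hsnd : ∀ᶠ p in 𝓝 (0 : (Idx n → 𝔽) × (L → 𝔽)), ρ (ψ p.2) = p.2 :=
      (continuous_snd.tendsto (0 : (Idx n → 𝔽) × (L → 𝔽))).eventually hρψ
    filter_upwards [Metric.ball_mem_nhds _ hr, hsnd] with p hp hp2
    have hpath : ∀ t, coad hγ (chartPath γ p.1 t) (σ p.2) ∈ W := by
      intro t
      have hmem : (((t : ℝ) : 𝔽) • p.1, p.2) ∈ Metric.ball (0 : (Idx n → 𝔽) × (L → 𝔽)) r := by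
        rw [mem_ball_zero_iff, Prod.norm_def, max_lt_iff] at hp ⊢
        exact ⟨(norm_unitInterval_smul_le t p.1).trans_lt hp.1, hp.2⟩
      have h : Φ (((t : ℝ) : 𝔽) • p.1, p.2) ∈ W := hball hmem
      simp only [Φ] at h
      rwa [chartPath]
    have key : ∀ {V : Set (Idx n → 𝔽)} {K : (Idx n → 𝔽) → 𝔽}, W ⊆ V → IsInvariantOn hγ V K →
        K (Φ p) = K (σ p.2) := by
      intro V K hV hK
      have := hK (σ p.2) (chartPath γ p.1) (continuous_chartPath γ _) (chartPath_zero γ _)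
        fun t => hV (hpath t)
      rwa [chartPath_one] at this
    have h1 : (fun l => F l (Φ p)) = ψ p.2 := by
      funext l
      exact key hWU (hinv l)
    rw [h1, hp2]
    exact key subset_rfl hGinv

/-- A criterion for a functional basis in terms of the tangent spaces of the orbits. -/
theorem isFunctionalBasis_of_span {γ : Fin n → 𝔽} (hγ : ∃ i j, γ i ≠ γ j) {U : Set (Idx n → 𝔽)}
    (hU : IsOpen U) {L : Type} [Fintype L] {F : L → (Idx n → 𝔽) → 𝔽}
    (hF : ∀ l, ContDiffOn 𝔽 ∞ (F l) U) (hinv : ∀ l, IsInvariantOn hγ U (F l))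
    (hind : ∀ x ∈ U, LinearIndependent 𝔽 fun l => fderiv 𝔽 (F l) x)
    (hspan : ∀ x ∈ U, ∀ φ : (Idx n → 𝔽) →L[𝔽] 𝔽, (∀ q, φ (tangent γ q x) = 0) →
      ∃ c : L → 𝔽, φ = ∑ l, c l • fderiv 𝔽 (F l) x) :
    IsFunctionalBasis hγ U F where
  isOpen := hU
  smooth := hF
  invariant := hinv
  independent := hind
  complete _ _ hW hWU hG hGinv x hx :=
    exists_eq_comp_of_span hγ hU hF hinv (hind x (hWU hx)) (hspan x (hWU hx)) hW hWU hG hGinv hx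

/-! ### Stabilizers of points with nonvanishing corner minors -/

/-- A row vector supported on the first `k` entries is zero if the last `k` entries of its product
with `M` vanish; the mirror image `eq_zero_of_corner_right` concerns column vectors. -/
theorem eq_zero_of_corner_left {M : Matrix (Fin n) (Fin n) 𝔽}
    (hM : ∀ k : Fin (n / 2), (corner M k).det ≠ 0) {k : ℕ} (hk : k ≤ n / 2) {v : Fin n → 𝔽}
    (hv : ∀ p : Fin n, k ≤ p → v p = 0)
    (h : ∀ j : Fin n, n - k ≤ j → ∑ p, v p * M p j = 0) (p : Fin n) : v p = 0 := by
  rcases le_or_gt k p with hp | hp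
  · exact hv p hp
  obtain ⟨k, rfl⟩ : ∃ l, k = l + 1 := ⟨k - 1, by omega⟩
  let κ : Fin (n / 2) := ⟨k, by omega⟩
  have h0 : Matrix.vecMul (fun a => v (firstRows κ a)) (corner M κ) = 0 := by
    funext b
    rw [Matrix.vecMul, dotProduct]
    have h1 := h (lastCols κ b) (by simp [lastCols, κ])
    rw [Pi.zero_apply, ← h1]
    refine Finset.sum_of_injOn (firstRows κ) (firstRows_injective κ).injOn (by simp)
      (fun j _ hj => ?_) (fun _ _ => rfl)
    have hj' : j ∉ Set.range (firstRows κ) := by simpa using hj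
    rw [mem_range_firstRows] at hj'
    rw [hv j (by simp only [κ] at hj'; omega), zero_mul]
  have h2 := Matrix.eq_zero_of_vecMul_eq_zero (hM κ) h0
  obtain ⟨a, ha⟩ := (mem_range_firstRows κ p).mpr (by simp only [κ]; omega)
  rw [← ha]
  exact congrFun h2 a

theorem eq_zero_of_corner_right {M : Matrix (Fin n) (Fin n) 𝔽}
    (hM : ∀ k : Fin (n / 2), (corner M k).det ≠ 0) {k : ℕ} (hk : k ≤ n / 2) {v : Fin n → 𝔽}
    (hv : ∀ q : Fin n, (q : ℕ) < n - k → v q = 0)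
    (h : ∀ i : Fin n, (i : ℕ) < k → ∑ q, M i q * v q = 0) (q : Fin n) : v q = 0 := by
  rcases lt_or_ge (q : ℕ) (n - k) with hp | hp
  · exact hv q hp
  obtain ⟨k, rfl⟩ : ∃ l, k = l + 1 := ⟨k - 1, by omega⟩
  let κ : Fin (n / 2) := ⟨k, by omega⟩
  have h0 : Matrix.mulVec (corner M κ) (fun a => v (lastCols κ a)) = 0 := by
    funext b
    rw [Matrix.mulVec, dotProduct]
    have h1 := h (firstRows κ b) (by have := b.2; simp only [firstRows, κ] at this ⊢; omega)
    rw [Pi.zero_apply, ← h1]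
    refine Finset.sum_of_injOn (lastCols κ) (lastCols_injective κ).injOn (by simp)
      (fun j _ hj => ?_) (fun _ _ => rfl)
    have hj' : j ∉ Set.range (lastCols κ) := by simpa using hj
    rw [mem_range_lastCols] at hj'
    rw [hv j (by simp only [κ] at hj'; omega), mul_zero]
  have h2 := Matrix.eq_zero_of_mulVec_eq_zero (hM κ) h0
  obtain ⟨a, ha⟩ := (mem_range_lastCols κ q).mpr (by simp only [κ]; omega)
  rw [← ha]
  exact congrFun h2 a

/-- A strictly upper triangular matrix in the stabilizer of a regular point is determined by its
entries on the upper half of the antidiagonal. The equations of the stabilizer, taken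
in a suitable order, express the remaining entries through systems with the
corner submatrices as their matrices: first the columns from the left and the rows from the bottom
up to the middle are found to vanish, then the rows and the columns of the remaining upper right
block from inside out. -/
theorem eq_zero_of_stabilizer {M Z : Matrix (Fin n) (Fin n) 𝔽}
    (hM : ∀ k : Fin (n / 2), (corner M k).det ≠ 0)
    (hZ : ∀ i j, j ≤ i → Z i j = 0)
    (heq : ∀ i j : Fin n, i < j → ∑ p, Z p i * M p j = ∑ q, M i q * Z j q)
    (hanti : ∀ k : Fin (n / 2), Z (row k) (Fin.rev (row k)) = 0) : Z = 0 := by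
  -- The columns from the left and the rows from the bottom, in turn; for the next column the right
  -- hand sides of `heq` involve only rows already known to vanish, and vice versa.
  have step1 : ∀ k : ℕ, 2 * k ≤ n + 1 → ∀ p q : Fin n, ((q : ℕ) < k ∨ n - k ≤ p) → Z p q = 0 := by
    intro k
    induction k with
    | zero =>
      intro _ p q h
      have := p.2
      omega
    | succ k ih =>
      intro hk p q h
      have ih := ih (by omega)
      rcases h with h | h
      · by_cases hqk : (q : ℕ) < k
        · exact ih p q (Or.inl hqk)
        · have hq : (q : ℕ) = k := by omega
          refine eq_zero_of_corner_left hM (k := k) (by omega) (v := fun p => Z p q)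
            (fun p hp => hZ p q (by rw [Fin.le_def]; omega)) (fun j hj => ?_) p
          rw [heq q j (by rw [Fin.lt_def]; omega)]
          exact Finset.sum_eq_zero fun r _ => by rw [ih j r (Or.inr hj), mul_zero]
      · by_cases hpk : n - k ≤ (p : ℕ)
        · exact ih p q (Or.inr hpk)
        · have hp : (p : ℕ) = n - (k + 1) := by omega
          refine eq_zero_of_corner_right hM (k := k) (by omega) (v := fun q => Z p q)
            (fun q hq => hZ p q (by rw [Fin.le_def]; omega)) (fun i hi => ?_) q
          rw [← heq i p (by rw [Fin.lt_def]; omega)]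
          exact Finset.sum_eq_zero fun r _ => by rw [ih r i (Or.inl hi), zero_mul]
  -- The remaining upper right block, whose size `k` decreases. Here the corner submatrix leaves one
  -- entry of each row and column undetermined, the one on the antidiagonal.
  have step2 : ∀ d k : ℕ, k + d = n / 2 → ∀ p q : Fin n, (k ≤ p ∨ (q : ℕ) < n - k) →
      Z p q = 0 := by
    intro d
    induction d with
    | zero =>
      intro k hk p q h
      refine step1 (n - n / 2) (by omega) p q ?_
      omega
    | succ d ih =>
      intro k hk p q h
      have ih := ih (k + 1) (by omega)
      have hanti' : ∀ p q : Fin n, (p : ℕ) = k → (q : ℕ) = n - (k + 1) → Z p q = 0 := by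
        intro p q hp hq
        have h1 : p = row ⟨k, by omega⟩ := by
          ext
          simpa [row] using hp
        have h2 : q = Fin.rev (row ⟨k, by omega⟩) := by
          ext
          simpa [row] using hq
        rw [h1, h2]
        exact hanti _
      rcases h with h | h
      · by_cases hpk : k + 1 ≤ (p : ℕ)
        · exact ih p q (Or.inl hpk)
        · have hp : (p : ℕ) = k := by omega
          refine eq_zero_of_corner_right hM (k := k) (by omega) (v := fun q => Z p q)
            (fun q hq => ?_) (fun i hi => ?_) q
          · by_cases hq' : (q : ℕ) < n - (k + 1)
            · exact ih p q (Or.inr hq')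
            · exact hanti' p q hp (by omega)
          · rw [← heq i p (by rw [Fin.lt_def]; omega)]
            exact Finset.sum_eq_zero fun r _ => by rw [ih r i (Or.inr (by omega)), zero_mul]
      · by_cases hqk : (q : ℕ) < n - (k + 1)
        · exact ih p q (Or.inr hqk)
        · have hq : (q : ℕ) = n - (k + 1) := by omega
          refine eq_zero_of_corner_left hM (k := k) (by omega) (v := fun p => Z p q)
            (fun p hp => ?_) (fun j hj => ?_) p
          · by_cases hp' : k + 1 ≤ (p : ℕ)
            · exact ih p q (Or.inl hp')
            · exact hanti' p q (by omega) hq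
          · rw [heq q j (by rw [Fin.lt_def]; omega)]
            exact Finset.sum_eq_zero fun r _ => by rw [ih j r (Or.inl (by omega)), mul_zero]
  ext p q
  exact step2 (n / 2) 0 (by omega) p q (Or.inl (Nat.zero_le _))

/-! ### The pairing of functionals with tangent vectors -/

theorem sum_sum_dite_lt (f : {p : Fin n × Fin n // p.1 < p.2} → 𝔽) :
    ∑ i, ∑ j, (if h : i < j then f ⟨(i, j), h⟩ else 0) = ∑ p, f p := by
  rw [← Fintype.sum_prod_type']
  refine (Finset.sum_of_injOn Subtype.val Subtype.val_injective.injOn (by simp)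
    (fun p _ hp => ?_) (fun p _ => ?_)).symm
  · rw [dif_neg]
    intro h
    exact hp ⟨⟨p, h⟩, by simp, rfl⟩
  · rw [dif_pos p.2]

theorem sum_mul_tangent (γ : Fin n → 𝔽) (z q x : Idx n → 𝔽) :
    ∑ a, z a * tangent γ q x a = ((lieMat γ z).transpose * lieTr γ q x).trace := by
  rw [← sum_mul_eq_trace, Fintype.sum_option, add_comm, ← sum_sum_dite_lt]
  simp only [lieMat, Matrix.add_apply, add_mul, Finset.sum_add_distrib]
  congr 1
  · refine Finset.sum_congr rfl fun i _ => Finset.sum_congr rfl fun j _ => ?_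
    by_cases h : i < j
    · rw [dif_pos h, upperMat_apply_of_lt _ h]
      rfl
    · rw [dif_neg h, upperMat_apply_of_le _ (not_lt.mp h), zero_mul]
  · simp [tangent, Matrix.diagonal_apply, Finset.mul_sum, mul_assoc]

/-- The pairing of a functional with a tangent vector of the orbit is `⟨x, [Z, Y]⟩`, where `Z` is
the functional read as an element of the Lie algebra through its coefficients; it is antisymmetric
in these coefficients and the coordinates of `Y`. -/
theorem sum_mul_tangent_antisymm (γ : Fin n → 𝔽) (z q x : Idx n → 𝔽) :
    ∑ a, z a * tangent γ q x a = -∑ a, q a * tangent γ z x a := by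
  rw [sum_mul_tangent, sum_mul_tangent, lieTr, lieTr, Matrix.mul_sub, Matrix.mul_sub,
    Matrix.trace_sub, Matrix.trace_sub, neg_sub]
  congr 1
  · rw [← Matrix.mul_assoc, Matrix.trace_mul_comm]
  · rw [Matrix.trace_mul_comm, Matrix.mul_assoc]

theorem clm_apply_eq_sum (φ : (Idx n → 𝔽) →L[𝔽] 𝔽) (y : Idx n → 𝔽) :
    φ y = ∑ a, φ (Pi.single a 1) * y a := by
  conv_lhs => rw [pi_eq_sum_univ' y]
  simp [mul_comm]

theorem lieMat_single (γ : Fin n → 𝔽) (p : {p : Fin n × Fin n // p.1 < p.2}) :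
    lieMat γ (Pi.single (some p) 1) = Matrix.single p.1.1 p.1.2 1 := by
  have h : (Pi.single (some p) 1 : Idx n → 𝔽) none = 0 := by simp
  rw [lieMat, h, zero_smul, add_zero]
  ext i j
  rw [Matrix.single_apply]
  by_cases hij : i < j
  · rw [upperMat_apply_of_lt _ hij, Pi.single_apply]
    refine if_congr ?_ rfl rfl
    rw [Option.some.injEq, Subtype.ext_iff, Prod.ext_iff]
    exact ⟨fun h => ⟨h.1.symm, h.2.symm⟩, fun h => ⟨h.1.symm, h.2.symm⟩⟩
  · rw [upperMat_apply_of_le _ (not_lt.mp hij), if_neg]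
    rintro ⟨rfl, rfl⟩
    exact hij p.2

/-- The label of the `k`-th entry of the upper half of the antidiagonal. -/
def antiIdx (k : Fin (n / 2)) : Idx n :=
  some ⟨(row k, Fin.rev (row k)), by
    simp only [row, Fin.lt_def, Fin.val_rev]
    omega⟩

/-- A functional that does not involve `x₀` and vanishes on the vectors tangent at a regular point
to its unipotent orbit is determined by its values on the antidiagonal coordinate vectors. -/
theorem clm_eq_zero_of_antidiag (γ : Fin n → 𝔽) {x : Idx n → 𝔽} (hx : x ∈ regularDomain 𝔽 n)
    {φ : (Idx n → 𝔽) →L[𝔽] 𝔽} (h0 : φ (Pi.single none 1) = 0)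
    (hφ : ∀ q, q none = 0 → φ (tangent γ q x) = 0)
    (hanti : ∀ k, φ (Pi.single (antiIdx k) 1) = 0) : φ = 0 := by
  let z : Idx n → 𝔽 := fun a => φ (Pi.single a 1)
  have hz : lieMat γ z = upperMat z := by
    rw [lieMat, show z none = 0 from h0, zero_smul, add_zero]
  have hZ : upperMat z = 0 := by
    refine eq_zero_of_stabilizer (M := upperMat x) hx
      (fun i j h => upperMat_apply_of_le z h) (fun i j hij => ?_) (fun k => ?_)
    · have h1 := hφ (Pi.single (some ⟨(i, j), hij⟩) 1) (by simp)
      rw [clm_apply_eq_sum] at h1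
      change ∑ a, z a * _ = 0 at h1
      rw [sum_mul_tangent, hz, lieTr, lieMat_single, Matrix.transpose_single, Matrix.mul_sub,
        Matrix.trace_sub, ← Matrix.mul_assoc, Matrix.trace_mul_single, ← Matrix.mul_assoc,
        Matrix.trace_mul_comm, ← Matrix.mul_assoc, Matrix.trace_mul_single, sub_eq_zero] at h1
      simpa [Matrix.mul_apply] using h1
    · rw [upperMat_apply_of_lt]
      exact hanti k
  refine ContinuousLinearMap.ext fun y => ?_
  rw [clm_apply_eq_sum]
  refine Finset.sum_eq_zero fun a _ => ?_
  have : φ (Pi.single a 1) = 0 := by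
    rcases a with _ | p
    · exact h0
    · have h2 : upperMat z p.1.1 p.1.2 = 0 := by rw [hZ]; rfl
      rwa [upperMat_apply_of_lt _ p.2] at h2
  rw [this, zero_mul]

/-! ### Differentials of the corner minors -/

theorem fderiv_apply_of_affine {E : Type*} [NormedAddCommGroup E] [NormedSpace 𝔽 E] {F : E → 𝔽}
    {x v : E} {e : 𝔽} (hF : DifferentiableAt 𝔽 F x) (h : ∀ t : 𝔽, F (x + t • v) = F x + t * e) :
    fderiv 𝔽 F x v = e := by
  have h1 : HasDerivAt (fun t : 𝔽 => x + t • v) v 0 := by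
    simpa using ((hasDerivAt_id (0 : 𝔽)).smul_const v).const_add x
  have h2 : HasFDerivAt F (fderiv 𝔽 F x) (x + (0 : 𝔽) • v) := by
    rw [zero_smul, add_zero]
    exact hF.hasFDerivAt
  have h3 := h2.comp_hasDerivAt (0 : 𝔽) h1
  have h4 : HasDerivAt (fun t : 𝔽 => F x + t * e) e 0 := by
    simpa using ((hasDerivAt_id (0 : 𝔽)).mul_const e).const_add (F x)
  refine h3.unique (h4.congr_of_eventuallyEq (Filter.Eventually.of_forall fun t => ?_))
  exact h t

theorem differentiableAt_minor (k : Fin (n / 2)) (x : Idx n → 𝔽) :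
    DifferentiableAt 𝔽 (minor k : (Idx n → 𝔽) → 𝔽) x :=
  ((contDiff_minor 1 k).differentiable (by simp)).differentiableAt

theorem upperMat_add_single (x : Idx n → 𝔽) (t : 𝔽) (k : Fin (n / 2)) (i j : Fin n) :
    upperMat (x + t • Pi.single (antiIdx k) 1) i j
      = upperMat x i j + if i = row k ∧ j = Fin.rev (row k) then t else 0 := by
  by_cases hij : i < j
  · rw [upperMat_apply_of_lt _ hij, upperMat_apply_of_lt _ hij, Pi.add_apply, Pi.smul_apply,
      Pi.single_apply, smul_eq_mul, mul_ite, mul_one, mul_zero]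
    congr 1
    refine if_congr ?_ rfl rfl
    rw [antiIdx, Option.some.injEq, Subtype.ext_iff, Prod.ext_iff]
  · rw [upperMat_apply_of_le _ (not_lt.mp hij), upperMat_apply_of_le _ (not_lt.mp hij), if_neg,
      add_zero]
    rintro ⟨rfl, rfl⟩
    refine hij ?_
    simp only [row, Fin.lt_def, Fin.val_rev]
    omega

theorem fderiv_minor_none (k : Fin (n / 2)) (x : Idx n → 𝔽) :
    fderiv 𝔽 (minor k) x (Pi.single none 1) = 0 := by
  refine fderiv_apply_of_affine (differentiableAt_minor k x) fun t => ?_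
  rw [mul_zero, add_zero, minor, minor]
  congr 2
  ext i j
  by_cases hij : i < j
  · rw [upperMat_apply_of_lt _ hij, upperMat_apply_of_lt _ hij]
    simp
  · rw [upperMat_apply_of_le _ (not_lt.mp hij), upperMat_apply_of_le _ (not_lt.mp hij)]

theorem fderiv_minor_anti_of_lt {j k : Fin (n / 2)} (h : k < j) (x : Idx n → 𝔽) :
    fderiv 𝔽 (minor k) x (Pi.single (antiIdx j) 1) = 0 := by
  refine fderiv_apply_of_affine (differentiableAt_minor k x) fun t => ?_
  rw [mul_zero, add_zero, minor, minor]
  congr 1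
  ext a b
  change upperMat _ _ _ = upperMat _ _ _
  rw [upperMat_add_single, if_neg, add_zero]
  rintro ⟨h1, -⟩
  have h2 : (a : ℕ) = j := by simpa [firstRows, row] using h1
  have h3 : (k : ℕ) < j := h
  omega

/-- Removing the last row and the first column of a corner submatrix gives the previous one. -/
theorem det_corner_submatrix_ne_zero {M : Matrix (Fin n) (Fin n) 𝔽}
    (hM : ∀ k : Fin (n / 2), (corner M k).det ≠ 0) (k : Fin (n / 2)) :
    ((corner M k).submatrix (Fin.last k).succAbove (Fin.succAbove 0)).det ≠ 0 := by
  obtain ⟨k, hk⟩ := k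
  rcases k with _ | k
  · simp
  · refine ne_of_eq_of_ne ?_ (hM ⟨k, by omega⟩)
    congr 1
    ext a b
    change M _ _ = M _ _
    congr 1
    · ext
      simp [firstRows]
    · ext
      simp [lastCols]
      omega

theorem fderiv_minor_anti_self (k : Fin (n / 2)) {x : Idx n → 𝔽} (hx : x ∈ regularDomain 𝔽 n) :
    fderiv 𝔽 (minor k) x (Pi.single (antiIdx k) 1) ≠ 0 := by
  have h : fderiv 𝔽 (minor k) x (Pi.single (antiIdx k) 1)
      = (corner (upperMat x) k).adjugate 0 (Fin.last k) := by
    refine fderiv_apply_of_affine (differentiableAt_minor k x) fun t => ?_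
    have h1 : corner (upperMat (x + t • Pi.single (antiIdx k) 1)) k
        = (corner (upperMat x) k).updateRow (Fin.last k)
          (corner (upperMat x) k (Fin.last k) + t • Pi.single 0 1) := by
      ext a b
      change upperMat _ (firstRows k a) (lastCols k b) = _
      rw [upperMat_add_single, Matrix.updateRow_apply]
      have ha : firstRows k a = row k ↔ a = Fin.last k := by
        simp [firstRows, row, Fin.ext_iff]
      have hb : lastCols k b = Fin.rev (row k) ↔ b = 0 := by
        rw [Fin.ext_iff, Fin.ext_iff]
        simp only [lastCols, row, Fin.val_rev, Fin.val_zero]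
        omega
      simp only [ha, hb]
      by_cases h1 : a = Fin.last k
      · subst h1
        by_cases h2 : b = 0
        · subst h2
          simp [corner]
        · simp [corner, h2]
      · simp [corner, h1]
    rw [minor, h1, Matrix.det_updateRow_add, Matrix.det_updateRow_smul, Matrix.updateRow_eq_self,
      ← Matrix.adjugate_apply, minor]
  rw [h, Matrix.adjugate_fin_succ_eq_det_submatrix]
  exact mul_ne_zero (pow_ne_zero _ (by simp)) (det_corner_submatrix_ne_zero hx k)

theorem fderiv_minor_tangent {γ : Fin n → 𝔽} (hγ : ∃ i j, γ i ≠ γ j) (k : Fin (n / 2))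
    (q x : Idx n → 𝔽) :
    fderiv 𝔽 (minor k) x (tangent γ q x) = q none * weight γ k * minor k x := by
  have h1 := hasDerivAt_comp_coad hγ q x (differentiableAt_minor k x)
  simp only [minor_coad] at h1
  have h2 : HasDerivAt (fun t : 𝔽 => (chart γ (t • q)).eps * weight γ k)
      (q none * weight γ k) 0 := by
    change HasDerivAt (fun t : 𝔽 => t * q none * weight γ k) (q none * weight γ k) 0
    simpa using ((hasDerivAt_id (0 : 𝔽)).mul_const (q none)).mul_const (weight γ k)
  have h3 : HasDerivAt (NormedSpace.exp : 𝔽 → 𝔽) 1 ((chart γ ((0 : 𝔽) • q)).eps * weight γ k) := by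
    have : (chart γ ((0 : 𝔽) • q)).eps * weight γ k = 0 := by
      change 0 * q none * weight γ k = 0
      ring
    rw [this]
    exact hasDerivAt_exp_zero
  have h4 := (h3.comp (0 : 𝔽) h2).mul_const (minor k x)
  rw [one_mul] at h4
  exact h1.unique h4

/-- The Jacobian matrix of the corner minors with respect to the antidiagonal coordinates. -/
noncomputable def minorJacobian (x : Idx n → 𝔽) : Matrix (Fin (n / 2)) (Fin (n / 2)) 𝔽 :=
  Matrix.of fun j k => fderiv 𝔽 (minor k) x (Pi.single (antiIdx j) 1)

theorem det_minorJacobian_ne_zero {x : Idx n → 𝔽} (hx : x ∈ regularDomain 𝔽 n) :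
    (minorJacobian x).det ≠ 0 := by
  rw [Matrix.det_of_isUpperTriangular, Finset.prod_ne_zero_iff]
  · exact fun k _ => fderiv_minor_anti_self k hx
  · intro j k h
    exact fderiv_minor_anti_of_lt h x

theorem eq_zero_of_sum_fderiv_minor {x : Idx n → 𝔽} (hx : x ∈ regularDomain 𝔽 n)
    {c : Fin (n / 2) → 𝔽} (hc : ∀ y, ∑ k, c k * fderiv 𝔽 (minor k) x y = 0)
    (k : Fin (n / 2)) : c k = 0 := by
  have h : Matrix.mulVec (minorJacobian x) c = 0 := by
    funext j
    have := hc (Pi.single (antiIdx j) 1)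
    simpa [Matrix.mulVec, dotProduct, minorJacobian, mul_comm] using this
  exact congrFun (Matrix.eq_zero_of_mulVec_eq_zero (det_minorJacobian_ne_zero hx) h) k

theorem linearIndependent_clm_iff {E : Type*} [NormedAddCommGroup E] [NormedSpace 𝔽 E]
    {L : Type*} [Fintype L] {φ : L → E →L[𝔽] 𝔽} :
    LinearIndependent 𝔽 φ ↔ ∀ c : L → 𝔽, (∀ y, ∑ l, c l * φ l y = 0) → ∀ l, c l = 0 := by
  rw [Fintype.linearIndependent_iff]
  refine forall_congr' fun c => imp_congr_left ⟨fun h y => ?_, fun h => ?_⟩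
  · simpa using congrArg (fun f : E →L[𝔽] 𝔽 => f y) h
  · refine ContinuousLinearMap.ext fun y => ?_
    simpa using h y

/-- The differentials of the corner minors span the space of the functionals that do not
involve `x₀` and vanish on the tangent space of the unipotent orbit. -/
theorem exists_eq_sum_fderiv_minor {γ : Fin n → 𝔽} (hγ : ∃ i j, γ i ≠ γ j) {x : Idx n → 𝔽}
    (hx : x ∈ regularDomain 𝔽 n) {φ : (Idx n → 𝔽) →L[𝔽] 𝔽} (h0 : φ (Pi.single none 1) = 0)
    (hφ : ∀ q, q none = 0 → φ (tangent γ q x) = 0) :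
    ∃ c : Fin (n / 2) → 𝔽, φ = ∑ k, c k • fderiv 𝔽 (minor k) x := by
  let c := Matrix.mulVec (minorJacobian x)⁻¹ fun j => φ (Pi.single (antiIdx j) 1)
  have hc : Matrix.mulVec (minorJacobian x) c = fun j => φ (Pi.single (antiIdx j) 1) := by
    rw [Matrix.mulVec_mulVec, Matrix.mul_nonsing_inv _
      (isUnit_iff_ne_zero.mpr (det_minorJacobian_ne_zero hx)), Matrix.one_mulVec]
  refine ⟨c, ?_⟩
  rw [← sub_eq_zero]
  refine clm_eq_zero_of_antidiag γ hx ?_ (fun q hq => ?_) (fun j => ?_)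
  · simp [h0, fderiv_minor_none]
  · simp [hφ q hq, fderiv_minor_tangent hγ, hq]
  · have := congrFun hc j
    simp only [Matrix.mulVec, dotProduct, minorJacobian, Matrix.of_apply] at this
    simp [← this, mul_comm]

/-! ### The invariant linear in `x₀` -/

/-- The indices `i` with `k + 1 ≤ i ≤ n - k` in the numbering from `1`. -/
def middle (k : Fin (n / 2)) : Finset (Fin n) :=
  Finset.univ.filter fun i : Fin n => (k : ℕ) < i ∧ (i : ℕ) + k + 1 < n

/-- The product of the last columns of `M`, the inverse of its corner submatrix and the first rows
of `M`. It has the same first rows and the same last columns as `M`. -/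
noncomputable def midMat (M : Matrix (Fin n) (Fin n) 𝔽) (k : Fin (n / 2)) :
    Matrix (Fin n) (Fin n) 𝔽 :=
  M.submatrix id (lastCols k) * (corner M k)⁻¹ * M.submatrix (firstRows k) id

/-- Outside the middle block `midMat M k` has the diagonal of `M`. -/
theorem midMat_diag {M : Matrix (Fin n) (Fin n) 𝔽} {k : Fin (n / 2)} (hM : (corner M k).det ≠ 0)
    {i : Fin n} (hi : i ∉ middle k) : midMat M k i i = M i i := by
  have hu : IsUnit (corner M k).det := isUnit_iff_ne_zero.mpr hM
  rcases le_or_gt (i : ℕ) k with h | h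
  · obtain ⟨a, rfl⟩ := (mem_range_firstRows k i).mpr h
    have h1 : (midMat M k).submatrix (firstRows k) id = M.submatrix (firstRows k) id := by
      have : (midMat M k).submatrix (firstRows k) id
          = corner M k * (corner M k)⁻¹ * M.submatrix (firstRows k) id := rfl
      rw [this, Matrix.mul_nonsing_inv _ hu, Matrix.one_mul]
    exact congrFun (congrFun h1 a) (firstRows k a)
  · obtain ⟨b, rfl⟩ := (mem_range_lastCols k i).mpr (by
      have : ¬ ((k : ℕ) < i ∧ (i : ℕ) + k + 1 < n) := by simpa [middle] using hi
      omega)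
    have h1 : (midMat M k).submatrix id (lastCols k) = M.submatrix id (lastCols k) := by
      have : (midMat M k).submatrix id (lastCols k)
          = M.submatrix id (lastCols k) * (corner M k)⁻¹ * corner M k := rfl
      rw [this, Matrix.mul_assoc, Matrix.nonsing_inv_mul _ hu, Matrix.mul_one]
    exact congrFun (congrFun h1 (lastCols k b)) b

theorem sum_middle_midMat {M : Matrix (Fin n) (Fin n) 𝔽} {k : Fin (n / 2)}
    (hM : (corner M k).det ≠ 0) :
    ∑ i ∈ middle k, midMat M k i i
      = (midMat M k).trace - ∑ i ∈ (middle k)ᶜ, M i i := by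
  rw [Matrix.trace, ← Finset.sum_add_sum_compl (middle k), eq_sub_iff_add_eq]
  congr 1
  exact Finset.sum_congr rfl fun i hi => (midMat_diag hM (Finset.mem_compl.mp hi)).symm

theorem exp_ne_zero' (z : 𝔽) : NormedSpace.exp z ≠ 0 := (NormedSpace.isUnit_exp z).ne_zero

theorem transpose_mul_inv_transpose {γ : Fin n → 𝔽} (B : TGroup γ) :
    B.mat.transpose * (B.mat⁻¹).transpose = 1 := by
  rw [← Matrix.transpose_mul, Matrix.nonsing_inv_mul _ B.isUnit_det, Matrix.transpose_one]

theorem trace_conjTr {γ : Fin n → 𝔽} (B : TGroup γ) (M : Matrix (Fin n) (Fin n) 𝔽) :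
    (conjTr B M).trace = M.trace := by
  rw [conjTr, Matrix.trace_mul_comm, ← Matrix.mul_assoc, transpose_mul_inv_transpose,
    Matrix.one_mul]

theorem midMat_conjTr {γ : Fin n → 𝔽} (B : TGroup γ) (M : Matrix (Fin n) (Fin n) 𝔽)
    (k : Fin (n / 2)) : midMat (conjTr B M) k = conjTr B (midMat M k) := by
  have h1 : (conjTr B M).submatrix id (lastCols k) = (B.mat⁻¹).transpose
      * M.submatrix id (lastCols k) * B.mat.transpose.submatrix (lastCols k) (lastCols k) := by
    rw [conjTr, submatrix_mul_right (lastCols_injective k)]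
    · rfl
    · intro a j hj
      rw [mem_range_lastCols] at hj
      refine B.upper _ _ ?_
      simp only [lastCols, Fin.lt_def]
      omega
  have h2 : (conjTr B M).submatrix (firstRows k) id
      = (B.mat⁻¹).transpose.submatrix (firstRows k) (firstRows k)
        * M.submatrix (firstRows k) id * B.mat.transpose := by
    rw [conjTr, Matrix.mul_assoc, submatrix_mul_left (firstRows_injective k), Matrix.mul_assoc]
    · rfl
    · intro a j hj
      rw [mem_range_firstRows] at hj
      refine B.inv_upper _ _ ?_
      simp only [firstRows, Fin.lt_def]
      omega
  have hl : IsUnit ((B.mat⁻¹).transpose.submatrix (firstRows k) (firstRows k)).det := by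
    rw [det_firstRows_block, isUnit_iff_ne_zero, Finset.prod_ne_zero_iff]
    exact fun a _ => exp_ne_zero' _
  have hr : IsUnit (B.mat.transpose.submatrix (lastCols k) (lastCols k)).det := by
    rw [det_lastCols_block, isUnit_iff_ne_zero, Finset.prod_ne_zero_iff]
    exact fun a _ => exp_ne_zero' _
  rw [midMat, h1, h2, corner_conjTr, Matrix.mul_inv_rev, Matrix.mul_inv_rev, conjTr, midMat]
  simp only [Matrix.mul_assoc]
  rw [Matrix.mul_nonsing_inv_cancel_left _ _ hr, Matrix.nonsing_inv_mul_cancel_left _ _ hl]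

theorem sum_ite_telescope (g : ℕ → 𝔽) (m : ℕ) : ∀ h : ℕ, m ≤ h →
    ∑ k ∈ Finset.range h, (if m ≤ k then g k - g (k + 1) else 0) = g m - g h := by
  intro h
  induction h with
  | zero =>
    intro hm
    obtain rfl : m = 0 := by omega
    simp
  | succ h ih =>
    intro hm
    rw [Finset.sum_range_succ]
    rcases Nat.lt_or_ge h m with h1 | h1
    · obtain rfl : m = h + 1 := by omega
      rw [if_neg (by omega), add_zero, sub_self]
      exact Finset.sum_eq_zero fun k hk => if_neg (by have := Finset.mem_range.mp hk; omega)
    · rw [if_pos h1, ih h1]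
      ring

/-- Abel summation for a family of coefficients that is symmetric under `i ↦ n - i + 1`. -/
theorem sum_mul_eq_abel {γ : Fin n → 𝔽} (hsym : ∀ k : Fin (n / 2), γ (row k) = γ (Fin.rev (row k)))
    {d : Fin n → 𝔽} (hd : ∑ i, d i = 0) :
    ∑ i, γ i * d i
      = ∑ k : Fin (n / 2), (γ (row k) - γ (rowSucc k)) * ∑ i ∈ (middle k)ᶜ, d i := by
  let g : ℕ → 𝔽 := fun k => if h : k < n then γ ⟨k, h⟩ else 0
  have hmid : ∀ (k : Fin (n / 2)) (i : Fin n), i ∈ (middle k)ᶜ ↔ min (i : ℕ) (n - 1 - i) ≤ k := by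
    intro k i
    simp only [middle, Finset.mem_compl, Finset.mem_filter, Finset.mem_univ, true_and]
    omega
  have hin : ∀ i : Fin n, ∑ k : Fin (n / 2), (if min (i : ℕ) (n - 1 - i) ≤ k then
      γ (row k) - γ (rowSucc k) else 0) = γ i - g (n / 2) := by
    intro i
    have h1 := sum_ite_telescope g (min (i : ℕ) (n - 1 - i)) (n / 2) (by omega)
    rw [Finset.sum_range] at h1
    have h2 : g (min (i : ℕ) (n - 1 - i)) = γ i := by
      rcases le_or_gt (i : ℕ) (n - 1 - i) with h | h
      · rw [min_eq_left h]
        simp [g]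
      · rw [min_eq_right h.le]
        have h3 := hsym ⟨n - 1 - i, by omega⟩
        have h4 : Fin.rev (row (⟨n - 1 - i, by omega⟩ : Fin (n / 2))) = i := by
          ext
          simp only [row, Fin.val_rev]
          omega
        rw [h4] at h3
        simp only [g]
        rw [dif_pos (by omega), ← h3]
        rfl
    rw [h2] at h1
    rw [← h1]
    refine Finset.sum_congr rfl fun k _ => ?_
    have h5 : g k = γ (row k) := dif_pos (by omega)
    have h6 : g (k + 1) = γ (rowSucc k) := dif_pos (by omega)
    rw [h5, h6]
  have h7 : ∀ k : Fin (n / 2), (γ (row k) - γ (rowSucc k)) * ∑ i ∈ (middle k)ᶜ, d i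
      = ∑ i : Fin n,
        (if min (i : ℕ) (n - 1 - i) ≤ k then γ (row k) - γ (rowSucc k) else 0) * d i := by
    intro k
    rw [Finset.mul_sum, ← Finset.sum_subset (Finset.subset_univ (middle k)ᶜ)]
    · exact Finset.sum_congr rfl fun i hi => by rw [if_pos ((hmid k i).mp hi)]
    · intro i _ hi
      rw [if_neg (fun h => hi ((hmid k i).mpr h)), zero_mul]
  simp only [h7]
  rw [Finset.sum_comm]
  simp only [← Finset.sum_mul, hin, sub_mul, Finset.sum_sub_distrib]
  rw [← Finset.mul_sum, hd, mul_zero, sub_zero]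

/-- The invariant linear in `x₀`, in terms of the inverses of the corner submatrices. -/
noncomputable def midInv (γ : Fin n → 𝔽) (x : Idx n → 𝔽) : 𝔽 :=
  x none + ∑ k : Fin (n / 2), (γ (row k) - γ (rowSucc k))
    * ∑ i ∈ middle k, midMat (upperMat x) k i i

theorem trace_upperMat (x : Idx n → 𝔽) : (upperMat x).trace = 0 :=
  Finset.sum_eq_zero fun _ _ => upperMat_apply_of_le x le_rfl

/-- The traces of the matrices `midMat` do not change under conjugation, and the contributions of
the diagonal entries of the conjugate matrix to them compensate for the change of `x₀`. -/
theorem midInv_coad {γ : Fin n → 𝔽} (hγ : ∃ i j, γ i ≠ γ j)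
    (hsym : ∀ k : Fin (n / 2), γ (row k) = γ (Fin.rev (row k))) (B : TGroup γ) {x : Idx n → 𝔽}
    (hx : x ∈ regularDomain 𝔽 n) : midInv γ (coad hγ B x) = midInv γ x := by
  set N := conjTr B (upperMat x) with hN
  have hxk : ∀ k, (corner (upperMat x) k).det ≠ 0 := hx
  have hNk : ∀ k, (corner N k).det ≠ 0 := by
    intro k
    have := minor_coad hγ B x k
    rw [minor, corner_coad] at this
    rw [hN, this]
    exact mul_ne_zero (exp_ne_zero' _) (hx k)
  have h1 : ∀ k, ∑ i ∈ middle k, midMat (upperMat (coad hγ B x)) k i i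
      = (midMat (upperMat x) k).trace - ∑ i ∈ (middle k)ᶜ, N i i := by
    intro k
    rw [← trace_conjTr B, ← midMat_conjTr, ← sum_middle_midMat (hNk k)]
    refine Finset.sum_congr rfl fun i hi => ?_
    simp only [middle, Finset.mem_filter, Finset.mem_univ, true_and] at hi
    simp only [midMat, Matrix.mul_apply, corner_coad, Matrix.submatrix_apply, id, ← hN]
    refine Finset.sum_congr rfl fun a _ => ?_
    have ha : firstRows k a < i := by
      simp only [firstRows, Fin.lt_def]
      omega
    rw [upperMat_coad hγ B x ha]
    congr 1
    refine Finset.sum_congr rfl fun b _ => ?_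
    have hb : i < lastCols k b := by
      simp only [lastCols, Fin.lt_def]
      omega
    rw [upperMat_coad hγ B x hb]
  have h2 : ∀ k, ∑ i ∈ middle k, midMat (upperMat x) k i i = (midMat (upperMat x) k).trace := by
    intro k
    rw [sum_middle_midMat (hxk k), sub_eq_self]
    exact Finset.sum_eq_zero fun i _ => upperMat_apply_of_le x le_rfl
  have h3 := sum_mul_eq_abel hsym (d := fun i => N i i)
    ((trace_conjTr B (upperMat x)).trans (trace_upperMat x))
  simp only [midInv, h1, h2, coad_none, ← hN, h3, mul_sub, Finset.sum_sub_distrib]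
  ring

/-- The Schur complement formula for the determinant of `bordered`. -/
theorem det_bordered {M : Matrix (Fin n) (Fin n) 𝔽} {k : Fin (n / 2)} (hM : (corner M k).det ≠ 0)
    (i : Fin n) :
    (bordered M k i).det = (-1) ^ ((k : ℕ) + 1 + 1) * (corner M k).det * midMat M k i i := by
  have hu : IsUnit (corner M k).det := isUnit_iff_ne_zero.mpr hM
  -- the first column is cleared above its last entry by means of the other columns
  let w : Fin (k + 1) → 𝔽 := Matrix.mulVec (corner M k)⁻¹ fun a => M (firstRows k a) i
  let c : Fin (k + 1 + 1) → 𝔽 := Fin.cons 1 fun b => -w b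
  have hw : Matrix.mulVec (corner M k) w = fun a => M (firstRows k a) i := by
    rw [Matrix.mulVec_mulVec, Matrix.mul_nonsing_inv _ hu, Matrix.one_mulVec]
  have hmid : midMat M k i i = ∑ b, M i (lastCols k b) * w b := by
    simp only [midMat, Matrix.mul_assoc]
    rfl
  have h1 := Matrix.det_updateCol_sum (bordered M k i) 0 c
  have hc0 : c 0 = 1 := rfl
  rw [hc0, one_smul] at h1
  rw [← h1, Matrix.det_succ_column_zero, Finset.sum_eq_single (Fin.last _)]
  · have h2 : ((bordered M k i).updateCol 0 fun k_1 => ∑ j, c j • bordered M k i k_1 j)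
        (Fin.last _) 0 = -midMat M k i i := by
      rw [Matrix.updateCol_self, Fin.sum_univ_succ, hmid, ← Finset.sum_neg_distrib]
      simp [c, bordered, mul_comm]
    have h3 : ((bordered M k i).updateCol 0 fun k_1 => ∑ j, c j • bordered M k i k_1 j).submatrix
        (Fin.last _).succAbove Fin.succ = corner M k := by
      ext a b
      rw [Matrix.submatrix_apply, Matrix.updateCol_ne (Fin.succ_ne_zero b)]
      simp [bordered, corner]
    rw [h2, h3, Fin.val_last]
    ring
  · intro a _ ha
    obtain ⟨a, rfl⟩ := Fin.exists_castSucc_eq.mpr ha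
    have h2 : ((bordered M k i).updateCol 0 fun k_1 => ∑ j, c j • bordered M k i k_1 j)
        a.castSucc 0 = 0 := by
      have h3 := congrFun hw a
      simp only [Matrix.mulVec, dotProduct, corner, Matrix.of_apply] at h3
      rw [Matrix.updateCol_self, Fin.sum_univ_succ]
      simp [c, bordered, ← h3, mul_comm]
    rw [h2, mul_zero, zero_mul]
  · simp

/-! ### The singular case -/

theorem weight_eq_sum (γ : Fin n → 𝔽) (k : Fin (n / 2)) :
    weight γ k = ∑ i ∈ Finset.Iic k, (γ (Fin.rev (row i)) - γ (row i)) := by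
  have h1 : ∑ a : Fin (k + 1), γ (lastCols k a)
      = ∑ a : Fin (k + 1), γ (Fin.rev (firstRows k a)) := by
    rw [← Equiv.sum_comp Fin.revPerm]
    refine Finset.sum_congr rfl fun a _ => ?_
    congr 1
    ext
    simp only [Fin.revPerm_apply, lastCols, firstRows, Fin.val_rev]
    omega
  rw [weight, Finset.sum_sub_distrib, h1, ← Finset.sum_sub_distrib]
  refine Finset.sum_of_injOn (fun a => (⟨a, by omega⟩ : Fin (n / 2))) ?_ ?_ ?_ ?_
  · intro a _ b _ h
    simpa [Fin.ext_iff] using h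
  · intro a _
    simp only [Finset.coe_Iic, Set.mem_Iic, Fin.le_def]
    omega
  · intro i hi hi'
    refine absurd ?_ hi'
    rw [Finset.mem_Iic, Fin.le_def] at hi
    exact ⟨⟨i, by omega⟩, by simp, rfl⟩
  · exact fun a _ => rfl

theorem isOpen_regularDomain : IsOpen (regularDomain 𝔽 n) := by
  have h : regularDomain 𝔽 n = ⋂ k : Fin (n / 2), {x | minor k x ≠ 0} := by
    ext x
    simp [regularDomain, minor]
  rw [h]
  exact isOpen_iInter_of_finite fun k =>
    isOpen_ne_fun (contDiff_minor 0 k).continuous continuous_const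

theorem isInvariantOn_minor {γ : Fin n → 𝔽} (hγ : ∃ i j, γ i ≠ γ j) {k : Fin (n / 2)}
    (hk : weight γ k = 0) (U : Set (Idx n → 𝔽)) : IsInvariantOn hγ U (minor k) := by
  intro x B _ _ _
  rw [minor_coad, hk, mul_zero, NormedSpace.exp_zero, one_mul]

/-- The invariant linear in `x₀` as a combination of determinants; the constants `e k` change it by
an additive constant. -/
noncomputable def singFun (γ : Fin n → 𝔽) (e : Fin (n / 2) → 𝔽) (x : Idx n → 𝔽) : 𝔽 :=
  x none + ∑ k : Fin (n / 2), (-1) ^ ((k : ℕ) + 1 + 1) / minor k x * (γ (row k) - γ (rowSucc k))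
    * (∑ i ∈ middle k, (bordered (upperMat x) k i).det + e k * minor k x)

/-- On the regular domain `singFun` is the invariant `midInv` up to an additive constant. -/
theorem singFun_eq (γ : Fin n → 𝔽) (e : Fin (n / 2) → 𝔽) {x : Idx n → 𝔽}
    (hx : x ∈ regularDomain 𝔽 n) :
    singFun γ e x = midInv γ x
      + ∑ k : Fin (n / 2), (-1) ^ ((k : ℕ) + 1 + 1) * (γ (row k) - γ (rowSucc k)) * e k := by
  rw [singFun, midInv, add_assoc, ← Finset.sum_add_distrib]
  congr 1
  refine Finset.sum_congr rfl fun k _ => ?_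
  have hk : minor k x ≠ 0 := hx k
  have h1 : ∀ i ∈ middle k, (bordered (upperMat x) k i).det
      = (-1) ^ ((k : ℕ) + 1 + 1) * minor k x * midMat (upperMat x) k i i :=
    fun i _ => det_bordered (hx k) i
  rw [Finset.sum_congr rfl h1, ← Finset.mul_sum]
  have h2 : ((-1 : 𝔽) ^ ((k : ℕ) + 1 + 1)) * (-1) ^ ((k : ℕ) + 1 + 1) = 1 := by
    rw [← mul_pow]
    simp
  generalize (∑ i ∈ middle k, midMat (upperMat x) k i i) = S
  generalize ((-1 : 𝔽) ^ ((k : ℕ) + 1 + 1)) = s at h2 ⊢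
  field_simp
  linear_combination (S * γ (row k) - S * γ (rowSucc k)) * h2

theorem contDiff_det_bordered (m : WithTop ℕ∞) (k : Fin (n / 2)) (i : Fin n) :
    ContDiff 𝔽 m fun x : Idx n → 𝔽 => (bordered (upperMat x) k i).det := by
  refine contDiff_det fun a b => ?_
  refine Fin.lastCases ?_ (fun a => ?_) a
  · refine Fin.cases ?_ (fun b => ?_) b
    · simpa [bordered] using contDiff_const
    · simpa [bordered] using contDiff_upperMat_entry m i (lastCols k b)
  · refine Fin.cases ?_ (fun b => ?_) b
    · simpa [bordered] using contDiff_upperMat_entry m (firstRows k a) i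
    · simpa [bordered] using contDiff_upperMat_entry m (firstRows k a) (lastCols k b)

theorem contDiffOn_singFun (γ : Fin n → 𝔽) (e : Fin (n / 2) → 𝔽) :
    ContDiffOn 𝔽 ∞ (singFun γ e) (regularDomain 𝔽 n) := by
  refine ContDiffOn.add (contDiff_apply 𝔽 𝔽 (none : Idx n)).contDiffOn
    (ContDiffOn.sum fun k _ => ?_)
  refine ((contDiffOn_const.div (contDiff_minor ∞ k).contDiffOn
    fun x (hx : x ∈ regularDomain 𝔽 n) => hx k).mul contDiffOn_const).mul (ContDiff.contDiffOn ?_)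
  exact (ContDiff.sum fun i _ => contDiff_det_bordered ∞ k i).add
    (contDiff_const.mul (contDiff_minor ∞ k))

theorem upperMat_add_smul_none (x : Idx n → 𝔽) (t : 𝔽) :
    upperMat (x + t • Pi.single none 1) = upperMat x := by
  ext i j
  by_cases hij : i < j
  · rw [upperMat_apply_of_lt _ hij, upperMat_apply_of_lt _ hij]
    simp
  · rw [upperMat_apply_of_le _ (not_lt.mp hij), upperMat_apply_of_le _ (not_lt.mp hij)]

theorem fderiv_singFun_none (γ : Fin n → 𝔽) (e : Fin (n / 2) → 𝔽) {x : Idx n → 𝔽}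
    (hx : x ∈ regularDomain 𝔽 n) : fderiv 𝔽 (singFun γ e) x (Pi.single none 1) = 1 := by
  refine fderiv_apply_of_affine
    (((contDiffOn_singFun γ e).contDiffAt (isOpen_regularDomain.mem_nhds hx)).differentiableAt
      (by simp)) fun t => ?_
  simp only [singFun, minor, upperMat_add_smul_none]
  simp only [Pi.add_apply, Pi.smul_apply, Pi.single_eq_same, smul_eq_mul]
  ring

/-- The functional basis in the singular case. -/
theorem isFunctionalBasis_singular {γ : Fin n → 𝔽} (hγ : ∃ i j, γ i ≠ γ j)
    (hsym : ∀ k : Fin (n / 2), γ (row k) = γ (Fin.rev (row k))) (e : Fin (n / 2) → 𝔽) :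
    IsFunctionalBasis hγ (regularDomain 𝔽 n)
      (fun l : Option (Fin (n / 2)) => l.elim (singFun γ e) minor) := by
  have hw : ∀ k, weight γ k = 0 := by
    intro k
    rw [weight_eq_sum]
    exact Finset.sum_eq_zero fun i _ => by rw [hsym i, sub_self]
  have hinv : IsInvariantOn hγ (regularDomain 𝔽 n) (singFun γ e) := by
    intro x B _ hB0 hBU
    have hx : x ∈ regularDomain 𝔽 n := by
      have := hBU 0
      rwa [hB0, coad_one] at this
    rw [singFun_eq γ e (hBU 1), singFun_eq γ e hx, midInv_coad hγ hsym _ hx]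
  have hsum : ∀ (x : Idx n → 𝔽) (c : Option (Fin (n / 2)) → 𝔽),
      ∑ l, c l • fderiv 𝔽 (Option.elim l (singFun γ e) minor) x
        = c none • fderiv 𝔽 (singFun γ e) x + ∑ k, c (some k) • fderiv 𝔽 (minor k) x := by
    intro x c
    rw [Fintype.sum_option]
    rfl
  refine isFunctionalBasis_of_span hγ isOpen_regularDomain ?_ ?_ (fun x hx => ?_)
    (fun x hx φ hφ => ?_)
  · rintro (_ | k)
    · exact contDiffOn_singFun γ e
    · exact (contDiff_minor ∞ k).contDiffOn
  · rintro (_ | k)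
    · exact hinv
    · exact isInvariantOn_minor hγ (hw k) _
  · rw [linearIndependent_clm_iff]
    intro c hc
    simp only [Fintype.sum_option, Option.elim] at hc
    have h0 : c none = 0 := by
      simpa [fderiv_singFun_none γ e hx, fderiv_minor_none] using hc (Pi.single none 1)
    simp only [h0, zero_mul, zero_add] at hc
    rintro (_ | k)
    · exact h0
    · exact eq_zero_of_sum_fderiv_minor hx hc k
  · have hd : DifferentiableAt 𝔽 (singFun γ e) x :=
      ((contDiffOn_singFun γ e).contDiffAt (isOpen_regularDomain.mem_nhds hx)).differentiableAt
        (by simp)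
    obtain ⟨c, hc⟩ := exists_eq_sum_fderiv_minor hγ hx
      (φ := φ - φ (Pi.single none 1) • fderiv 𝔽 (singFun γ e) x)
      (by simp [fderiv_singFun_none γ e hx])
      (fun q _ => by
        simp [hφ q, fderiv_tangent_of_invariant hγ isOpen_regularDomain hinv hx hd])
    refine ⟨fun l => l.elim (φ (Pi.single none 1)) c, ?_⟩
    rw [hsum]
    exact (add_eq_of_eq_sub' hc.symm).symm

/-! ### The regular case -/

theorem IsPowerBranch.contDiffOn {α : 𝔽} {V : Set 𝔽} {P : 𝔽 → 𝔽} (hV : IsOpen V)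
    (hP : IsPowerBranch α V P) : ContDiffOn 𝔽 ∞ P V := by
  have hd : DifferentiableOn 𝔽 P V := fun z hz =>
    (hP z hz).2.2.differentiableAt.differentiableWithinAt
  have h : ∀ m : ℕ, ContDiffOn 𝔽 m P V := by
    intro m
    induction m with
    | zero => exact contDiffOn_zero.mpr hd.continuousOn
    | succ m ih =>
      refine (contDiffOn_succ_iff_deriv_of_isOpen (n := (m : WithTop ℕ∞)) hV).mpr ⟨hd, by simp, ?_⟩
      refine ContDiffOn.congr (f := fun z => α * P z / z)
        ((contDiffOn_const.mul ih).div contDiffOn_id fun z hz => (hP z hz).1) fun z hz => ?_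
      exact (hP z hz).2.2.deriv
  exact contDiffOn_infty.mpr h

theorem continuous_eps (γ : Fin n → 𝔽) : Continuous (TGroup.eps : TGroup γ → 𝔽) := by
  have h : Continuous fun B : TGroup γ => (B.mat, B.eps) := continuous_induced_dom
  exact continuous_snd.comp h

/-- Along a curve of parameters for which `exp (ε s) z` stays in `V`, a branch `P` of the power
function with the exponent `α` is multiplied by `exp (α s ε)`. -/
theorem IsPowerBranch.apply_exp_mul {α s w z : 𝔽} {V : Set 𝔽} {P : 𝔽 → 𝔽} (hV : IsOpen V)
    (hP : IsPowerBranch α V P) (hw : α * s + w = 0) {ε : unitInterval → 𝔽} (hε : Continuous ε)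
    (h0 : ε 0 = 0) (hεV : ∀ t, NormedSpace.exp (ε t * s) * z ∈ V) :
    P (NormedSpace.exp (ε 1 * s) * z) * NormedSpace.exp (ε 1 * w) = P z := by
  -- the function whose derivative vanishes on the open set of admissible parameters
  let g : 𝔽 → 𝔽 := fun u => P (NormedSpace.exp (u * s) * z) * NormedSpace.exp (u * w)
  let O : Set 𝔽 := (fun u => NormedSpace.exp (u * s) * z) ⁻¹' V
  have hexp : ∀ c u : 𝔽, HasDerivAt (fun u => NormedSpace.exp (u * c))
      (NormedSpace.exp (u * c) * c) u := by
    intro c u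
    have h1 : HasDerivAt (fun u : 𝔽 => u * c) c u := by
      simpa using (hasDerivAt_id u).mul_const c
    exact (hasDerivAt_exp (x := u * c)).comp u h1
  have hO : IsOpen O := hV.preimage (continuous_iff_continuousAt.mpr fun u =>
    ((hexp s u).mul_const z).continuousAt)
  have hg : ∀ u ∈ O, HasDerivAt g 0 u := by
    intro u hu
    obtain ⟨hz, -, hPz⟩ := hP _ hu
    replace hz : NormedSpace.exp (u * s) * z ≠ 0 := hz
    have h1 := (hPz.comp u ((hexp s u).mul_const z)).mul (hexp w u)
    refine h1.congr_deriv ?_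
    simp only [Function.comp_apply]
    have h2 : α * P (NormedSpace.exp (u * s) * z) / (NormedSpace.exp (u * s) * z)
        * (NormedSpace.exp (u * s) * s * z) = α * s * P (NormedSpace.exp (u * s) * z) := by
      rw [div_mul_eq_mul_div, div_eq_iff hz]
      ring
    rw [h2]
    linear_combination (P (NormedSpace.exp (u * s) * z) * NormedSpace.exp (u * w)) * hw
  have hloc : IsLocallyConstant fun t => g (ε t) := by
    rw [IsLocallyConstant.iff_eventually_eq]
    intro t
    obtain ⟨r, hr, hball⟩ := Metric.mem_nhds_iff.mp (hO.mem_nhds (hεV t))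
    filter_upwards [hε.continuousAt.preimage_mem_nhds (Metric.ball_mem_nhds (ε t) hr)] with u hu
    let _ : NormedSpace ℝ 𝔽 := NormedSpace.restrictScalars ℝ 𝔽 𝔽
    exact Metric.isOpen_ball.is_const_of_deriv_eq_zero (convex_ball (ε t) r).isPreconnected
      (fun y hy => (hg y (hball hy)).differentiableAt.differentiableWithinAt)
      (fun y hy => (hg y (hball hy)).deriv) hu (Metric.mem_ball_self hr)
  have h1 := hloc.apply_eq_of_isPreconnected isPreconnected_univ (Set.mem_univ 1) (Set.mem_univ 0)
  simpa [g, h0] using h1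

theorem weight_eq_zero {γ : Fin n → 𝔽} {k₀ : Fin (n / 2)}
    (hlt : ∀ k : Fin (n / 2), k < k₀ → γ (row k) = γ (Fin.rev (row k))) {k : Fin (n / 2)}
    (hk : k < k₀) : weight γ k = 0 := by
  rw [weight_eq_sum]
  exact Finset.sum_eq_zero fun i hi => by
    rw [hlt i ((Finset.mem_Iic.mp hi).trans_lt hk), sub_self]

theorem weight_eq_sum_Icc {γ : Fin n → 𝔽} {k₀ : Fin (n / 2)}
    (hlt : ∀ k : Fin (n / 2), k < k₀ → γ (row k) = γ (Fin.rev (row k))) (k : Fin (n / 2)) :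
    weight γ k = ∑ i ∈ Finset.Icc k₀ k, (γ (Fin.rev (row i)) - γ (row i)) := by
  rw [weight_eq_sum]
  symm
  refine Finset.sum_subset (fun i hi => Finset.mem_Iic.mpr (Finset.mem_Icc.mp hi).2)
    fun i hi hi' => ?_
  rw [hlt i, sub_self]
  by_contra h
  exact hi' (Finset.mem_Icc.mpr ⟨not_lt.mp h, Finset.mem_Iic.mp hi⟩)

theorem weight_self {γ : Fin n → 𝔽} {k₀ : Fin (n / 2)}
    (hlt : ∀ k : Fin (n / 2), k < k₀ → γ (row k) = γ (Fin.rev (row k))) :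
    weight γ k₀ = γ (Fin.rev (row k₀)) - γ (row k₀) := by
  rw [weight_eq_sum_Icc hlt, Finset.Icc_self, Finset.sum_singleton]

theorem alpha_mul_weight_add {γ : Fin n → 𝔽} {k₀ : Fin (n / 2)}
    (hne : γ (row k₀) ≠ γ (Fin.rev (row k₀)))
    (hlt : ∀ k : Fin (n / 2), k < k₀ → γ (row k) = γ (Fin.rev (row k))) (k : Fin (n / 2)) :
    alpha γ k₀ k * weight γ k₀ + weight γ k = 0 := by
  have h : γ (Fin.rev (row k₀)) - γ (row k₀) ≠ 0 := sub_ne_zero.mpr hne.symm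
  rw [alpha, weight_self hlt, weight_eq_sum_Icc hlt k, ← Finset.sum_div, neg_mul,
    div_mul_cancel₀ _ h, neg_add_cancel]

/-- The functions forming the functional basis in the regular case. -/
noncomputable def regFun (k₀ : Fin (n / 2)) (P : Fin (n / 2) → 𝔽 → 𝔽) (k : Fin (n / 2))
    (x : Idx n → 𝔽) : 𝔽 :=
  if k < k₀ then minor k x else P k (minor k₀ x) * minor k x

/-- The functional basis in the regular case. A functional that vanishes on the tangent space of
the orbit does not involve `x₀`, since its pairing with the semi-invariant minor of order `k₀`
vanishes; so it is a combination of the differentials of the minors, and modulo the differentials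
of the basis functions it is a multiple of the differential of the minor of order `k₀`, which does
not vanish on the tangent space. -/
theorem isFunctionalBasis_regular {γ : Fin n → 𝔽} (hγ : ∃ i j, γ i ≠ γ j) {k₀ : Fin (n / 2)}
    (hne : γ (row k₀) ≠ γ (Fin.rev (row k₀)))
    (hlt : ∀ k : Fin (n / 2), k < k₀ → γ (row k) = γ (Fin.rev (row k)))
    {V : Set 𝔽} (hV : IsOpen V) {P : Fin (n / 2) → 𝔽 → 𝔽}
    (hP : ∀ k : Fin (n / 2), k₀ < k → IsPowerBranch (alpha γ k₀ k) V (P k)) :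
    IsFunctionalBasis hγ (regularDomain 𝔽 n ∩ {x | minor k₀ x ∈ V})
      (fun k : {k : Fin (n / 2) // k ≠ k₀} => regFun k₀ P k) := by
  set U := regularDomain 𝔽 n ∩ {x | minor k₀ x ∈ V} with hUdef
  have hU : IsOpen U :=
    isOpen_regularDomain.inter (hV.preimage (contDiff_minor 0 k₀).continuous)
  have hgt : ∀ k : {k : Fin (n / 2) // k ≠ k₀}, ¬ k.1 < k₀ → k₀ < k.1 := fun k hk =>
    lt_of_le_of_ne (not_lt.mp hk) k.2.symm
  have hsmooth : ∀ k : {k : Fin (n / 2) // k ≠ k₀}, ContDiffOn 𝔽 ∞ (regFun k₀ P k) U := by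
    intro k
    by_cases hk : k.1 < k₀
    · have : regFun k₀ P k = minor k.1 := funext fun x => if_pos hk
      rw [this]
      exact (contDiff_minor ∞ k.1).contDiffOn
    · have : regFun k₀ P k = fun x => P k (minor k₀ x) * minor k.1 x := funext fun x => if_neg hk
      rw [this]
      exact (((hP k (hgt k hk)).contDiffOn hV).comp (contDiff_minor ∞ k₀).contDiffOn
        fun x hx => hx.2).mul (contDiff_minor ∞ k.1).contDiffOn
  have hinv : ∀ k : {k : Fin (n / 2) // k ≠ k₀}, IsInvariantOn hγ U (regFun k₀ P k) := by
    intro k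
    by_cases hk : k.1 < k₀
    · have : regFun k₀ P k = minor k.1 := funext fun x => if_pos hk
      rw [this]
      exact isInvariantOn_minor hγ (weight_eq_zero hlt hk) U
    · have : regFun k₀ P k = fun x => P k (minor k₀ x) * minor k.1 x := funext fun x => if_neg hk
      rw [this]
      intro x B hB hB0 hBU
      have h1 := (hP k (hgt k hk)).apply_exp_mul (z := minor k₀ x) hV
        (alpha_mul_weight_add hne hlt k.1) ((continuous_eps γ).comp hB)
        (by rw [Function.comp_apply, hB0]; rfl)
        (fun t => by
          have h2 := (hBU t).2
          rw [Set.mem_ofPred_eq, minor_coad] at h2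
          exact h2)
      simp only [Function.comp_apply] at h1
      simp only [minor_coad]
      rw [← h1]
      ring
  have hfd : ∀ x ∈ U, ∃ a b : {k : Fin (n / 2) // k ≠ k₀} → 𝔽, (∀ k, a k ≠ 0) ∧
      ∀ (k : {k : Fin (n / 2) // k ≠ k₀}) (y : Idx n → 𝔽), fderiv 𝔽 (regFun k₀ P k) x y
        = a k * fderiv 𝔽 (minor k.1) x y + b k * fderiv 𝔽 (minor k₀) x y := by
    intro x hx
    have h : ∀ k : {k : Fin (n / 2) // k ≠ k₀}, ∃ a b : 𝔽, a ≠ 0 ∧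
      ∀ y, fderiv 𝔽 (regFun k₀ P k) x y
        = a * fderiv 𝔽 (minor k.1) x y + b * fderiv 𝔽 (minor k₀) x y := by
      intro k
      by_cases hk : k.1 < k₀
      · have : regFun k₀ P k = minor k.1 := funext fun x => if_pos hk
        rw [this]
        exact ⟨1, 0, one_ne_zero, fun y => by ring⟩
      · have : regFun k₀ P k = fun x => P k (minor k₀ x) * minor k.1 x :=
          funext fun x => if_neg hk
        rw [this]
        obtain ⟨-, hP0, hPd⟩ := hP k (hgt k hk) _ hx.2
        refine ⟨P k (minor k₀ x),
          minor k.1 x * (alpha γ k₀ k.1 * P k.1 (minor k₀ x) / minor k₀ x), hP0, fun y => ?_⟩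
        have h1 := (hPd.comp_hasFDerivAt x (differentiableAt_minor k₀ x).hasFDerivAt).mul
          (differentiableAt_minor k.1 x).hasFDerivAt
        have h2 : HasFDerivAt (fun x => P k (minor k₀ x) * minor k.1 x) _ x := h1
        rw [h2.fderiv]
        simp [mul_assoc]
    choose a b ha hab using h
    exact ⟨a, b, ha, hab⟩
  refine isFunctionalBasis_of_span hγ hU hsmooth hinv (fun x hx => ?_) (fun x hx φ hφ => ?_)
  · obtain ⟨a, b, ha, hab⟩ := hfd x hx
    rw [linearIndependent_clm_iff]
    intro c hc
    -- the relation, rewritten in terms of the differentials of all the minors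
    let c' : Fin (n / 2) → 𝔽 := fun k =>
      if h : k ≠ k₀ then c ⟨k, h⟩ * a ⟨k, h⟩ else ∑ l, c l * b l
    have h1 : ∀ y, ∑ k, c' k * fderiv 𝔽 (minor k) x y = 0 := by
      intro y
      rw [← hc y, Fintype.sum_eq_add_sum_subtype_ne _ k₀]
      have h2 : c' k₀ = ∑ l, c l * b l := dif_neg (by simp)
      have h3 : ∀ l : {k : Fin (n / 2) // k ≠ k₀}, c' l.1 = c l * a l := fun l => dif_pos l.2
      rw [h2, Finset.sum_mul, ← Finset.sum_add_distrib]
      refine Finset.sum_congr rfl fun l _ => ?_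
      rw [h3, hab]
      ring
    intro l
    have h2 := eq_zero_of_sum_fderiv_minor hx.1 h1 l.1
    have h3 : c' l.1 = c l * a l := dif_pos l.2
    rw [h3] at h2
    exact (mul_eq_zero.mp h2).resolve_right (ha l)
  · obtain ⟨a, b, ha, hab⟩ := hfd x hx
    have hw : weight γ k₀ * minor k₀ x ≠ 0 := by
      rw [weight_self hlt]
      exact mul_ne_zero (sub_ne_zero.mpr hne.symm) (hx.1 k₀)
    -- The tangent vector given by the coefficients of the differential of `minor k₀` is paired with
    -- `φ`; by antisymmetry this is, up to sign, the value of that differential at the tangent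
    -- vector given by `φ`, which is `φ(∂/∂x₀)` times the nonzero number
    -- `weight γ k₀ * minor k₀ x`.
    have h0 : φ (Pi.single none 1) = 0 := by
      have h1 := hφ fun a => fderiv 𝔽 (minor k₀) x (Pi.single a 1)
      rw [clm_apply_eq_sum φ, sum_mul_tangent_antisymm γ (fun a => φ (Pi.single a 1)),
        ← clm_apply_eq_sum, fderiv_minor_tangent hγ, neg_eq_zero, mul_assoc] at h1
      exact (mul_eq_zero.mp h1).resolve_right hw
    obtain ⟨c, hc⟩ := exists_eq_sum_fderiv_minor hγ hx.1 h0 fun q _ => hφ q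
    have hφy : ∀ y, φ y = ∑ k, c k * fderiv 𝔽 (minor k) x y := fun y => by
      rw [hc]
      simp
    have hφ' : ∀ y, φ y = (c k₀ - ∑ l : {k : Fin (n / 2) // k ≠ k₀}, c l.1 / a l * b l)
        * fderiv 𝔽 (minor k₀) x y
        + ∑ l : {k : Fin (n / 2) // k ≠ k₀}, c l.1 / a l * fderiv 𝔽 (regFun k₀ P l) x y := by
      intro y
      rw [hφy, Fintype.sum_eq_add_sum_subtype_ne _ k₀, sub_mul, sub_add_eq_add_sub, add_sub_assoc,
        Finset.sum_mul, ← Finset.sum_sub_distrib]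
      congr 1
      refine Finset.sum_congr rfl fun l _ => ?_
      rw [hab]
      have := ha l
      field_simp
      ring
    have hd : ∀ l : {k : Fin (n / 2) // k ≠ k₀}, ∀ q,
        fderiv 𝔽 (regFun k₀ P l) x (tangent γ q x) = 0 := fun l q =>
      fderiv_tangent_of_invariant hγ hU (hinv l) hx
        (((hsmooth l).contDiffAt (hU.mem_nhds hx)).differentiableAt (by simp)) q
    -- the coefficient of the differential of `minor k₀` is found from the direction of `f`
    have hlam : c k₀ - ∑ l : {k : Fin (n / 2) // k ≠ k₀}, c l.1 / a l * b l = 0 := by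
      have h1 := hφ (Pi.single none 1)
      rw [hφ'] at h1
      simp only [hd, mul_zero, Finset.sum_const_zero, add_zero] at h1
      rw [fderiv_minor_tangent hγ, Pi.single_eq_same, one_mul] at h1
      exact (mul_eq_zero.mp h1).resolve_right hw
    refine ⟨fun l => c l.1 / a l, ContinuousLinearMap.ext fun y => ?_⟩
    rw [hφ', hlam]
    simp

/-! ### Symmetrization of monomials -/

theorem ofFn_comp_rev {α : Type*} {m : ℕ} (f : Fin m → α) :
    (List.ofFn fun i => f (Fin.rev i)) = (List.ofFn f).reverse := by
  refine List.ext_getElem (by simp) fun i h1 h2 => ?_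
  simp only [List.getElem_ofFn, List.getElem_reverse, List.length_ofFn]
  congr 1
  ext
  simp [Fin.val_rev]
  omega

/-- A product in which all the factors but `x` and `y` commute with everything depends only on the
order of `x` and `y`. -/
theorem prod_append_cons_append_cons {A : Type*} [Monoid A] {x y : A} {l₁ l₂ l₃ : List A}
    (hx : ∀ r ∈ l₁ ++ l₂ ++ l₃, Commute r x) (hy : ∀ r ∈ l₁ ++ l₂ ++ l₃, Commute r y) :
    (l₁ ++ x :: (l₂ ++ y :: l₃)).prod = x * y * (l₁ ++ l₂ ++ l₃).prod := by
  have h1 : l₁.prod * x = x * l₁.prod :=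
    Commute.list_prod_left _ _ fun r hr => hx r (by simp [hr])
  have h2 : l₁.prod * y = y * l₁.prod :=
    Commute.list_prod_left _ _ fun r hr => hy r (by simp [hr])
  have h3 : l₂.prod * y = y * l₂.prod :=
    Commute.list_prod_left _ _ fun r hr => hy r (by simp [hr])
  simp only [List.prod_append, List.prod_cons]
  calc l₁.prod * (x * (l₂.prod * (y * l₃.prod)))
      = l₁.prod * x * (l₂.prod * y) * l₃.prod := by simp only [mul_assoc]
    _ = x * (l₁.prod * y) * l₂.prod * l₃.prod := by rw [h1, h3]; simp only [mul_assoc]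
    _ = x * y * (l₁.prod * l₂.prod * l₃.prod) := by rw [h2]; simp only [mul_assoc]

/-- The sum of a product and of the reversed product, if all the factors but `x` and `y`
commute with everything. -/
theorem prod_add_prod_reverse {A : Type*} [Semiring A] {x y : A} {R l : List A}
    (hl : l.Perm (x :: y :: R)) (hx : ∀ r ∈ R, Commute r x) (hy : ∀ r ∈ R, Commute r y)
    (hR : R.Pairwise Commute) : l.prod + l.reverse.prod = (x * y + y * x) * R.prod := by
  have key : ∀ u v : A, ∀ l₁ l₂ l₃ : List A, (l₁ ++ l₂ ++ l₃).Perm R →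
      (∀ r ∈ R, Commute r u) → (∀ r ∈ R, Commute r v) →
      (l₁ ++ u :: (l₂ ++ v :: l₃)).prod + (l₁ ++ u :: (l₂ ++ v :: l₃)).reverse.prod
        = (u * v + v * u) * R.prod := by
    intro u v l₁ l₂ l₃ hp hu hv
    have hp' : (l₃.reverse ++ l₂.reverse ++ l₁.reverse).Perm R := by
      refine List.Perm.trans ?_ hp
      have : l₃.reverse ++ l₂.reverse ++ l₁.reverse = (l₁ ++ l₂ ++ l₃).reverse := by simp
      rw [this]
      exact List.reverse_perm _
    have h1 := prod_append_cons_append_cons (x := u) (y := v) (l₁ := l₁) (l₂ := l₂) (l₃ := l₃)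
      (fun r hr => hu r (hp.mem_iff.mp hr)) (fun r hr => hv r (hp.mem_iff.mp hr))
    have h2 := prod_append_cons_append_cons (x := v) (y := u) (l₁ := l₃.reverse)
      (l₂ := l₂.reverse) (l₃ := l₁.reverse)
      (fun r hr => hv r (hp'.mem_iff.mp hr)) (fun r hr => hu r (hp'.mem_iff.mp hr))
    have h3 : (l₁ ++ u :: (l₂ ++ v :: l₃)).reverse
        = l₃.reverse ++ v :: (l₂.reverse ++ u :: l₁.reverse) := by simp
    have h4 : (l₁ ++ l₂ ++ l₃).prod = R.prod := (hp.symm.prod_eq' hR).symm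
    have h5 : (l₃.reverse ++ l₂.reverse ++ l₁.reverse).prod = R.prod :=
      (hp'.symm.prod_eq' hR).symm
    rw [h1, h3, h2, h4, h5, add_mul]
  obtain ⟨l₁, l', rfl⟩ := List.append_of_mem (hl.mem_iff.mpr (List.mem_cons_self))
  have h1 : (l₁ ++ l').Perm (y :: R) :=
    (List.perm_cons x).mp (List.perm_middle.symm.trans hl)
  rcases List.mem_append.mp (h1.mem_iff.mpr List.mem_cons_self) with h | h
  · obtain ⟨a, b, rfl⟩ := List.append_of_mem h
    have h2 : (a ++ b ++ l').Perm R := by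
      refine (List.perm_cons y).mp (List.Perm.trans ?_ h1)
      simpa using (List.perm_middle (a := y) (l₁ := a) (l₂ := b ++ l')).symm
    have h3 := key y x a b l' h2 hy hx
    rw [add_comm (x * y)]
    simpa using h3
  · obtain ⟨b, c, rfl⟩ := List.append_of_mem h
    have h2 : (l₁ ++ b ++ c).Perm R := by
      refine (List.perm_cons y).mp (List.Perm.trans ?_ h1)
      simpa using (List.perm_middle (a := y) (l₁ := l₁ ++ b) (l₂ := c)).symm
    exact key x y l₁ b c h2 hx hy

theorem ofFn_get_comp_perm {α β : Type*} (l : List α) (u : α → β)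
    (σ : Equiv.Perm (Fin l.length)) : (List.ofFn fun i => u (l.get (σ i))).Perm (l.map u) := by
  have h1 := Equiv.Perm.ofFn_comp_perm σ fun i => u (l.get i)
  have h2 : (List.ofFn fun i => u (l.get i)) = l.map u := by
    have := congrArg (List.map u) (List.ofFn_get l)
    rwa [List.map_ofFn] at this
  rw [h2] at h1
  exact h1

theorem avgProd_of_commute (γ : Fin n → 𝔽) {l : List (Idx n)}
    (hl : (l.map (ugen γ)).Pairwise Commute) : avgProd γ l = (l.map (ugen γ)).prod := by
  have h : ∀ σ : Equiv.Perm (Fin l.length),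
      (List.ofFn fun i => ugen γ (l.get (σ i))).prod = (l.map (ugen γ)).prod := fun σ =>
    ((ofFn_get_comp_perm l (ugen γ) σ).symm.prod_eq' hl).symm
  rw [avgProd]
  simp only [h, Finset.sum_const, Finset.card_univ, Fintype.card_perm, Fintype.card_fin]
  rw [← Nat.cast_smul_eq_nsmul 𝔽, smul_smul, inv_mul_cancel₀
    (Nat.cast_ne_zero.mpr (Nat.factorial_ne_zero _)), one_smul]

/-- If only the generators with the labels `a` and `b` may fail to commute, the average over all
orders is the average of the two orders of this pair: an order and its reversal contain the pair in
opposite orders. -/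
theorem avgProd_of_perm (γ : Fin n → 𝔽) {l R : List (Idx n)} {a b : Idx n}
    (hl : l.Perm (a :: b :: R)) (ha : ∀ r ∈ R, Commute (ugen γ r) (ugen γ a))
    (hb : ∀ r ∈ R, Commute (ugen γ r) (ugen γ b)) (hR : (R.map (ugen γ)).Pairwise Commute) :
    avgProd γ l = (2⁻¹ : 𝔽) •
      ((ugen γ a * ugen γ b + ugen γ b * ugen γ a) * (R.map (ugen γ)).prod) := by
  set w : Equiv.Perm (Fin l.length) → UEA γ := fun σ =>
    (List.ofFn fun i => ugen γ (l.get (σ i))).prod with hw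
  set Z : UEA γ := (ugen γ a * ugen γ b + ugen γ b * ugen γ a) * (R.map (ugen γ)).prod with hZ
  have h1 : ∀ σ, w σ + w (σ * Fin.revPerm) = Z := by
    intro σ
    have h2 : w (σ * Fin.revPerm) = (List.ofFn fun i => ugen γ (l.get (σ i))).reverse.prod := by
      rw [← ofFn_comp_rev]
      rfl
    rw [h2]
    refine prod_add_prod_reverse ((ofFn_get_comp_perm l (ugen γ) σ).trans
      (by simpa using hl.map (ugen γ))) ?_ ?_ hR
    · intro r hr
      obtain ⟨r, hr', rfl⟩ := List.mem_map.mp hr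
      exact ha r hr'
    · intro r hr
      obtain ⟨r, hr', rfl⟩ := List.mem_map.mp hr
      exact hb r hr'
  have h2 : ∑ σ, w (σ * Fin.revPerm) = ∑ σ, w σ :=
    Equiv.sum_comp (Equiv.mulRight (Fin.revPerm : Equiv.Perm (Fin l.length))) w
  have h3 : (2 : 𝔽) • ∑ σ, w σ = (l.length.factorial : 𝔽) • Z := by
    rw [two_smul]
    nth_rw 2 [← h2]
    rw [← Finset.sum_add_distrib]
    simp only [h1, Finset.sum_const, Finset.card_univ, Fintype.card_perm, Fintype.card_fin]
    rw [← Nat.cast_smul_eq_nsmul 𝔽]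
  have h4 : ∑ σ, w σ = (2⁻¹ : 𝔽) • (l.length.factorial : 𝔽) • Z := by
    rw [← h3, smul_smul, inv_mul_cancel₀ two_ne_zero, one_smul]
  change (l.length.factorial : 𝔽)⁻¹ • ∑ σ, w σ = _
  rw [h4, smul_comm, inv_smul_smul₀ (Nat.cast_ne_zero.mpr (Nat.factorial_ne_zero _))]

/-- The list `l'` is the order of the factors chosen in the definition of `symmetrize`. -/
theorem symmetrize_list_prod (γ : Fin n → 𝔽) (l : List (Idx n)) :
    ∃ l' : List (Idx n), l'.Perm l ∧
      symmetrize γ (l.map (MvPolynomial.X (R := 𝔽))).prod = avgProd γ l' := by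
  classical
  have h1 : (l.map (MvPolynomial.X (R := 𝔽))).prod
      = MvPolynomial.monomial (Multiset.toFinsupp (l : Multiset (Idx n))) 1 := by
    induction l with
    | nil => simp
    | cons a l ih =>
      rw [List.map_cons, List.prod_cons, ih, MvPolynomial.X, MvPolynomial.monomial_mul, one_mul,
        ← Multiset.cons_coe, ← Multiset.singleton_add, map_add, Multiset.toFinsupp_singleton]
  refine ⟨(l : Multiset (Idx n)).toList, ?_, ?_⟩
  · rw [← Multiset.coe_eq_coe, Multiset.coe_toList]
  · have h2 := (MvPolynomial.basisMonomials (Idx n) 𝔽).constr_basis 𝔽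
      (fun s => avgProd γ (Finsupp.toMultiset s).toList)
      (Multiset.toFinsupp (l : Multiset (Idx n)))
    rw [MvPolynomial.coe_basisMonomials, Multiset.toFinsupp_toMultiset] at h2
    rw [h1]
    exact h2

theorem symmetrize_of_commute (γ : Fin n → 𝔽) {l : List (Idx n)}
    (hl : ∀ a ∈ l, ∀ b ∈ l, Commute (ugen γ a) (ugen γ b)) :
    symmetrize γ (l.map (MvPolynomial.X (R := 𝔽))).prod = (l.map (ugen γ)).prod := by
  obtain ⟨l', hp, h⟩ := symmetrize_list_prod γ l
  have hpw : ∀ l : List (Idx n), (∀ a ∈ l, ∀ b ∈ l, Commute (ugen γ a) (ugen γ b)) →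
      (l.map (ugen γ)).Pairwise Commute := fun l hl =>
    List.pairwise_map.mpr (List.pairwise_of_forall_mem_list fun a ha b hb => hl a ha b hb)
  have hl' := hpw l' fun a ha b hb => hl a (hp.mem_iff.mp ha) b (hp.mem_iff.mp hb)
  rw [h, avgProd_of_commute γ hl', (hp.map (ugen γ)).prod_eq' hl']

theorem symmetrize_of_perm (γ : Fin n → 𝔽) {l R : List (Idx n)} {a b : Idx n}
    (hl : l.Perm (a :: b :: R)) (ha : ∀ r ∈ R, Commute (ugen γ r) (ugen γ a))
    (hb : ∀ r ∈ R, Commute (ugen γ r) (ugen γ b)) (hR : (R.map (ugen γ)).Pairwise Commute) :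
    symmetrize γ (l.map (MvPolynomial.X (R := 𝔽))).prod = (2⁻¹ : 𝔽) •
      ((ugen γ a * ugen γ b + ugen γ b * ugen γ a) * (R.map (ugen γ)).prod) := by
  obtain ⟨l', hp, h⟩ := symmetrize_list_prod γ l
  rw [h, avgProd_of_perm γ (hp.trans hl) ha hb hR]

/-! ### Commutation relations of the generators -/

theorem gen_lie_eq_zero (γ : Fin n → 𝔽) {p q : {p : Fin n × Fin n // p.1 < p.2}}
    (h1 : p.1.2 ≠ q.1.1) (h2 : q.1.2 ≠ p.1.1) : ⁅gen γ (some p), gen γ (some q)⁆ = 0 := by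
  apply Subtype.ext
  change ⁅(Matrix.single p.1.1 p.1.2 1 : Matrix (Fin n) (Fin n) 𝔽),
    Matrix.single q.1.1 q.1.2 1⁆ = 0
  rw [Ring.lie_def, Matrix.single_mul_single_of_ne _ _ _ _ h1,
    Matrix.single_mul_single_of_ne _ _ _ _ h2, sub_zero]

theorem gen_lie_eq (γ : Fin n → 𝔽) {i j k : Fin n} (hij : i < j) (hjk : j < k) :
    ⁅gen γ (some ⟨(i, j), hij⟩), gen γ (some ⟨(j, k), hjk⟩)⁆
      = gen γ (some ⟨(i, k), hij.trans hjk⟩) := by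
  apply Subtype.ext
  change ⁅(Matrix.single i j 1 : Matrix (Fin n) (Fin n) 𝔽), Matrix.single j k 1⁆
    = Matrix.single i k 1
  rw [Ring.lie_def, Matrix.single_mul_single_same,
    Matrix.single_mul_single_of_ne _ _ _ _ (hij.trans hjk).ne', sub_zero, one_mul]

theorem ugen_commute (γ : Fin n → 𝔽) {p q : {p : Fin n × Fin n // p.1 < p.2}}
    (h1 : p.1.2 ≠ q.1.1) (h2 : q.1.2 ≠ p.1.1) :
    Commute (ugen γ (some p)) (ugen γ (some q)) := by
  have h := LieHom.map_lie (UniversalEnvelopingAlgebra.ι 𝔽) (gen γ (some p)) (gen γ (some q))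
  rw [gen_lie_eq_zero γ h1 h2, map_zero, Ring.lie_def] at h
  exact (sub_eq_zero.mp h.symm)

theorem ugen_mul_sub_mul (γ : Fin n → 𝔽) {i j k : Fin n} (hij : i < j) (hjk : j < k) :
    ugen γ (some ⟨(i, j), hij⟩) * ugen γ (some ⟨(j, k), hjk⟩)
      - ugen γ (some ⟨(j, k), hjk⟩) * ugen γ (some ⟨(i, j), hij⟩)
      = ugen γ (some ⟨(i, k), hij.trans hjk⟩) := by
  have h := LieHom.map_lie (UniversalEnvelopingAlgebra.ι 𝔽) (gen γ (some ⟨(i, j), hij⟩))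
    (gen γ (some ⟨(j, k), hjk⟩))
  rw [gen_lie_eq, Ring.lie_def] at h
  exact h.symm

/-! ### Symmetrization of the determinants -/

/-- The label of the entry of the corner submatrix with the indices `a` and `b`. -/
def cornerLabel (k : Fin (n / 2)) (a b : Fin (k + 1)) : Idx n :=
  some ⟨(firstRows k a, lastCols k b), firstRows_lt_lastCols k a b⟩

theorem corner_upperMat {A : Type*} [Zero A] (v : Idx n → A) (k : Fin (n / 2))
    (a b : Fin (k + 1)) : corner (upperMat v) k a b = v (cornerLabel k a b) :=
  upperMat_apply_of_lt v (firstRows_lt_lastCols k a b)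

theorem cornerLabel_commute (γ : Fin n → 𝔽) (k : Fin (n / 2)) (a b c d : Fin (k + 1)) :
    Commute (ugen γ (cornerLabel k a b)) (ugen γ (cornerLabel k c d)) :=
  ugen_commute γ (firstRows_lt_lastCols k c b).ne' (firstRows_lt_lastCols k a d).ne'

theorem prod_X_eq_list_prod {m : ℕ} (f : Fin m → Idx n) :
    ∏ b, MvPolynomial.X (R := 𝔽) (f b) = ((List.ofFn f).map MvPolynomial.X).prod := by
  rw [List.map_ofFn, List.prod_ofFn]
  rfl

theorem symmetrize_det_eq_sum (γ : Fin n → 𝔽) {m : ℕ}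
    (M : Matrix (Fin m) (Fin m) (MvPolynomial (Idx n) 𝔽)) :
    symmetrize γ M.det = ∑ σ : Equiv.Perm (Fin m), ((Equiv.Perm.sign σ : ℤˣ) : ℤ) •
      symmetrize γ (∏ b, M (σ b) b) := by
  rw [Matrix.det_apply, map_sum]
  refine Finset.sum_congr rfl fun σ _ => ?_
  rw [Units.smul_def, map_zsmul]

theorem symmetrize_corner_term (γ : Fin n → 𝔽) (k : Fin (n / 2))
    (σ : Equiv.Perm (Fin (k + 1))) :
    symmetrize γ (∏ b, corner (upperMat (MvPolynomial.X (R := 𝔽))) k (σ b) b)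
        = (List.ofFn fun b => corner (upperMat (ugen γ)) k (σ b) b).prod ∧
      symmetrize γ (∏ b, corner (upperMat (MvPolynomial.X (R := 𝔽))) k (σ b) b)
        = (List.ofFn fun b => corner (upperMat (ugen γ)) k (σ b) b).reverse.prod := by
  simp only [corner_upperMat]
  have hc : ∀ a ∈ List.ofFn (fun b => cornerLabel k (σ b) b),
      ∀ b ∈ List.ofFn (fun b => cornerLabel k (σ b) b), Commute (ugen γ a) (ugen γ b) := by
    intro a ha b hb
    obtain ⟨a, rfl⟩ := (List.mem_ofFn' _ _).mp ha
    obtain ⟨b, rfl⟩ := (List.mem_ofFn' _ _).mp hb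
    exact cornerLabel_commute γ k _ _ _ _
  have h1 : (List.ofFn fun b => ugen γ (cornerLabel k (σ b) b))
      = (List.ofFn fun b => cornerLabel k (σ b) b).map (ugen γ) := by
    rw [List.map_ofFn]
    rfl
  rw [prod_X_eq_list_prod (fun b => cornerLabel k (σ b) b), symmetrize_of_commute γ hc, h1]
  refine ⟨rfl, (List.reverse_perm _).symm.prod_eq' ?_⟩
  exact List.pairwise_map.mpr (List.pairwise_of_forall_mem_list fun a ha b hb => hc a ha b hb)

theorem symmetrize_det_corner (γ : Fin n → 𝔽) (k : Fin (n / 2)) (o : FactorOrder) :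
    symmetrize γ (corner (upperMat (MvPolynomial.X (R := 𝔽))) k).det
      = udet o (corner (upperMat (ugen γ)) k) := by
  have h1 : symmetrize γ (corner (upperMat (MvPolynomial.X (R := 𝔽))) k).det
      = detBefore (corner (upperMat (ugen γ)) k) := by
    rw [symmetrize_det_eq_sum, detBefore]
    simp only [(symmetrize_corner_term γ k _).1]
  have h2 : symmetrize γ (corner (upperMat (MvPolynomial.X (R := 𝔽))) k).det
      = detAfter (corner (upperMat (ugen γ)) k) := by
    rw [symmetrize_det_eq_sum, detAfter]
    simp only [(symmetrize_corner_term γ k _).2]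
  cases o
  · exact h1
  · exact h2
  · change _ = (2⁻¹ : 𝔽) • (detBefore _ + detAfter _)
    rw [← h1, ← h2, ← two_smul 𝔽, smul_smul, inv_mul_cancel₀ two_ne_zero, one_smul]

/-- The matrix with the rows `(C e_d, C)` and `(0, e_dᵀ)`. Its expansion consists of the
terms in which the product of an entry of the first column and of the `d`-th entry of the last row
of `bordered` has been replaced by their commutator. -/
def bracketMat {A : Type*} [Zero A] [One A] {m : ℕ} (C : Matrix (Fin m) (Fin m) A) (d : Fin m) :
    Matrix (Fin (m + 1)) (Fin (m + 1)) A :=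
  Matrix.of fun a b => Fin.lastCases (motive := fun _ => A)
    (Fin.cases (motive := fun _ => A) 0 (fun b' => if b' = d then 1 else 0) b)
    (fun a' => Fin.cases (motive := fun _ => A) (C a' d) (fun b' => C a' b') b) a

theorem det_bracketMat {A : Type*} [CommRing A] {m : ℕ} (C : Matrix (Fin m) (Fin m) A)
    (d : Fin m) : (bracketMat C d).det = (-1) ^ (m + 1) * C.det := by
  -- the column with the index `d` of the right block is subtracted from the first column
  let c : Fin (m + 1) → A := Fin.cons 1 fun b => if b = d then -1 else 0
  have h1 := Matrix.det_updateCol_sum (bracketMat C d) 0 c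
  have hc0 : c 0 = 1 := rfl
  rw [hc0, one_smul] at h1
  rw [← h1, Matrix.det_succ_column_zero, Finset.sum_eq_single (Fin.last _)]
  · have h2 : ((bracketMat C d).updateCol 0 fun k_1 => ∑ j, c j • bracketMat C d k_1 j)
        (Fin.last _) 0 = -1 := by
      rw [Matrix.updateCol_self, Fin.sum_univ_succ]
      simp [c, bracketMat]
    have h3 : ((bracketMat C d).updateCol 0 fun k_1 => ∑ j, c j • bracketMat C d k_1 j).submatrix
        (Fin.last _).succAbove Fin.succ = C := by
      ext a b
      rw [Matrix.submatrix_apply, Matrix.updateCol_ne (Fin.succ_ne_zero b)]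
      simp [bracketMat]
    rw [h2, h3, Fin.val_last]
    ring
  · intro a _ ha
    obtain ⟨a, rfl⟩ := Fin.exists_castSucc_eq.mpr ha
    have h2 : ((bracketMat C d).updateCol 0 fun k_1 => ∑ j, c j • bracketMat C d k_1 j)
        a.castSucc 0 = 0 := by
      rw [Matrix.updateCol_self, Fin.sum_univ_succ]
      simp [c, bracketMat]
    rw [h2, mul_zero, zero_mul]
  · simp

section Bordered

variable {k : Fin (n / 2)} {i : Fin n}

theorem firstRows_lt_middle (hi : i ∈ middle k) (a : Fin (k + 1)) : firstRows k a < i := by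
  simp only [middle, Finset.mem_filter, Finset.mem_univ, true_and] at hi
  simp only [firstRows, Fin.lt_def]
  omega

theorem middle_lt_lastCols (hi : i ∈ middle k) (b : Fin (k + 1)) : i < lastCols k b := by
  simp only [middle, Finset.mem_filter, Finset.mem_univ, true_and] at hi
  simp only [lastCols, Fin.lt_def]
  omega

/-- The labels of the nonzero entries of the first column of `bordered`. -/
def colLabel (hi : i ∈ middle k) (a : Fin (k + 1)) : Idx n :=
  some ⟨(firstRows k a, i), firstRows_lt_middle hi a⟩

/-- The labels of the nonzero entries of the last row of `bordered`. -/
def rowLabel (hi : i ∈ middle k) (b : Fin (k + 1)) : Idx n :=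
  some ⟨(i, lastCols k b), middle_lt_lastCols hi b⟩

/-- The labels of the entries of `bordered` outside the first column. -/
def rightLabel (hi : i ∈ middle k) (a : Fin (k + 1 + 1)) (b : Fin (k + 1)) : Idx n :=
  Fin.lastCases (motive := fun _ => Idx n) (rowLabel hi b) (fun a' => cornerLabel k a' b) a

theorem rightLabel_last (hi : i ∈ middle k) (b : Fin (k + 1)) :
    rightLabel hi (Fin.last _) b = rowLabel hi b := by
  simp [rightLabel]

theorem rightLabel_castSucc (hi : i ∈ middle k) (a b : Fin (k + 1)) :
    rightLabel hi a.castSucc b = cornerLabel k a b := by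
  simp [rightLabel]

theorem rightLabel_inj (hi : i ∈ middle k) {a a' : Fin (k + 1 + 1)} {b b' : Fin (k + 1)}
    (h : rightLabel hi a b = rightLabel hi a' b') : b = b' := by
  have h1 : ∀ (a : Fin (k + 1 + 1)) (b : Fin (k + 1)),
      (rightLabel hi a b).map (fun p => p.1.2) = some (lastCols k b) := by
    intro a b
    refine Fin.lastCases ?_ (fun a => ?_) a
    · rw [rightLabel_last]
      rfl
    · rw [rightLabel_castSucc]
      rfl
  have h2 := h1 a b
  rw [h, h1] at h2
  exact (lastCols_injective k (Option.some.inj h2)).symm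

theorem bordered_succ {A : Type*} [Zero A] (v : Idx n → A) (hi : i ∈ middle k)
    (a : Fin (k + 1 + 1)) (b : Fin (k + 1)) :
    bordered (upperMat v) k i a b.succ = v (rightLabel hi a b) := by
  refine Fin.lastCases ?_ (fun a => ?_) a
  · rw [rightLabel_last]
    simp only [bordered, Matrix.of_apply, Fin.lastCases_last, Fin.cases_succ]
    exact upperMat_apply_of_lt v (middle_lt_lastCols hi b)
  · rw [rightLabel_castSucc]
    simp only [bordered, Matrix.of_apply, Fin.lastCases_castSucc, Fin.cases_succ]
    exact upperMat_apply_of_lt v (firstRows_lt_lastCols k a b)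

theorem bordered_castSucc_zero {A : Type*} [Zero A] (v : Idx n → A) (hi : i ∈ middle k)
    (a : Fin (k + 1)) : bordered (upperMat v) k i a.castSucc 0 = v (colLabel hi a) := by
  simp only [bordered, Matrix.of_apply, Fin.lastCases_castSucc, Fin.cases_zero]
  exact upperMat_apply_of_lt v (firstRows_lt_middle hi a)

theorem bordered_last_zero {A : Type*} [Zero A] (M : Matrix (Fin n) (Fin n) A) :
    bordered M k i (Fin.last _) 0 = 0 := by
  simp [bordered]

/-- In each term of the expansion of the determinant of `bordered`, the product in the order of the
columns differs from the symmetrized product by half of the product in which the two noncommuting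
factors have been replaced by their commutator, and the product in the reverse order by the
negative of this. -/
theorem symmetrize_bordered_term (γ : Fin n → 𝔽) (hi : i ∈ middle k)
    (σ : Equiv.Perm (Fin (k + 1 + 1))) :
    (List.ofFn fun b => bordered (upperMat (ugen γ)) k i (σ b) b).prod
        = symmetrize γ (∏ b, bordered (upperMat (MvPolynomial.X (R := 𝔽))) k i (σ b) b)
          + (2⁻¹ : 𝔽) • ∑ d, symmetrize γ
            (∏ b, bracketMat (corner (upperMat (MvPolynomial.X (R := 𝔽))) k) d (σ b) b) ∧
      (List.ofFn fun b => bordered (upperMat (ugen γ)) k i (σ b) b).reverse.prod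
        = symmetrize γ (∏ b, bordered (upperMat (MvPolynomial.X (R := 𝔽))) k i (σ b) b)
          - (2⁻¹ : 𝔽) • ∑ d, symmetrize γ
            (∏ b, bracketMat (corner (upperMat (MvPolynomial.X (R := 𝔽))) k) d (σ b) b) := by
  rw [List.ofFn_succ, List.reverse_cons, List.prod_cons, List.prod_append, List.prod_singleton,
    Fin.prod_univ_succ]
  rcases Fin.eq_castSucc_or_eq_last (σ 0) with ⟨c, hc⟩ | hlast
  swap
  · have h1 : ∀ d, ∏ b, bracketMat (corner (upperMat (MvPolynomial.X (R := 𝔽))) k) d (σ b) b = 0 :=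
      fun d => Finset.prod_eq_zero (Finset.mem_univ 0) (by rw [hlast]; simp [bracketMat])
    simp [h1, hlast, bordered_last_zero]
  -- the column `d + 1` contains the factor from the last row
  obtain ⟨d, hd⟩ : ∃ d : Fin (k + 1), σ d.succ = Fin.last _ := by
    obtain ⟨e, he⟩ := σ.surjective (Fin.last _)
    rcases Fin.eq_zero_or_eq_succ e with rfl | ⟨d, rfl⟩
    · rw [he] at hc
      exact absurd hc (Fin.castSucc_lt_last c).ne'
    · exact ⟨d, he⟩
  have hcast : ∀ b : Fin (k + 1), b ≠ d → ∃ a : Fin (k + 1), σ b.succ = a.castSucc := by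
    intro b hb
    rcases Fin.eq_castSucc_or_eq_last (σ b.succ) with h | h
    · exact h
    · exact absurd (Fin.succ_injective _ (σ.injective (h.trans hd.symm))) hb
  let f : Fin (k + 1) → Idx n := fun b => rightLabel hi (σ b.succ) b
  have hfd : f d = rowLabel hi d := by
    simp only [f, hd, rightLabel_last]
  have hfinj : Function.Injective f := fun a b h => rightLabel_inj hi h
  classical
  let R := (List.ofFn f).erase (rowLabel hi d)
  have hmem : rowLabel hi d ∈ List.ofFn f := (List.mem_ofFn' _ _).mpr ⟨d, hfd⟩
  have hperm : (List.ofFn f).Perm (rowLabel hi d :: R) := List.perm_cons_erase hmem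
  have hR : ∀ r ∈ R, ∃ a b, r = cornerLabel k a b := by
    intro r hr
    obtain ⟨hne, hr⟩ := ((List.nodup_ofFn.mpr hfinj).mem_erase_iff).mp hr
    obtain ⟨b, rfl⟩ := (List.mem_ofFn' _ _).mp hr
    have hb : b ≠ d := by
      rintro rfl
      exact hne hfd
    obtain ⟨a, ha⟩ := hcast b hb
    exact ⟨a, b, by simp only [f, ha, rightLabel_castSucc]⟩
  have hRR : ∀ a ∈ R, ∀ b ∈ R, Commute (ugen γ a) (ugen γ b) := by
    intro r hr s hs
    obtain ⟨a, b, rfl⟩ := hR r hr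
    obtain ⟨a', b', rfl⟩ := hR s hs
    exact cornerLabel_commute γ k _ _ _ _
  have hRcorner : ∀ r ∈ R, ∀ a b, Commute (ugen γ r) (ugen γ (cornerLabel k a b)) := by
    intro r hr a' b'
    obtain ⟨a, b, rfl⟩ := hR r hr
    exact cornerLabel_commute γ k _ _ _ _
  have hRcol : ∀ r ∈ R, Commute (ugen γ r) (ugen γ (colLabel hi c)) := by
    intro r hr
    obtain ⟨a, b, rfl⟩ := hR r hr
    exact ugen_commute γ (firstRows_lt_lastCols k c b).ne' (firstRows_lt_middle hi a).ne'
  have hRrow : ∀ r ∈ R, Commute (ugen γ r) (ugen γ (rowLabel hi d)) := by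
    intro r hr
    obtain ⟨a, b, rfl⟩ := hR r hr
    exact ugen_commute γ (middle_lt_lastCols hi b).ne' (firstRows_lt_lastCols k a d).ne'
  have hRpw : (R.map (ugen γ)).Pairwise Commute :=
    List.pairwise_map.mpr (List.pairwise_of_forall_mem_list fun a ha b hb => hRR a ha b hb)
  have hrowpw : ((rowLabel hi d :: R).map (ugen γ)).Pairwise Commute := by
    rw [List.map_cons, List.pairwise_cons]
    refine ⟨fun s hs => ?_, hRpw⟩
    obtain ⟨r, hr, rfl⟩ := List.mem_map.mp hs
    exact (hRrow r hr).symm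
  set x := ugen γ (colLabel hi c) with hx
  set y := ugen γ (rowLabel hi d) with hy
  set ρ := (R.map (ugen γ)).prod with hρ
  have hlist : (List.ofFn fun b : Fin (k + 1) =>
      bordered (upperMat (ugen γ)) k i (σ b.succ) b.succ) = (List.ofFn f).map (ugen γ) := by
    rw [List.map_ofFn]
    congr 1
    funext b
    exact bordered_succ (ugen γ) hi _ _
  have hprod : (List.ofFn fun b : Fin (k + 1) =>
      bordered (upperMat (ugen γ)) k i (σ b.succ) b.succ).prod = y * ρ := by
    rw [hlist, ← (hperm.map (ugen γ)).symm.prod_eq' hrowpw, List.map_cons, List.prod_cons]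
  have hprod' : (List.ofFn fun b : Fin (k + 1) =>
      bordered (upperMat (ugen γ)) k i (σ b.succ) b.succ).reverse.prod = y * ρ := by
    rw [hlist, ← (((List.reverse_perm _).trans (hperm.map (ugen γ))).symm).prod_eq' hrowpw,
      List.map_cons, List.prod_cons]
  have hfirst : bordered (upperMat (ugen γ)) k i (σ 0) 0 = x := by
    rw [hc, bordered_castSucc_zero (ugen γ) hi]
  have hpoly : bordered (upperMat (MvPolynomial.X (R := 𝔽))) k i (σ 0) 0
      * ∏ b : Fin (k + 1), bordered (upperMat (MvPolynomial.X (R := 𝔽))) k i (σ b.succ) b.succ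
      = ((colLabel hi c :: List.ofFn f).map MvPolynomial.X).prod := by
    rw [hc, bordered_castSucc_zero _ hi, List.map_cons, List.prod_cons, ← prod_X_eq_list_prod]
    congr 1
    exact Finset.prod_congr rfl fun b _ => bordered_succ _ hi _ _
  have hsym := symmetrize_of_perm γ (hperm.cons (colLabel hi c)) hRcol hRrow hRpw
  have hbr0 : ∀ e, e ≠ d →
      ∏ b, bracketMat (corner (upperMat (MvPolynomial.X (R := 𝔽))) k) e (σ b) b = 0 := by
    intro e he
    refine Finset.prod_eq_zero (Finset.mem_univ d.succ) ?_
    rw [hd]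
    simp [bracketMat, he.symm]
  have hbr : ∏ b, bracketMat (corner (upperMat (MvPolynomial.X (R := 𝔽))) k) d (σ b) b
      = ((cornerLabel k c d :: R).map MvPolynomial.X).prod := by
    have h1 : ∏ b : Fin (k + 1), MvPolynomial.X (R := 𝔽) (f b)
        = MvPolynomial.X (rowLabel hi d) * (R.map MvPolynomial.X).prod := by
      rw [prod_X_eq_list_prod, (hperm.map _).prod_eq, List.map_cons, List.prod_cons]
    rw [← Finset.mul_prod_erase _ _ (Finset.mem_univ d), hfd] at h1
    have h2 := mul_left_cancel₀ (MvPolynomial.X_ne_zero _) h1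
    rw [Fin.prod_univ_succ, List.map_cons, List.prod_cons, ← h2, hc,
      ← Finset.mul_prod_erase _ _ (Finset.mem_univ d), hd]
    have h3 : bracketMat (corner (upperMat (MvPolynomial.X (R := 𝔽))) k) d c.castSucc 0
        = MvPolynomial.X (cornerLabel k c d) := by
      simp only [bracketMat, Matrix.of_apply, Fin.lastCases_castSucc, Fin.cases_zero]
      exact corner_upperMat _ k c d
    have h4 : bracketMat (corner (upperMat (MvPolynomial.X (R := 𝔽))) k) d (Fin.last _) d.succ
        = 1 := by
      simp [bracketMat]
    rw [h3, h4, one_mul]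
    congr 1
    refine Finset.prod_congr rfl fun b hb => ?_
    obtain ⟨a, ha⟩ := hcast b (Finset.ne_of_mem_erase hb)
    simp only [f, ha, rightLabel_castSucc, bracketMat, Matrix.of_apply, Fin.lastCases_castSucc,
      Fin.cases_succ]
    exact corner_upperMat _ k a b
  have hbrsym : symmetrize γ
      (∏ b, bracketMat (corner (upperMat (MvPolynomial.X (R := 𝔽))) k) d (σ b) b)
      = ugen γ (cornerLabel k c d) * ρ := by
    rw [hbr, symmetrize_of_commute γ, List.map_cons, List.prod_cons]
    intro a ha b hb
    rcases List.mem_cons.mp ha with rfl | ha <;> rcases List.mem_cons.mp hb with rfl | hb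
    · exact Commute.refl _
    · exact (hRcorner b hb _ _).symm
    · exact hRcorner a ha _ _
    · exact hRR a ha b hb
  have hlie : x * y - y * x = ugen γ (cornerLabel k c d) :=
    ugen_mul_sub_mul γ (firstRows_lt_middle hi c) (middle_lt_lastCols hi d)
  have hρx : ρ * x = x * ρ := by
    refine Commute.list_prod_left _ _ fun s hs => ?_
    obtain ⟨r, hr, rfl⟩ := List.mem_map.mp hs
    exact hRcol r hr
  rw [Finset.sum_eq_single d (fun e _ he => by rw [hbr0 e he, map_zero]) (by simp), hbrsym, hpoly,
    hsym, hfirst, hprod, hprod', ← hlie, mul_assoc y, hρx]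
  have h2 : ∀ u : UEA γ, u = (2⁻¹ : 𝔽) • (u + u) := fun u => by
    rw [← two_smul 𝔽, smul_smul, inv_mul_cancel₀ two_ne_zero, one_smul]
  constructor
  · rw [← smul_add, h2 (x * (y * ρ))]
    congr 1
    noncomm_ring
  · rw [← smul_sub, h2 (y * (x * ρ))]
    congr 1
    noncomm_ring

/-- The sign in the contribution of the commutators for a given order of the factors. -/
def orderSign : FactorOrder → 𝔽
  | .before => 1
  | .after => -1
  | .averaged => 0

/-- The polynomial whose symmetrization is the determinant of `bordered` for a given order of the
factors. The correction is half of the sum of the `k + 1` determinants of `bracketMat`, each of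
which is the corner minor up to sign. -/
noncomputable def borderedPoly (o : FactorOrder) (k : Fin (n / 2)) (i : Fin n) :
    MvPolynomial (Idx n) 𝔽 :=
  (bordered (upperMat MvPolynomial.X) k i).det
    + (orderSign o * (2⁻¹ * ((k : 𝔽) + 1) * (-1) ^ ((k : ℕ) + 1 + 1)) : 𝔽) •
      (corner (upperMat MvPolynomial.X) k).det

theorem symmetrize_borderedPoly (γ : Fin n → 𝔽) (hi : i ∈ middle k) (o : FactorOrder) :
    symmetrize γ (borderedPoly o k i) = udet o (bordered (upperMat (ugen γ)) k i) := by
  set D := symmetrize γ (bordered (upperMat (MvPolynomial.X (R := 𝔽))) k i).det with hD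
  set T := symmetrize γ (corner (upperMat (MvPolynomial.X (R := 𝔽))) k).det with hT
  set s : 𝔽 := 2⁻¹ * ((k : 𝔽) + 1) * (-1) ^ ((k : ℕ) + 1 + 1) with hs
  have hsum : (2⁻¹ : 𝔽) • ∑ σ : Equiv.Perm (Fin (k + 1 + 1)), ((Equiv.Perm.sign σ : ℤˣ) : ℤ) •
      ∑ d, symmetrize γ (∏ b, bracketMat (corner (upperMat (MvPolynomial.X (R := 𝔽))) k) d (σ b) b)
      = s • T := by
    simp only [Finset.smul_sum]
    rw [Finset.sum_comm]
    simp only [← Finset.smul_sum, ← symmetrize_det_eq_sum, det_bracketMat]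
    have h1 : ((-1) ^ ((k : ℕ) + 1 + 1) * (corner (upperMat (MvPolynomial.X (R := 𝔽))) k).det)
        = ((-1) ^ ((k : ℕ) + 1 + 1) : 𝔽) • (corner (upperMat (MvPolynomial.X (R := 𝔽))) k).det := by
      rw [MvPolynomial.smul_eq_C_mul]
      simp
    rw [h1, map_smul, Finset.sum_const, Finset.card_univ, Fintype.card_fin,
      ← Nat.cast_smul_eq_nsmul 𝔽, smul_smul, smul_smul, hs, ← hT]
    push_cast
    congr 1
  have hb : detBefore (bordered (upperMat (ugen γ)) k i) = D + s • T := by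
    rw [← hsum, hD, symmetrize_det_eq_sum, detBefore, Finset.smul_sum, ← Finset.sum_add_distrib]
    refine Finset.sum_congr rfl fun σ _ => ?_
    rw [(symmetrize_bordered_term γ hi σ).1, smul_add, smul_comm]
  have ha : detAfter (bordered (upperMat (ugen γ)) k i) = D - s • T := by
    rw [← hsum, hD, symmetrize_det_eq_sum, detAfter, Finset.smul_sum, ← Finset.sum_sub_distrib]
    refine Finset.sum_congr rfl fun σ _ => ?_
    rw [(symmetrize_bordered_term γ hi σ).2, smul_sub, smul_comm]
  rw [borderedPoly, map_add, map_smul, ← hD, ← hT, ← hs]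
  cases o
  · change _ = detBefore _
    rw [hb, orderSign, one_mul]
  · change _ = detAfter _
    rw [ha, orderSign, neg_one_mul, neg_smul, sub_eq_add_neg]
  · change _ = (2⁻¹ : 𝔽) • (detBefore _ + detAfter _)
    rw [hb, ha, orderSign, zero_mul, zero_smul, add_zero, add_add_sub_cancel, ← two_smul 𝔽,
      smul_smul, inv_mul_cancel₀ two_ne_zero, one_smul]

end Bordered

/-! ### Density of the domain -/

/-- The point with the coordinates `1` on the antidiagonal and `0` elsewhere; all its corner minors
are `±1`. -/
def antiPoint (𝔽 : Type*) [RCLike 𝔽] (n : ℕ) : Idx n → 𝔽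
  | none => 0
  | some p => if p.1.2 = Fin.rev p.1.1 then 1 else 0

theorem det_corner_antiPoint_ne_zero (k : Fin (n / 2)) :
    (corner (upperMat (antiPoint 𝔽 n)) k).det ≠ 0 := by
  have h : corner (upperMat (antiPoint 𝔽 n)) k
      = (1 : Matrix (Fin (k + 1)) (Fin (k + 1)) 𝔽).submatrix Fin.revPerm id := by
    ext a b
    rw [corner_upperMat, Matrix.submatrix_apply, Matrix.one_apply]
    refine if_congr ?_ rfl rfl
    simp only [firstRows, lastCols, Fin.ext_iff, Fin.val_rev, Fin.revPerm_apply, id]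
    omega
  rw [h, Matrix.det_permute, Matrix.det_one, mul_one]
  exact_mod_cast Units.ne_zero _

theorem dense_regularDomain : Dense (regularDomain 𝔽 n) := by
  intro x
  -- Along the line `x + t • antiPoint` each minor is a polynomial in `t` with a nonzero
  -- coefficient of the highest possible degree.
  let p : Fin (n / 2) → Polynomial 𝔽 := fun k =>
    ((Polynomial.X : Polynomial 𝔽) • (corner (upperMat (antiPoint 𝔽 n)) k).map Polynomial.C
      + (corner (upperMat x) k).map Polynomial.C).det
  have hp : ∀ k, p k ≠ 0 := fun k h => det_corner_antiPoint_ne_zero (𝔽 := 𝔽) k (by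
    rw [← Polynomial.coeff_det_X_add_C_card _ (corner (upperMat x) k)]
    change (p k).coeff _ = 0
    rw [h, Polynomial.coeff_zero])
  have heval : ∀ k t, (p k).eval t = (corner (upperMat (x + t • antiPoint 𝔽 n)) k).det := by
    intro k t
    rw [← Polynomial.coe_evalRingHom, RingHom.map_det]
    congr 1
    ext a b
    simp [corner_upperMat, mul_comm t, add_comm (x _)]
  have hfin : {t | (∏ k, p k).IsRoot t}.Finite :=
    Polynomial.finite_setOfPred_isRoot (Finset.prod_ne_zero_iff.mpr fun k _ => hp k)
  have hd : Dense {t | (∏ k, p k).IsRoot t}ᶜ := hfin.countable.dense_compl 𝔽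
  have hc : Continuous fun t : 𝔽 => x + t • antiPoint 𝔽 n := by fun_prop
  have h0 := map_mem_closure hc (hd 0) (t := regularDomain 𝔽 n) (fun t ht k => by
    rw [← heval k t]
    intro h
    refine ht ?_
    change (∏ k, p k).eval t = 0
    rw [Polynomial.eval_prod]
    exact Finset.prod_eq_zero (Finset.mem_univ k) h)
  simpa using h0

/-! ### The polynomials behind the expressions -/

theorem eval_upperMat_X (x : Idx n → 𝔽) (i j : Fin n) :
    MvPolynomial.eval x (upperMat MvPolynomial.X i j) = upperMat x i j := by
  rcases lt_or_ge i j with h | h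
  · rw [upperMat_apply_of_lt _ h, upperMat_apply_of_lt _ h, MvPolynomial.eval_X]
  · rw [upperMat_apply_of_le _ h, upperMat_apply_of_le _ h, map_zero]

theorem eval_det_corner (x : Idx n → 𝔽) (k : Fin (n / 2)) :
    MvPolynomial.eval x (corner (upperMat MvPolynomial.X) k).det = minor k x := by
  rw [RingHom.map_det, minor]
  congr 1
  ext a b
  exact eval_upperMat_X x _ _

theorem eval_det_bordered (x : Idx n → 𝔽) (k : Fin (n / 2)) (i : Fin n) :
    MvPolynomial.eval x (bordered (upperMat MvPolynomial.X) k i).det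
      = (bordered (upperMat x) k i).det := by
  rw [RingHom.map_det]
  congr 1
  ext a b
  refine Fin.lastCases ?_ (fun a' => ?_) a <;> refine Fin.cases ?_ (fun b' => ?_) b <;>
    simp [bordered, eval_upperMat_X]

theorem eval_borderedPoly (x : Idx n → 𝔽) (o : FactorOrder) (k : Fin (n / 2)) (i : Fin n) :
    MvPolynomial.eval x (borderedPoly o k i) = (bordered (upperMat x) k i).det
      + orderSign o * (2⁻¹ * ((k : 𝔽) + 1) * (-1) ^ ((k : ℕ) + 1 + 1)) * minor k x := by
  rw [borderedPoly, map_add, MvPolynomial.smul_eval, eval_det_corner, eval_det_bordered]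

theorem det_mem_supported {S : Set (Idx n)} {m : ℕ}
    {M : Matrix (Fin m) (Fin m) (MvPolynomial (Idx n) 𝔽)}
    (h : ∀ a b, M a b ∈ MvPolynomial.supported 𝔽 S) : M.det ∈ MvPolynomial.supported 𝔽 S := by
  rw [Matrix.det_apply]
  exact Subalgebra.sum_mem _ fun σ _ => Subalgebra.zsmul_mem _
    (Subalgebra.prod_mem _ fun b _ => h _ _) _

theorem upperMat_X_mem_supported {S : Set (Idx n)} {i j : Fin n}
    (h : ∀ hij : i < j, some ⟨(i, j), hij⟩ ∈ S) :
    upperMat (MvPolynomial.X (R := 𝔽)) i j ∈ MvPolynomial.supported 𝔽 S := by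
  rcases lt_or_ge i j with hij | hij
  · rw [upperMat_apply_of_lt _ hij]
    exact Algebra.subset_adjoin ⟨_, h hij, rfl⟩
  · rw [upperMat_apply_of_le _ hij]
    exact Subalgebra.zero_mem _

/-- The labels of the entries of the corner. -/
def cornerSet (k : Fin (n / 2)) : Set (Idx n) :=
  {a | ∃ p, a = some p ∧ (p.1.1 : ℕ) ≤ k ∧ n ≤ (p.1.2 : ℕ) + k + 1}

/-- The labels `(i, j)` such that `i` is not one of the last `k + 1` and `j` is not one of the
first `k + 1` indices. They contain the labels of the entries of the bordered corners. -/
def borderSet (k : Fin (n / 2)) : Set (Idx n) :=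
  {a | ∃ p, a = some p ∧ (p.1.1 : ℕ) + k + 1 < n ∧ (k : ℕ) < p.1.2}

theorem vars_det_corner (k : Fin (n / 2)) :
    ↑(corner (upperMat (MvPolynomial.X (R := 𝔽))) k).det.vars ⊆ cornerSet k := by
  refine MvPolynomial.mem_supported.mp (det_mem_supported fun a b => upperMat_X_mem_supported
    fun hij => ⟨_, rfl, ?_⟩)
  simp only [firstRows, lastCols]
  omega

theorem cornerSet_subset_borderSet (k : Fin (n / 2)) : cornerSet k ⊆ borderSet k := by
  rintro _ ⟨p, rfl, h1, h2⟩
  exact ⟨p, rfl, by omega, by omega⟩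

theorem borderedPoly_mem_supported {k : Fin (n / 2)} {i : Fin n} (hi : i ∈ middle k)
    (o : FactorOrder) :
    borderedPoly (𝔽 := 𝔽) o k i ∈ MvPolynomial.supported 𝔽 (borderSet k) := by
  obtain ⟨h1, h2⟩ : (k : ℕ) < i ∧ (i : ℕ) + k + 1 < n := by simpa [middle] using hi
  refine Subalgebra.add_mem _ (det_mem_supported fun a b => ?_) (Subalgebra.smul_mem _
    (MvPolynomial.mem_supported.mpr ((vars_det_corner k).trans (cornerSet_subset_borderSet k))) _)
  refine Fin.lastCases ?_ (fun a' => ?_) a <;> refine Fin.cases ?_ (fun b' => ?_) b <;>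
    simp only [bordered, Matrix.of_apply, Fin.lastCases_last, Fin.lastCases_castSucc,
      Fin.cases_zero, Fin.cases_succ]
  · exact Subalgebra.zero_mem _
  all_goals
    refine upperMat_X_mem_supported fun hij => ⟨_, rfl, ?_⟩
    simp only [firstRows, lastCols]
    omega

theorem gen_lie_eq_zero_of_mem (γ : Fin n → 𝔽) {j k : Fin (n / 2)} {a b : Idx n}
    (ha : a ∈ cornerSet j) (hb : b ∈ cornerSet k) : ⁅gen γ a, gen γ b⁆ = 0 := by
  obtain ⟨p, rfl, hp1, hp2⟩ := ha
  obtain ⟨q, rfl, hq1, hq2⟩ := hb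
  exact gen_lie_eq_zero γ (fun h => by rw [h] at hp2; omega) (fun h => by rw [h] at hq2; omega)

theorem gen_lie_eq_zero_of_mem_borderSet (γ : Fin n → 𝔽) {k : Fin (n / 2)} {a b : Idx n}
    (ha : a ∈ cornerSet k) (hb : b ∈ borderSet k) : ⁅gen γ a, gen γ b⁆ = 0 := by
  obtain ⟨p, rfl, hp1, hp2⟩ := ha
  obtain ⟨q, rfl, hq1, hq2⟩ := hb
  exact gen_lie_eq_zero γ (fun h => by rw [h] at hp2; omega) (fun h => by rw [h] at hq2; omega)

/-! ### The expressions as symmetrizations -/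

theorem symmetrize_one (γ : Fin n → 𝔽) : symmetrize γ 1 = 1 := by
  have h := symmetrize_of_commute γ (l := []) (by simp)
  simpa using h

theorem symmetrize_X (γ : Fin n → 𝔽) (a : Idx n) :
    symmetrize γ (MvPolynomial.X a) = ugen γ a := by
  have h := symmetrize_of_commute γ (l := [a]) (by simp)
  simpa using h

theorem isSymmetrization_minorExpr (γ : Fin n → 𝔽) (o : FactorOrder) (k : Fin (n / 2)) :
    IsSymmetrization (minorExpr γ o k) (minor k) := by
  refine ⟨fun _ => 1, fun _ => (corner (upperMat MvPolynomial.X) k).det, fun _ =>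
    ⟨symmetrize_one γ, symmetrize_det_corner γ k o⟩, fun _ a ha => ?_, ?_⟩
  · simp at ha
  · funext x
    change _ = ∑ _ : Unit, _
    simp [minorExpr, eval_det_corner]

theorem isSymmetrization_powerExpr (γ : Fin n → 𝔽) (o : FactorOrder) (k₀ k : Fin (n / 2))
    (P : 𝔽 → 𝔽) :
    IsSymmetrization (powerExpr γ o k₀ k P) (fun x => P (minor k₀ x) * minor k x) := by
  refine ⟨fun _ => (corner (upperMat MvPolynomial.X) k₀).det,
    fun _ => (corner (upperMat MvPolynomial.X) k).det, fun _ =>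
    ⟨symmetrize_det_corner γ k₀ o, symmetrize_det_corner γ k o⟩, fun _ a ha b hb => ?_, ?_⟩
  · rcases Finset.mem_union.mp hb with hb | hb
    · exact gen_lie_eq_zero_of_mem γ (vars_det_corner k₀ ha) (vars_det_corner k₀ hb)
    · exact gen_lie_eq_zero_of_mem γ (vars_det_corner k₀ ha) (vars_det_corner k hb)
  · funext x
    change _ = ∑ _ : Unit, _
    simp [powerExpr, eval_det_corner]

/-- The constants by which the order of the factors shifts the sums of bordered determinants, in
units of the corner minor. -/
def orderShift (o : FactorOrder) (k : Fin (n / 2)) : 𝔽 :=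
  (middle k).card * (orderSign o * (2⁻¹ * ((k : 𝔽) + 1) * (-1) ^ ((k : ℕ) + 1 + 1)))

theorem isSymmetrization_nilindepExpr (γ : Fin n → 𝔽) (o : FactorOrder) :
    IsSymmetrization (nilindepExpr γ o) (singFun γ (orderShift o)) := by
  refine ⟨fun j : Option (Fin (n / 2)) => j.elim 1
      fun k => (corner (upperMat MvPolynomial.X) k).det,
    fun j : Option (Fin (n / 2)) => j.elim (MvPolynomial.X none)
      fun k => ∑ i ∈ middle k, borderedPoly o k i, ?_, ?_, ?_⟩
  · rintro (_ | k)
    · exact ⟨symmetrize_one γ, symmetrize_X γ none⟩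
    · refine ⟨symmetrize_det_corner γ k o, ?_⟩
      simp only [Option.elim_some, map_sum]
      exact Finset.sum_congr rfl fun i hi => symmetrize_borderedPoly γ hi o
  · rintro (_ | k) a ha b hb
    · simp at ha
    · have ha' : a ∈ cornerSet k := vars_det_corner k ha
      refine gen_lie_eq_zero_of_mem_borderSet γ ha' ?_
      rcases Finset.mem_union.mp hb with hb | hb
      · exact cornerSet_subset_borderSet k (vars_det_corner k hb)
      · exact MvPolynomial.mem_supported.mp
          (Subalgebra.sum_mem _ fun i hi => borderedPoly_mem_supported hi o) hb
  · funext x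
    change _ = ∑ j : Option (Fin (n / 2)), _
    rw [Fintype.sum_option, singFun]
    congr 1
    · simp [nilindepExpr]
    · refine Finset.sum_congr rfl fun k _ => ?_
      simp only [nilindepExpr, Option.elim_some, eval_det_corner, map_sum, eval_borderedPoly]
      rw [Finset.sum_add_distrib, Finset.sum_const, nsmul_eq_mul, orderShift]
      simp only [mul_assoc]

end TriLie

theorem theorem2 {𝔽 : Type*} [RCLike 𝔽] (n : ℕ) (γ : Fin n → 𝔽) (hγ : ∃ i j, γ i ≠ γ j) :
    (IsOpen (regularDomain 𝔽 n) ∧ Dense (regularDomain 𝔽 n)) ∧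
    ((∀ k : Fin (n / 2), γ (row k) = γ (Fin.rev (row k))) →
      Fintype.card (Option (Fin (n / 2))) = n / 2 + 1 ∧
      ∀ o : FactorOrder, IsInvBasis hγ (regularDomain 𝔽 n) (singularBasis γ o)) ∧
    (∀ k₀ : Fin (n / 2), γ (row k₀) ≠ γ (Fin.rev (row k₀)) →
      (∀ k : Fin (n / 2), k < k₀ → γ (row k) = γ (Fin.rev (row k))) →
      Fintype.card {k : Fin (n / 2) // k ≠ k₀} = n / 2 - 1 ∧
      ∀ (o : FactorOrder) (V : Set 𝔽) (P : Fin (n / 2) → 𝔽 → 𝔽), IsOpen V →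
        (∀ k : Fin (n / 2), k₀ < k → IsPowerBranch (alpha γ k₀ k) V (P k)) →
        IsInvBasis hγ (regularDomain 𝔽 n ∩ {x | (corner (upperMat x) k₀).det ∈ V})
          (regularBasis γ o k₀ P)) := by
  refine ⟨⟨isOpen_regularDomain, dense_regularDomain⟩, fun hsym => ⟨by simp, fun o => ?_⟩,
    fun k₀ hne hlt => ⟨by simp, fun o V P hV hP => ?_⟩⟩
  · refine ⟨_, ?_, isFunctionalBasis_singular hγ hsym (orderShift o)⟩
    rintro (_ | k)
    · exact isSymmetrization_nilindepExpr γ o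
    · exact isSymmetrization_minorExpr γ o k
  · refine ⟨_, fun k => ?_, isFunctionalBasis_regular hγ hne hlt hV hP⟩
    by_cases hk : k.1 < k₀
    · have h : regFun k₀ P k.1 = minor k.1 := funext fun x => if_pos hk
      rw [h, regularBasis, if_pos hk]
      exact isSymmetrization_minorExpr γ o k.1
    · have h : regFun k₀ P k.1 = fun x => P k.1 (minor k₀ x) * minor k.1 x :=
        funext fun x => if_neg hk
      rw [h, regularBasis, if_neg hk]
      exact isSymmetrization_powerExpr γ o k₀ k.1 (P k.1)
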